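/- For real numbers $a_1,a_2,b_1,b_2,c_1,c_2,e$ and an integer $n\ge 0$ put $$J_3(a_1,a_2,b_1,b_2,c_1,c_2;e)(n)=\int_0^1\!\!\int_0^1\!\!\int_0^1 \frac{x^{a_1}(1-x)^{a_2}y^{b_1}(1-y)^{b_2}z^{c_1}(1-z)^{c_2}}{(1-z+xyz)^{e}}\left(\frac{x(1-x)y(1-y)z(1-z)}{1-z+xyz}\right)^{n}dx\,dy\,dz ,$$ $$I_3(a_1,a_2,b_1,b_2,c_1,c_2;e)(n)=\frac{J_3(a_1,a_2,b_1,b_2,c_1,c_2;e+1)(n)}{J_3(a_1,a_2,b_1,b_2,c_1,c_2;e)(0)},\qquad K(a,b,c,d,e)(n)=I_3(b,c,e,a,a,c;d)(n).$$ Call $(a_1,a_2,b_1,b_2,c_1,c_2;e)$ admissible if $a_1,a_2,b_1,b_2,c_1,c_2>-1$ and $e<c_2+1+\min(a_1,b_1)$, and call $(a,b,c,d,e)$ admissible if $(b,c,e,a,a,c;d)$ is, i.e. if $a,b,c,e>-1$ and $d<c+1+\min(b,e)$. (0) For admissible parameters the integrals defining $I_3(\cdot)(n)$, $n\ge0$,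 converge absolutely and the denominator is positive. (1) The seven-parameter family satisfies a third-order recurrence: there are polynomials $R_0,\dots,R_3$ with integer coefficients in $(a_1,a_2,b_1,b_2,c_1,c_2,e,n)$, with $R_0\neq0$ and $R_3\ne 0$, such that $\sum_{k=0}^3R_k\, I_3(a_1,a_2,b_1,b_2,c_1,c_2;e)(n+k)=0$ for all admissible parameters and all $n\ge0$. (2) It satisfies no second-order one: if $S_0,S_1,S_2$ are real polynomials in $(a_1,a_2,b_1,b_2,c_1,c_2,e,n)$ with $\sum_{k=0}^2S_k\, I_3(a_1,a_2,b_1,b_2,c_1,c_2;e)(n+k)=0$ for all admissible parameters and all $n\ge0$, then $S_0=S_1=S_2=0$. (3) The five-parameter family satisfies a second-order recurrence: there are polynomials $P_0,P_1,P_2$ with integer coefficients in $(a,b,c,d,e,n)$ such that for all admissible real $(a,b,c,d,e)$ and all $n\ge 0$ $$P_0(a,b,c,d,e,n)\,K(a,b,c,d,e)(n)+P_1(a,b,c,d,e,n)\,K(a,b,c,d,e)(n+1)+P_2(a,b,c,d,e,n)\,K(a,b,c,d,e)(n+2)=0 ,$$ and, for each admissible $(a,b,c,d,e)$, $P_0(a,b,c,d,e,n)\,P_2(a,b,c,d,e,n)\neq0$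 for all sufficiently large $n$; moreover this holds for every $n\ge0$ if none of the six numbers $d$, $a+c-d$, $a+e-d$, $a+e-b$, $b+c-e$, $b+c-a$ is a negative integer. (4) This recurrence yields Diophantine approximations to the constants $K(a,b,c,d,e)(0)$: with the same $P_0,P_1,P_2$, if $a,b,c,d,e$ are rational and admissible and none of these six numbers is a negative integer, then there are sequences $(A_n)$, $(B_n)$ of rational numbers, both satisfying the recurrence of (3), with $K(a,b,c,d,e)(n)=B_n\,K(a,b,c,d,e)(0)-A_n$ for all $n\ge0$ and $A_n/B_n\to K(a,b,c,d,e)(0)$. -/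

import Mathlib

open MeasureTheory Filter Topology

noncomputable section

/-- The open unit cube `(0,1)³`. -/
def unitCube : Set (ℝ × ℝ × ℝ) :=
  Set.Ioo 0 1 ×ˢ Set.Ioo 0 1 ×ˢ Set.Ioo 0 1

/-- The integrand of `J₃`, with real exponents `a₁, …, c₂, e` and a natural exponent `n`. -/
def J3Integrand (a₁ a₂ b₁ b₂ c₁ c₂ e : ℝ) (n : ℕ) (p : ℝ × ℝ × ℝ) : ℝ :=
  let x := p.1
  let y := p.2.1
  let z := p.2.2
  x ^ a₁ * (1 - x) ^ a₂ * y ^ b₁ * (1 - y) ^ b₂ * z ^ c₁ * (1 - z) ^ c₂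
      / (1 - z + x * y * z) ^ e
    * (x * (1 - x) * y * (1 - y) * z * (1 - z) / (1 - z + x * y * z)) ^ n

/-- `J₃(a₁,a₂,b₁,b₂,c₁,c₂;e)(n)`. -/
def J3 (a₁ a₂ b₁ b₂ c₁ c₂ e : ℝ) (n : ℕ) : ℝ :=
  ∫ p in unitCube, J3Integrand a₁ a₂ b₁ b₂ c₁ c₂ e n p

/-- `I₃(a₁,a₂,b₁,b₂,c₁,c₂;e)(n)`. -/
def I3 (a₁ a₂ b₁ b₂ c₁ c₂ e : ℝ) (n : ℕ) : ℝ :=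
  J3 a₁ a₂ b₁ b₂ c₁ c₂ (e + 1) n / J3 a₁ a₂ b₁ b₂ c₁ c₂ e 0

/-- The five-parameter family `K(a,b,c,d,e)(n) = I₃(b,c,e,a,a,c;d)(n)`. -/
def KFamily (a b c d e : ℝ) (n : ℕ) : ℝ :=
  I3 b c e a a c d n

/-- The range of parameters in which the integrals defining `I₃(a₁,a₂,b₁,b₂,c₁,c₂;e)(0)` converge. -/
def Admissible (a₁ a₂ b₁ b₂ c₁ c₂ e : ℝ) : Prop :=
  -1 < a₁ ∧ -1 < a₂ ∧ -1 < b₁ ∧ -1 < b₂ ∧ -1 < c₁ ∧ -1 < c₂ ∧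
    e < a₁ + c₂ + 1 ∧ e < b₁ + c₂ + 1

/-- None of `d`, `a+c-d`, `a+e-d`, `a+e-b`, `b+c-e`, `b+c-a` is a negative integer. -/
def Nondegenerate (a b c d e : ℝ) : Prop :=
  ∀ m : ℕ, d ≠ -(m + 1) ∧ a + c - d ≠ -(m + 1) ∧ a + e - d ≠ -(m + 1) ∧
    a + e - b ≠ -(m + 1) ∧ b + c - e ≠ -(m + 1) ∧ b + c - a ≠ -(m + 1)

end

/-!
All integrals in question are values of one function of real parameters, the Euler integral
`eulerInt a₁ a₂ b₁ b₂ c₁ c₂ e`, which converges if `a₁, a₂, b₁, b₂, c₁, c₂ > -1` and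
`e < c₂ + 2 + min(a₁, b₁)`, because `1 - z + xyz` dominates both `1 - z` and `xy`. With `θ = t d/dt` at
`t = xy`, integrating the weight without its denominator against `q(θ) (1 - z + tz)^(-e)` is a
linear functional `eulerFun` of the polynomial `q`. Raising or lowering a parameter corresponds to
multiplying `q` by a linear form, and integration by parts makes the functional vanish on the exact
polynomials `U(X) q(X + 1) - V(X) q(X)`, with `U` and `V` monic of degree four (`eulerFun_exact`).
A recurrence is thus a congruence between explicit polynomials modulo exact ones.

*The second-order recurrence.* For the parameters `(b, c, e, a, a, c; d)` two such congruences have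
an explicit certificate (`certificate_fst`, `certificate_snd`); they relate the integrals `F(d)` and
`F(d + 1)` to their shifts by one in all parameters. The certificates divide by factors that may
vanish, but along a line in the parameter space the integral is a moment generating function, hence
analytic (`analyticOnNhd_eulerInt`), so both relations hold on the whole admissible range
(`contiguity_fst`, `contiguity_snd`). Eliminating `F(d)` gives the recurrence, whose outer
coefficients are products of linear forms and of the factor `kRho`, which is positive on the
admissible range (`kRho_pos`). The approximations `A n / B n` converge since `K` decays
geometrically while the Casoratian of `A` and `B` changes by factors tending to `1`
(`tendsto_div_of_casoratian`).

*The third-order recurrence.* Four consecutive shifts of the Euler integral and ten exact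
polynomials all have representatives of degree at most `12`, so they are linearly dependent over
the ring of parameters; as `q ↦ U(X) q(X + 1) - V(X) q(X)` is injective, the relation involves a
shift (`exists_third_order_relation`). If an outer coefficient vanished, a second-order recurrence
would remain.

*No second-order recurrence.* By analyticity along the diagonal, a recurrence makes the Euler
integral and its first two shifts linearly dependent over the polynomials in the seven parameters;
after division by a power of the variable of a line, the relation can be specialised to
`a₂ = b₂ = c₂ = 0`, `c₁ = 1` and exponent `0` of the denominator. There the integrals are
combinations of `1`, `psi α`, `psi β` with rational coefficients, where `psi b` is the trigamma
function at `b + 1`. The difference equation `(b + 1)² (psi b - psi (b + 1)) = const` shows that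
`psi` is not a rational function (`eq_zero_of_mul_psi_eq`), so the coefficients of `psi α` and
`psi β` vanish separately, and the determinant of the resulting linear system is not zero
(`eq_zero_of_special_relation`).
-/

noncomputable section

open Polynomial

/-! ### The Euler-type integral and its convergence -/

/-- The denominator `1 - z + xyz` of the integrands. -/
def den (x y z : ℝ) : ℝ := 1 - z + x * y * z

/-- The weight `x^a₁ (1-x)^a₂ y^b₁ (1-y)^b₂ z^c₁ (1-z)^c₂ (1-z+xyz)^(-e)`. -/
def eulerWeight (a₁ a₂ b₁ b₂ c₁ c₂ e : ℝ) (p : ℝ × ℝ × ℝ) : ℝ :=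
  p.1 ^ a₁ * (1 - p.1) ^ a₂ * (p.2.1 ^ b₁ * (1 - p.2.1) ^ b₂ * (p.2.2 ^ c₁ * (1 - p.2.2) ^ c₂))
    * den p.1 p.2.1 p.2.2 ^ (-e)

/-- The Euler type integral of `eulerWeight` over the unit cube. -/
def eulerInt (a₁ a₂ b₁ b₂ c₁ c₂ e : ℝ) : ℝ :=
  ∫ p in unitCube, eulerWeight a₁ a₂ b₁ b₂ c₁ c₂ e p

/-- The parameters for which `eulerInt` converges. -/
def EulerDom (a₁ a₂ b₁ b₂ c₁ c₂ e : ℝ) : Prop :=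
  -1 < a₁ ∧ -1 < a₂ ∧ -1 < b₁ ∧ -1 < b₂ ∧ -1 < c₁ ∧ -1 < c₂ ∧
    e < a₁ + c₂ + 2 ∧ e < b₁ + c₂ + 2

theorem measurableSet_unitCube : MeasurableSet unitCube :=
  measurableSet_Ioo.prod (measurableSet_Ioo.prod measurableSet_Ioo)

theorem den_pos {x y z : ℝ} (hx : x ∈ Set.Ioo (0 : ℝ) 1) (hy : y ∈ Set.Ioo (0 : ℝ) 1)
    (hz : z ∈ Set.Ioo (0 : ℝ) 1) : 0 < den x y z := by
  have := mul_pos (mul_pos hx.1 hy.1) hz.1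
  have := hz.2
  unfold den; linarith

theorem den_le_one {x y z : ℝ} (hx : x ∈ Set.Ioo (0 : ℝ) 1) (hy : y ∈ Set.Ioo (0 : ℝ) 1)
    (hz : z ∈ Set.Ioo (0 : ℝ) 1) : den x y z ≤ 1 := by
  have h1 : x * y ≤ 1 := by nlinarith [hx.1, hx.2, hy.1, hy.2]
  have := hz.1
  unfold den; nlinarith

theorem one_sub_le_den {x y z : ℝ} (hx : x ∈ Set.Ioo (0 : ℝ) 1) (hy : y ∈ Set.Ioo (0 : ℝ) 1)
    (hz : z ∈ Set.Ioo (0 : ℝ) 1) : 1 - z ≤ den x y z := by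
  have := mul_pos (mul_pos hx.1 hy.1) hz.1
  unfold den; linarith

theorem mul_le_den {x y z : ℝ} (hx : x ∈ Set.Ioo (0 : ℝ) 1) (hy : y ∈ Set.Ioo (0 : ℝ) 1)
    (hz : z ∈ Set.Ioo (0 : ℝ) 1) : x * y ≤ den x y z := by
  have h1 : x * y ≤ 1 := by nlinarith [hx.1, hx.2, hy.1, hy.2]
  have := hz.2
  unfold den; nlinarith

theorem eulerWeight_pos {a₁ a₂ b₁ b₂ c₁ c₂ e : ℝ} {p : ℝ × ℝ × ℝ} (hp : p ∈ unitCube) :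
    0 < eulerWeight a₁ a₂ b₁ b₂ c₁ c₂ e p := by
  obtain ⟨hx, hy, hz⟩ := hp
  have hD := den_pos hx hy hz
  have := hx.1; have := sub_pos.2 hx.2
  have := hy.1; have := sub_pos.2 hy.2
  have := hz.1; have := sub_pos.2 hz.2
  unfold eulerWeight; positivity

@[fun_prop]
theorem measurable_eulerWeight (a₁ a₂ b₁ b₂ c₁ c₂ e : ℝ) :
    Measurable (eulerWeight a₁ a₂ b₁ b₂ c₁ c₂ e) := by
  unfold eulerWeight den; fun_prop

theorem integrableOn_rpow_mul_one_sub_rpow {a b : ℝ} (ha : -1 < a) (hb : -1 < b) :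
    IntegrableOn (fun x : ℝ => x ^ a * (1 - x) ^ b) (Set.Ioo 0 1) := by
  have h := (Complex.betaIntegral_convergent (u := ((a + 1 : ℝ) : ℂ)) (v := ((b + 1 : ℝ) : ℂ))
    (by simp; linarith) (by simp; linarith)).norm
  rw [intervalIntegrable_iff_integrableOn_Ioo_of_le zero_le_one] at h
  refine h.congr_fun (fun x hx => ?_) measurableSet_Ioo
  have h1 : (0 : ℝ) < 1 - x := sub_pos.2 hx.2
  have e1 : (1 : ℂ) - (x : ℂ) = ((1 - x : ℝ) : ℂ) := by push_cast; rfl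
  simp only [norm_mul]
  rw [Complex.norm_cpow_eq_rpow_re_of_pos hx.1, e1, Complex.norm_cpow_eq_rpow_re_of_pos h1]
  simp

theorem integrableOn_unitCube_mul {f g h : ℝ → ℝ} (hf : IntegrableOn f (Set.Ioo 0 1))
    (hg : IntegrableOn g (Set.Ioo 0 1)) (hh : IntegrableOn h (Set.Ioo 0 1)) :
    IntegrableOn (fun p : ℝ × ℝ × ℝ => f p.1 * (g p.2.1 * h p.2.2)) unitCube := by
  unfold IntegrableOn unitCube
  rw [Measure.volume_eq_prod, ← Measure.prod_restrict, Measure.volume_eq_prod,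
    ← Measure.prod_restrict]
  exact Integrable.mul_prod hf (Integrable.mul_prod hg hh)

/-- An exponent of the denominator can be split so that the three beta integrals of
`integrableOn_eulerWeight` converge. -/
theorem exists_split_exponent {a b c e : ℝ} (ha : -1 < a) (hb : -1 < b) (hc : -1 < c)
    (h1 : e < a + c + 2) (h2 : e < b + c + 2) :
    ∃ u v : ℝ, 0 ≤ u ∧ 0 ≤ v ∧ e ≤ u + v ∧ u < c + 1 ∧ v < a + 1 ∧ v < b + 1 := by
  obtain ⟨u, hu1, hu2⟩ : ∃ u, max 0 (max (e - (a + 1)) (e - (b + 1))) < u ∧ u < c + 1 :=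
    exists_between (by simp only [max_lt_iff]; exact ⟨by linarith, by linarith, by linarith⟩)
  simp only [max_lt_iff] at hu1
  refine ⟨u, max 0 (e - u), hu1.1.le, le_max_left _ _, ?_, hu2, ?_, ?_⟩
  · linarith [le_max_right 0 (e - u)]
  · simp only [max_lt_iff]; exact ⟨by linarith, by linarith⟩
  · simp only [max_lt_iff]; exact ⟨by linarith, by linarith⟩

/-- Since `1 - z + xyz` dominates both `1 - z` and `xy`, a power of it can be split between
these two, which reduces convergence to that of three beta integrals. -/
theorem integrableOn_eulerWeight {a₁ a₂ b₁ b₂ c₁ c₂ e : ℝ}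
    (h : EulerDom a₁ a₂ b₁ b₂ c₁ c₂ e) :
    IntegrableOn (eulerWeight a₁ a₂ b₁ b₂ c₁ c₂ e) unitCube := by
  obtain ⟨ha₁, ha₂, hb₁, hb₂, hc₁, hc₂, h1, h2⟩ := h
  obtain ⟨u, v, hu, hv, huv, huc, hva, hvb⟩ := exists_split_exponent ha₁ hb₁ hc₂ h1 h2
  have hint := integrableOn_unitCube_mul
    (integrableOn_rpow_mul_one_sub_rpow (a := a₁ - v) (by linarith) ha₂)
    (integrableOn_rpow_mul_one_sub_rpow (a := b₁ - v) (by linarith) hb₂)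
    (integrableOn_rpow_mul_one_sub_rpow (b := c₂ - u) hc₁ (by linarith))
  refine hint.mono' (measurable_eulerWeight ..).aestronglyMeasurable ?_
  refine (ae_restrict_mem measurableSet_unitCube).mono fun p hp => ?_
  rw [Real.norm_of_nonneg (eulerWeight_pos hp).le]
  obtain ⟨hx, hy, hz⟩ := hp
  have hD := den_pos hx hy hz
  have hx0 := hx.1; have hx1 := sub_pos.2 hx.2
  have hy0 := hy.1; have hy1 := sub_pos.2 hy.2
  have hz0 := hz.1; have hz1 := sub_pos.2 hz.2
  set x := p.1
  set y := p.2.1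
  set z := p.2.2
  have hbound : den x y z ^ (-e) ≤ (1 - z) ^ (-u) * (x ^ (-v) * y ^ (-v)) := by
    calc den x y z ^ (-e) ≤ den x y z ^ (-u + -v) :=
          Real.rpow_le_rpow_of_exponent_ge hD (den_le_one hx hy hz) (by linarith)
      _ = den x y z ^ (-u) * den x y z ^ (-v) := Real.rpow_add hD _ _
      _ ≤ (1 - z) ^ (-u) * (x * y) ^ (-v) := by
          gcongr ?_ * ?_
          · exact Real.rpow_le_rpow_of_nonpos hz1 (one_sub_le_den hx hy hz) (by linarith)
          · exact Real.rpow_le_rpow_of_nonpos (mul_pos hx0 hy0) (mul_le_den hx hy hz)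
              (by linarith)
      _ = _ := by rw [Real.mul_rpow hx0.le hy0.le]
  calc eulerWeight a₁ a₂ b₁ b₂ c₁ c₂ e p
      ≤ x ^ a₁ * (1 - x) ^ a₂ * (y ^ b₁ * (1 - y) ^ b₂ * (z ^ c₁ * (1 - z) ^ c₂))
        * ((1 - z) ^ (-u) * (x ^ (-v) * y ^ (-v))) := by
        unfold eulerWeight; gcongr
    _ = _ := by
        rw [sub_eq_add_neg a₁, sub_eq_add_neg b₁, sub_eq_add_neg c₂, Real.rpow_add hx0,
          Real.rpow_add hy0, Real.rpow_add hz1]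
        ring

theorem volume_unitCube_pos : 0 < volume unitCube := by
  refine IsOpen.measure_pos volume (isOpen_Ioo.prod (isOpen_Ioo.prod isOpen_Ioo)) ?_
  exact ⟨(1/2, 1/2, 1/2), by norm_num [unitCube]⟩

theorem eulerInt_pos {a₁ a₂ b₁ b₂ c₁ c₂ e : ℝ} (h : EulerDom a₁ a₂ b₁ b₂ c₁ c₂ e) :
    0 < eulerInt a₁ a₂ b₁ b₂ c₁ c₂ e := by
  unfold eulerInt
  rw [setIntegral_pos_iff_support_of_nonneg_ae]
  · refine volume_unitCube_pos.trans_le (measure_mono fun p hp => ⟨?_, hp⟩)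
    exact (eulerWeight_pos hp).ne'
  · exact (ae_restrict_mem measurableSet_unitCube).mono fun p hp => (eulerWeight_pos hp).le
  · exact integrableOn_eulerWeight h

theorem J3Integrand_eq_eulerWeight (a₁ a₂ b₁ b₂ c₁ c₂ e : ℝ) (n : ℕ) {p : ℝ × ℝ × ℝ}
    (hp : p ∈ unitCube) :
    J3Integrand a₁ a₂ b₁ b₂ c₁ c₂ e n p =
      eulerWeight (a₁ + n) (a₂ + n) (b₁ + n) (b₂ + n) (c₁ + n) (c₂ + n) (e + n) p := by
  obtain ⟨hx, hy, hz⟩ := hp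
  have hD := den_pos hx hy hz
  have hx0 := hx.1; have hx1 := sub_pos.2 hx.2
  have hy0 := hy.1; have hy1 := sub_pos.2 hy.2
  have hz0 := hz.1; have hz1 := sub_pos.2 hz.2
  simp only [J3Integrand, eulerWeight]
  rw [Real.rpow_add_natCast hx0.ne', Real.rpow_add_natCast hx1.ne',
    Real.rpow_add_natCast hy0.ne', Real.rpow_add_natCast hy1.ne',
    Real.rpow_add_natCast hz0.ne', Real.rpow_add_natCast hz1.ne', Real.rpow_neg hD.le,
    Real.rpow_add_natCast hD.ne']
  rw [show 1 - p.2.2 + p.1 * p.2.1 * p.2.2 = den p.1 p.2.1 p.2.2 from rfl, div_pow]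
  simp only [mul_pow]
  field_simp

theorem J3_eq_eulerInt (a₁ a₂ b₁ b₂ c₁ c₂ e : ℝ) (n : ℕ) :
    J3 a₁ a₂ b₁ b₂ c₁ c₂ e n =
      eulerInt (a₁ + n) (a₂ + n) (b₁ + n) (b₂ + n) (c₁ + n) (c₂ + n) (e + n) :=
  setIntegral_congr_fun measurableSet_unitCube fun _ hp =>
    J3Integrand_eq_eulerWeight _ _ _ _ _ _ _ n hp

theorem Admissible.eulerDom {a₁ a₂ b₁ b₂ c₁ c₂ e : ℝ} (h : Admissible a₁ a₂ b₁ b₂ c₁ c₂ e)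
    {t : ℝ} (ht : 0 ≤ t) :
    EulerDom (a₁ + t) (a₂ + t) (b₁ + t) (b₂ + t) (c₁ + t) (c₂ + t) (e + 1 + t) := by
  obtain ⟨h1, h2, h3, h4, h5, h6, h7, h8⟩ := h
  refine ⟨?_, ?_, ?_, ?_, ?_, ?_, ?_, ?_⟩ <;> linarith

theorem Admissible.eulerDom_zero {a₁ a₂ b₁ b₂ c₁ c₂ e : ℝ}
    (h : Admissible a₁ a₂ b₁ b₂ c₁ c₂ e) : EulerDom a₁ a₂ b₁ b₂ c₁ c₂ e := by
  obtain ⟨h1, h2, h3, h4, h5, h6, h7, h8⟩ := h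
  refine ⟨?_, ?_, ?_, ?_, ?_, ?_, ?_, ?_⟩ <;> linarith

theorem Admissible.integrableOn_J3Integrand {a₁ a₂ b₁ b₂ c₁ c₂ e : ℝ}
    (h : Admissible a₁ a₂ b₁ b₂ c₁ c₂ e) (n : ℕ) :
    IntegrableOn (J3Integrand a₁ a₂ b₁ b₂ c₁ c₂ (e + 1) n) unitCube :=
  (integrableOn_eulerWeight (h.eulerDom n.cast_nonneg)).congr_fun
    (fun _ hp => (J3Integrand_eq_eulerWeight _ _ _ _ _ _ _ n hp).symm) measurableSet_unitCube

theorem Admissible.integrableOn_J3Integrand_zero {a₁ a₂ b₁ b₂ c₁ c₂ e : ℝ}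
    (h : Admissible a₁ a₂ b₁ b₂ c₁ c₂ e) :
    IntegrableOn (J3Integrand a₁ a₂ b₁ b₂ c₁ c₂ e 0) unitCube :=
  (integrableOn_eulerWeight h.eulerDom_zero).congr_fun
    (fun _ hp => by
      simpa using (J3Integrand_eq_eulerWeight a₁ a₂ b₁ b₂ c₁ c₂ e 0 hp).symm)
    measurableSet_unitCube

theorem J3_zero (a₁ a₂ b₁ b₂ c₁ c₂ e : ℝ) :
    J3 a₁ a₂ b₁ b₂ c₁ c₂ e 0 = eulerInt a₁ a₂ b₁ b₂ c₁ c₂ e := by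
  simpa using J3_eq_eulerInt a₁ a₂ b₁ b₂ c₁ c₂ e 0

theorem Admissible.J3_pos {a₁ a₂ b₁ b₂ c₁ c₂ e : ℝ}
    (h : Admissible a₁ a₂ b₁ b₂ c₁ c₂ e) : 0 < J3 a₁ a₂ b₁ b₂ c₁ c₂ e 0 := by
  rw [J3_zero]; exact eulerInt_pos h.eulerDom_zero

/-! ### Integration by parts -/

theorem restrict_unitCube : (volume.restrict unitCube : Measure (ℝ × ℝ × ℝ)) =
    (volume.restrict (Set.Ioo (0 : ℝ) 1)).prod
      ((volume.restrict (Set.Ioo (0 : ℝ) 1)).prod (volume.restrict (Set.Ioo (0 : ℝ) 1))) := by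
  rw [unitCube, Measure.volume_eq_prod, ← Measure.prod_restrict, Measure.volume_eq_prod,
    ← Measure.prod_restrict]

/-- The fundamental theorem of calculus on the open unit interval. -/
theorem integral_Ioo_of_hasDerivAt {h H : ℝ → ℝ} {l r : ℝ}
    (hint : IntegrableOn h (Set.Ioo 0 1))
    (hd : ∀ x ∈ Set.Ioo (0 : ℝ) 1, HasDerivAt H (h x) x)
    (h0 : Tendsto H (𝓝[>] 0) (𝓝 l)) (h1 : Tendsto H (𝓝[<] 1) (𝓝 r)) :
    ∫ x in Set.Ioo 0 1, h x = r - l := by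
  rw [← integral_Ioc_eq_integral_Ioo, ← intervalIntegral.integral_of_le zero_le_one]
  exact intervalIntegral.integral_eq_sub_of_hasDerivAt_of_tendsto zero_lt_one hd
    ((intervalIntegrable_iff_integrableOn_Ioo_of_le zero_le_one).2 hint) h0 h1

/-- Integration of an `x`-derivative over the cube leaves the boundary values at `x = 1`. -/
theorem integral_unitCube_of_hasDerivAt_fst {h : ℝ × ℝ × ℝ → ℝ} {B : ℝ × ℝ → ℝ}
    (hint : IntegrableOn h unitCube)
    (hH : ∀ y ∈ Set.Ioo (0 : ℝ) 1, ∀ z ∈ Set.Ioo (0 : ℝ) 1, ∃ H : ℝ → ℝ,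
      (∀ x ∈ Set.Ioo (0 : ℝ) 1, HasDerivAt H (h (x, y, z)) x) ∧
      Tendsto H (𝓝[>] 0) (𝓝 0) ∧ Tendsto H (𝓝[<] 1) (𝓝 (B (y, z)))) :
    ∫ p in unitCube, h p = ∫ q in Set.Ioo (0 : ℝ) 1 ×ˢ Set.Ioo (0 : ℝ) 1, B q := by
  rw [IntegrableOn, restrict_unitCube] at hint
  rw [restrict_unitCube, integral_prod_symm _ hint, Measure.volume_eq_prod,
    ← Measure.prod_restrict]
  refine integral_congr_ae ?_
  have hmem : ∀ᵐ q ∂((volume.restrict (Set.Ioo (0 : ℝ) 1)).prod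
      (volume.restrict (Set.Ioo (0 : ℝ) 1))), q ∈ Set.Ioo (0 : ℝ) 1 ×ˢ Set.Ioo (0 : ℝ) 1 := by
    rw [Measure.prod_restrict]
    exact ae_restrict_mem (measurableSet_Ioo.prod measurableSet_Ioo)
  filter_upwards [hint.prod_left_ae, hmem] with q hq hm
  obtain ⟨H, hd, h0, h1⟩ := hH q.1 hm.1 q.2 hm.2
  rw [integral_Ioo_of_hasDerivAt hq hd h0 h1, sub_zero]

/-- The integral over the cube of a `z`-derivative vanishes if the boundary values do. -/
theorem integral_unitCube_of_hasDerivAt_snd {h : ℝ × ℝ × ℝ → ℝ}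
    (hint : IntegrableOn h unitCube)
    (hH : ∀ x ∈ Set.Ioo (0 : ℝ) 1, ∀ y ∈ Set.Ioo (0 : ℝ) 1, ∃ H : ℝ → ℝ,
      (∀ z ∈ Set.Ioo (0 : ℝ) 1, HasDerivAt H (h (x, y, z)) z) ∧
      Tendsto H (𝓝[>] 0) (𝓝 0) ∧ Tendsto H (𝓝[<] 1) (𝓝 0)) :
    ∫ p in unitCube, h p = 0 := by
  rw [IntegrableOn, restrict_unitCube] at hint
  rw [restrict_unitCube, integral_prod _ hint]
  refine integral_eq_zero_of_ae ?_
  filter_upwards [hint.prod_right_ae, ae_restrict_mem measurableSet_Ioo] with x hx hxm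
  rw [integral_prod _ hx]
  refine integral_eq_zero_of_ae ?_
  filter_upwards [hx.prod_right_ae, ae_restrict_mem measurableSet_Ioo] with y hy hym
  obtain ⟨H, hd, h0, h1⟩ := hH x hxm y hym
  rw [integral_Ioo_of_hasDerivAt hy hd h0 h1, sub_zero]
  rfl

theorem eulerInt_swap (a₁ a₂ b₁ b₂ c₁ c₂ e : ℝ) :
    eulerInt b₁ b₂ a₁ a₂ c₁ c₂ e = eulerInt a₁ a₂ b₁ b₂ c₁ c₂ e := by
  have hm : MeasurePreserving (fun p : ℝ × ℝ × ℝ => (p.2.1, p.1, p.2.2)) volume volume := by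
    have h1 : MeasurePreserving (MeasurableEquiv.prodAssoc (α := ℝ) (β := ℝ) (γ := ℝ))
        volume volume := measurePreserving_prodAssoc _ _ _
    have h2 : MeasurePreserving (Prod.map Prod.swap id : (ℝ × ℝ) × ℝ → (ℝ × ℝ) × ℝ)
        volume volume :=
      MeasurePreserving.prod Measure.measurePreserving_swap (MeasurePreserving.id _)
    exact (h1.comp h2).comp h1.symm
  have he : MeasurableEmbedding (fun p : ℝ × ℝ × ℝ => (p.2.1, p.1, p.2.2)) :=
    MeasurableEquiv.measurableEmbedding
      { toFun := fun p : ℝ × ℝ × ℝ => (p.2.1, p.1, p.2.2)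
        invFun := fun p : ℝ × ℝ × ℝ => (p.2.1, p.1, p.2.2)
        left_inv := fun _ => rfl
        right_inv := fun _ => rfl
        measurable_toFun := by dsimp; fun_prop
        measurable_invFun := by dsimp; fun_prop }
  have hs : (fun p : ℝ × ℝ × ℝ => (p.2.1, p.1, p.2.2)) ⁻¹' unitCube = unitCube := by
    ext ⟨x, y, z⟩
    simp only [unitCube, Set.mem_preimage, Set.mem_prod]
    tauto
  have := hm.setIntegral_preimage_emb he (eulerWeight b₁ b₂ a₁ a₂ c₁ c₂ e) unitCube
  rw [hs] at this
  unfold eulerInt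
  rw [← this]
  congr 1
  funext p
  simp only [eulerWeight, den]
  rw [mul_comm p.2.1 p.1]
  ring

theorem EulerDom.swap {a₁ a₂ b₁ b₂ c₁ c₂ e : ℝ} (h : EulerDom a₁ a₂ b₁ b₂ c₁ c₂ e) :
    EulerDom b₁ b₂ a₁ a₂ c₁ c₂ e := by
  obtain ⟨h1, h2, h3, h4, h5, h6, h7, h8⟩ := h
  exact ⟨h3, h4, h1, h2, h5, h6, h8, h7⟩

/-- Linear relations between Euler integrals, from relations between their integrands. -/
theorem eulerInt_add {a₁ a₂ b₁ b₂ c₁ c₂ e : ℝ} {f g : ℝ × ℝ × ℝ → ℝ}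
    (hf : IntegrableOn f unitCube) (hg : IntegrableOn g unitCube)
    (h : ∀ p ∈ unitCube, eulerWeight a₁ a₂ b₁ b₂ c₁ c₂ e p = f p + g p) :
    eulerInt a₁ a₂ b₁ b₂ c₁ c₂ e = (∫ p in unitCube, f p) + ∫ p in unitCube, g p := by
  rw [← integral_add hf hg]
  exact setIntegral_congr_fun measurableSet_unitCube h

section contiguity
variable {a₁ a₂ b₁ b₂ c₁ c₂ e : ℝ}

theorem eulerInt_split_fst (h : EulerDom a₁ a₂ b₁ b₂ c₁ c₂ e) :
    eulerInt a₁ a₂ b₁ b₂ c₁ c₂ e =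
      eulerInt (a₁ + 1) a₂ b₁ b₂ c₁ c₂ e + eulerInt a₁ (a₂ + 1) b₁ b₂ c₁ c₂ e := by
  obtain ⟨h1, h2, h3, h4, h5, h6, h7, h8⟩ := h
  refine eulerInt_add
    (integrableOn_eulerWeight ⟨by linarith, h2, h3, h4, h5, h6, by linarith, h8⟩)
    (integrableOn_eulerWeight ⟨h1, by linarith, h3, h4, h5, h6, h7, h8⟩) fun p hp => ?_
  obtain ⟨hx, hy, hz⟩ := hp
  simp only [eulerWeight]
  rw [Real.rpow_add_one hx.1.ne', Real.rpow_add_one (sub_pos.2 hx.2).ne']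
  ring

theorem eulerInt_split_trd (h : EulerDom a₁ a₂ b₁ b₂ c₁ c₂ e) :
    eulerInt a₁ a₂ b₁ b₂ c₁ c₂ e =
      eulerInt a₁ a₂ b₁ b₂ (c₁ + 1) c₂ e + eulerInt a₁ a₂ b₁ b₂ c₁ (c₂ + 1) e := by
  obtain ⟨h1, h2, h3, h4, h5, h6, h7, h8⟩ := h
  refine eulerInt_add
    (integrableOn_eulerWeight ⟨h1, h2, h3, h4, by linarith, h6, h7, h8⟩)
    (integrableOn_eulerWeight ⟨h1, h2, h3, h4, h5, by linarith, by linarith, by linarith⟩)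
    fun p hp => ?_
  obtain ⟨hx, hy, hz⟩ := hp
  simp only [eulerWeight]
  rw [Real.rpow_add_one hz.1.ne', Real.rpow_add_one (sub_pos.2 hz.2).ne']
  ring

/-- The relation expressing that the denominator is `(1 - z) + xyz`. -/
theorem eulerInt_split_den (h : EulerDom a₁ a₂ b₁ b₂ c₁ c₂ e) :
    eulerInt a₁ a₂ b₁ b₂ c₁ c₂ e =
      eulerInt a₁ a₂ b₁ b₂ c₁ (c₂ + 1) (e + 1)
        + eulerInt (a₁ + 1) a₂ (b₁ + 1) b₂ (c₁ + 1) c₂ (e + 1) := by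
  obtain ⟨h1, h2, h3, h4, h5, h6, h7, h8⟩ := h
  refine eulerInt_add
    (integrableOn_eulerWeight ⟨h1, h2, h3, h4, h5, by linarith, by linarith, by linarith⟩)
    (integrableOn_eulerWeight ⟨by linarith, h2, by linarith, h4, by linarith, h6, by linarith,
      by linarith⟩) fun p hp => ?_
  obtain ⟨hx, hy, hz⟩ := hp
  have hD := den_pos hx hy hz
  simp only [eulerWeight]
  rw [Real.rpow_add_one hx.1.ne', Real.rpow_add_one hy.1.ne', Real.rpow_add_one hz.1.ne',
    Real.rpow_add_one (sub_pos.2 hz.2).ne']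
  rw [show -e = -(e + 1) + 1 by ring, Real.rpow_add_one hD.ne']
  unfold den
  ring

theorem hasDerivAt_rpow_mul_one_sub_rpow {a b x : ℝ} (hx : x ∈ Set.Ioo (0 : ℝ) 1) :
    HasDerivAt (fun x : ℝ => x ^ (a + 1) * (1 - x) ^ b)
      ((a + 1) * x ^ a * (1 - x) ^ b - b * x ^ (a + 1) * (1 - x) ^ (b - 1)) x := by
  have h1 := Real.hasDerivAt_rpow_const (p := a + 1) (Or.inl hx.1.ne')
  have h2 := ((hasDerivAt_id x).const_sub 1).rpow_const (p := b) (Or.inl (sub_pos.2 hx.2).ne')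
  convert! h1.mul h2 using 1
  simp
  ring

theorem tendsto_zero_left {a b : ℝ} (ha : -1 < a) :
    Tendsto (fun x : ℝ => x ^ (a + 1) * (1 - x) ^ b) (𝓝[>] 0) (𝓝 0) := by
  have h1 : ContinuousAt (fun x : ℝ => x ^ (a + 1) * (1 - x) ^ b) 0 := by
    refine ContinuousAt.mul ?_ ?_
    · exact Real.continuousAt_rpow_const _ _ (Or.inr (by linarith))
    · exact ContinuousAt.rpow_const (by fun_prop) (Or.inl (by norm_num))
  have := h1.tendsto
  rw [Real.zero_rpow (by linarith), zero_mul] at this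
  exact this.mono_left nhdsWithin_le_nhds

theorem tendsto_zero_right {a b : ℝ} (hb : 0 < b) :
    Tendsto (fun x : ℝ => x ^ (a + 1) * (1 - x) ^ b) (𝓝[<] 1) (𝓝 0) := by
  have h1 : ContinuousAt (fun x : ℝ => x ^ (a + 1) * (1 - x) ^ b) 1 := by
    refine ContinuousAt.mul ?_ ?_
    · exact Real.continuousAt_rpow_const _ _ (Or.inl one_ne_zero)
    · exact ContinuousAt.rpow_const (by fun_prop) (Or.inr hb.le)
  have := h1.tendsto
  rw [sub_self, Real.zero_rpow hb.ne', mul_zero] at this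
  exact this.mono_left nhdsWithin_le_nhds

theorem tendsto_one_right {a : ℝ} :
    Tendsto (fun x : ℝ => x ^ (a + 1) * (1 - x) ^ (0 : ℝ)) (𝓝[<] 1) (𝓝 1) := by
  have h1 : ContinuousAt (fun x : ℝ => x ^ (a + 1)) 1 :=
    Real.continuousAt_rpow_const _ _ (Or.inl one_ne_zero)
  have := h1.tendsto
  rw [Real.one_rpow] at this
  simpa using this.mono_left nhdsWithin_le_nhds

theorem continuousAt_den_rpow_fst {x y z : ℝ} (hD : 0 < den x y z) :
    ContinuousAt (fun x => den x y z ^ (-e)) x := by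
  refine ContinuousAt.rpow_const ?_ (Or.inl hD.ne')
  unfold den; fun_prop

theorem hasDerivAt_den_rpow_fst {x y z : ℝ} (hD : 0 < den x y z) :
    HasDerivAt (fun x => den x y z ^ (-e)) (-e * (y * z) * den x y z ^ (-(e + 1))) x := by
  have h1 : HasDerivAt (fun x => den x y z) (y * z) x := by
    unfold den
    have := (((hasDerivAt_id x).mul_const y).mul_const z).const_add (1 - z)
    simpa using this
  convert! h1.rpow_const (p := -e) (Or.inl hD.ne') using 1
  rw [show -(e + 1) = -e - 1 by ring]; ring

theorem hasDerivAt_den_rpow_trd {x y z : ℝ} (hD : 0 < den x y z) :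
    HasDerivAt (fun z => den x y z ^ (-e)) (e * (1 - x * y) * den x y z ^ (-(e + 1))) z := by
  have h1 : HasDerivAt (fun z => den x y z) (-(1 - x * y)) z := by
    unfold den
    have := ((hasDerivAt_id z).const_sub 1).add ((hasDerivAt_id z).const_mul (x * y))
    convert! this using 1
    ring
  convert! h1.rpow_const (p := -e) (Or.inl hD.ne') using 1
  rw [show -(e + 1) = -e - 1 by ring]; ring

/-- Integration by parts in `x`. -/
theorem eulerInt_parts_fst (h : EulerDom a₁ a₂ b₁ b₂ c₁ c₂ e) (ha₂ : 0 < a₂) :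
    (a₁ + 1) * eulerInt a₁ a₂ b₁ b₂ c₁ c₂ e
      - e * eulerInt (a₁ + 1) a₂ (b₁ + 1) b₂ (c₁ + 1) c₂ (e + 1)
      = a₂ * eulerInt (a₁ + 1) (a₂ - 1) b₁ b₂ c₁ c₂ e := by
  obtain ⟨h1, h2, h3, h4, h5, h6, h7, h8⟩ := h
  have i1 := integrableOn_eulerWeight (a₁ := a₁) (a₂ := a₂) (b₁ := b₁) (b₂ := b₂) (c₁ := c₁)
    (c₂ := c₂) (e := e) ⟨h1, h2, h3, h4, h5, h6, h7, h8⟩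
  have i2 := integrableOn_eulerWeight (a₁ := a₁ + 1) (a₂ := a₂) (b₁ := b₁ + 1) (b₂ := b₂)
    (c₁ := c₁ + 1) (c₂ := c₂) (e := e + 1)
    ⟨by linarith, h2, by linarith, h4, by linarith, h6, by linarith, by linarith⟩
  have i3 := integrableOn_eulerWeight (a₁ := a₁ + 1) (a₂ := a₂ - 1) (b₁ := b₁) (b₂ := b₂)
    (c₁ := c₁) (c₂ := c₂) (e := e)
    ⟨by linarith, by linarith, h3, h4, h5, h6, by linarith, by linarith⟩
  have key := integral_unitCube_of_hasDerivAt_fst (B := fun _ => 0)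
    (((i1.const_mul (a₁ + 1)).sub (i2.const_mul e)).sub (i3.const_mul a₂)) ?_
  · rw [integral_sub' ((i1.const_mul (a₁ + 1)).sub (i2.const_mul e)) (i3.const_mul a₂),
      integral_sub' (i1.const_mul (a₁ + 1)) (i2.const_mul e), integral_const_mul,
      integral_const_mul, integral_const_mul, integral_zero] at key
    exact sub_eq_zero.1 key
  · intro y hy z hz
    set k := y ^ b₁ * (1 - y) ^ b₂ * (z ^ c₁ * (1 - z) ^ c₂) with hk
    have hD1 : 0 < den 1 y z := by
      have := mul_pos hy.1 hz.1; have := hz.2; unfold den; linarith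
    have hD0 : 0 < den 0 y z := by have := hz.2; unfold den; linarith
    refine ⟨fun x => k * (x ^ (a₁ + 1) * (1 - x) ^ a₂ * den x y z ^ (-e)), ?_, ?_, ?_⟩
    · intro x hx
      convert! ((hasDerivAt_rpow_mul_one_sub_rpow (a := a₁) (b := a₂) hx).mul
        (hasDerivAt_den_rpow_fst (e := e) (den_pos hx hy hz))).const_mul k using 1
      simp only [eulerWeight, Pi.sub_apply]
      rw [Real.rpow_add_one hy.1.ne', Real.rpow_add_one hz.1.ne', hk]
      ring
    · have := ((tendsto_zero_left (b := a₂) h1).mul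
        ((continuousAt_den_rpow_fst (e := e) hD0).tendsto.mono_left nhdsWithin_le_nhds)).const_mul k
      simpa using this
    · have := ((tendsto_zero_right (a := a₁) ha₂).mul
        ((continuousAt_den_rpow_fst (e := e) hD1).tendsto.mono_left nhdsWithin_le_nhds)).const_mul k
      simpa using this

/-- Integration by parts in `z`. -/
theorem eulerInt_parts_trd (h : EulerDom a₁ a₂ b₁ b₂ c₁ c₂ e) :
    (c₁ + 1 - e) * eulerInt a₁ a₂ b₁ b₂ c₁ (c₂ + 1) e
      - (c₂ + 1) * eulerInt a₁ a₂ b₁ b₂ (c₁ + 1) c₂ e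
      + e * eulerInt a₁ a₂ b₁ b₂ c₁ (c₂ + 1) (e + 1) = 0 := by
  obtain ⟨h1, h2, h3, h4, h5, h6, h7, h8⟩ := h
  have i1 := integrableOn_eulerWeight (a₁ := a₁) (a₂ := a₂) (b₁ := b₁) (b₂ := b₂) (c₁ := c₁)
    (c₂ := c₂ + 1) (e := e) ⟨h1, h2, h3, h4, h5, by linarith, by linarith, by linarith⟩
  have i2 := integrableOn_eulerWeight (a₁ := a₁) (a₂ := a₂) (b₁ := b₁) (b₂ := b₂)
    (c₁ := c₁ + 1) (c₂ := c₂) (e := e) ⟨h1, h2, h3, h4, by linarith, h6, h7, h8⟩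
  have i3 := integrableOn_eulerWeight (a₁ := a₁) (a₂ := a₂) (b₁ := b₁) (b₂ := b₂)
    (c₁ := c₁) (c₂ := c₂ + 1) (e := e + 1)
    ⟨h1, h2, h3, h4, h5, by linarith, by linarith, by linarith⟩
  have key := integral_unitCube_of_hasDerivAt_snd
    (((i1.const_mul (c₁ + 1 - e)).sub (i2.const_mul (c₂ + 1))).add (i3.const_mul e)) ?_
  · rwa [integral_add' ((i1.const_mul (c₁ + 1 - e)).sub (i2.const_mul (c₂ + 1)))
      (i3.const_mul e), integral_sub' (i1.const_mul (c₁ + 1 - e)) (i2.const_mul (c₂ + 1)),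
      integral_const_mul, integral_const_mul, integral_const_mul] at key
  · intro x hx y hy
    set k := x ^ a₁ * (1 - x) ^ a₂ * (y ^ b₁ * (1 - y) ^ b₂) with hk
    have hxy : 0 < x * y := mul_pos hx.1 hy.1
    have hD1 : den x y 1 ≠ 0 := by unfold den; linarith
    have hD0 : den x y 0 ≠ 0 := by unfold den; norm_num
    have hc : ∀ t, den x y t ≠ 0 → ContinuousAt (fun z => den x y z ^ (-e)) t := fun t ht =>
      ContinuousAt.rpow_const (by unfold den; fun_prop) (Or.inl ht)
    refine ⟨fun z => k * (z ^ (c₁ + 1) * (1 - z) ^ (c₂ + 1) * den x y z ^ (-e)), ?_, ?_, ?_⟩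
    · intro z hz
      have hD := den_pos hx hy hz
      convert! ((hasDerivAt_rpow_mul_one_sub_rpow (a := c₁) (b := c₂ + 1) hz).mul
        (hasDerivAt_den_rpow_trd (e := e) hD)).const_mul k using 1
      simp only [eulerWeight, Pi.sub_apply, Pi.add_apply]
      rw [Real.rpow_add_one hz.1.ne', Real.rpow_add_one (sub_pos.2 hz.2).ne', add_sub_cancel_right,
        hk, show -e = -(e + 1) + 1 by ring, Real.rpow_add_one hD.ne']
      unfold den
      ring
    · have := ((tendsto_zero_left (b := c₂ + 1) h5).mul
        ((hc 0 hD0).tendsto.mono_left nhdsWithin_le_nhds)).const_mul k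
      simpa using this
    · have := ((tendsto_zero_right (a := c₁) (by linarith : 0 < c₂ + 1)).mul
        ((hc 1 hD1).tendsto.mono_left nhdsWithin_le_nhds)).const_mul k
      simpa using this

end contiguity

/-! ### Integrals as a linear functional on polynomials -/

/-- The operator on sequences that makes multiplication by the variable of a polynomial, written
in the basis of the rising factorials `(e + X)_j`, act on values: `X (e + X)_j =
(e + X)_{j+1} - (e + j) (e + X)_j`. -/
def thetaOp (e : ℝ) : (ℕ → ℝ) →ₗ[ℝ] (ℕ → ℝ) where
  toFun f j := f (j + 1) - (e + j) * f j
  map_add' f g := by funext j; simp; ring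
  map_smul' c f := by funext j; simp; ring

@[simp] theorem thetaOp_apply (e : ℝ) (f : ℕ → ℝ) (j : ℕ) :
    thetaOp e f j = f (j + 1) - (e + j) * f j := rfl

/-- The sequence `(e)_j F(c₂ + j, e + j)`, where `F` is the Euler integral. -/
def eulerSeq (a₁ a₂ b₁ b₂ c₁ c₂ e : ℝ) (j : ℕ) : ℝ :=
  (∏ i ∈ Finset.range j, (e + i)) * eulerInt a₁ a₂ b₁ b₂ c₁ (c₂ + j) (e + j)

/-- The functional on polynomials which sends `q` to the integral of the weight without
denominator against `q(θ) (1 - z + tz)^(-e)` at `t = xy`, where `θ = t d/dt`. -/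
def eulerFun (a₁ a₂ b₁ b₂ c₁ c₂ e : ℝ) (q : ℝ[X]) : ℝ :=
  aeval (thetaOp e) q (eulerSeq a₁ a₂ b₁ b₂ c₁ c₂ e) 0

/-- Operators intertwined by a linear map stay so after substitution into a polynomial. -/
theorem aeval_intertwine {V W : Type*} [AddCommGroup V] [Module ℝ V] [AddCommGroup W] [Module ℝ W]
    (S : Module.End ℝ V) (T : Module.End ℝ W) (φ : V →ₗ[ℝ] W)
    (h : ∀ v, φ (S v) = T (φ v)) (q : ℝ[X]) (v : V) : φ (aeval S q v) = aeval T q (φ v) := by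
  induction q using Polynomial.induction_on' generalizing v with
  | add p q hp hq => simp [hp, hq]
  | monomial n a =>
    simp only [aeval_monomial, Module.End.mul_apply, Module.algebraMap_end_apply, map_smul]
    congr 1
    induction n generalizing v with
    | zero => simp
    | succ n ih => simp only [pow_succ, Module.End.mul_apply, ih, h]

theorem eulerFun_one (a₁ a₂ b₁ b₂ c₁ c₂ e : ℝ) :
    eulerFun a₁ a₂ b₁ b₂ c₁ c₂ e 1 = eulerInt a₁ a₂ b₁ b₂ c₁ c₂ e := by
  simp [eulerFun, eulerSeq]

/-- `eulerFun` as a linear map. -/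
def eulerLin (a₁ a₂ b₁ b₂ c₁ c₂ e : ℝ) : ℝ[X] →ₗ[ℝ] ℝ where
  toFun := eulerFun a₁ a₂ b₁ b₂ c₁ c₂ e
  map_add' p q := by simp [eulerFun]
  map_smul' c p := by simp [eulerFun]

theorem eulerFun_eq_eulerLin (a₁ a₂ b₁ b₂ c₁ c₂ e : ℝ) (q : ℝ[X]) :
    eulerFun a₁ a₂ b₁ b₂ c₁ c₂ e q = eulerLin a₁ a₂ b₁ b₂ c₁ c₂ e q := rfl

/-- A relation between sequences gives a relation between functionals. -/
theorem eulerFun_mul_of_seq {a₁ a₂ b₁ b₂ c₁ c₂ e a₁' a₂' b₁' b₂' c₁' c₂' k : ℝ} {r : ℝ[X]}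
    (h : aeval (thetaOp e) r (eulerSeq a₁ a₂ b₁ b₂ c₁ c₂ e) =
      k • eulerSeq a₁' a₂' b₁' b₂' c₁' c₂' e) (q : ℝ[X]) :
    eulerFun a₁ a₂ b₁ b₂ c₁ c₂ e (r * q) = k * eulerFun a₁' a₂' b₁' b₂' c₁' c₂' e q := by
  rw [eulerFun, mul_comm, map_mul, Module.End.mul_apply, h, map_smul]
  rfl

theorem aeval_thetaOp_C_add_X (e k : ℝ) (f : ℕ → ℝ) (j : ℕ) :
    aeval (thetaOp e) (C k + X) f j = f (j + 1) + (k - e - j) * f j := by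
  simp
  ring

section rules
variable {a₁ a₂ b₁ b₂ c₁ c₂ e : ℝ}

theorem EulerDom.add_nat (h : EulerDom a₁ a₂ b₁ b₂ c₁ c₂ e) (j : ℕ) :
    EulerDom a₁ a₂ b₁ b₂ c₁ (c₂ + j) (e + j) := by
  obtain ⟨h1, h2, h3, h4, h5, h6, h7, h8⟩ := h
  have : (0 : ℝ) ≤ j := j.cast_nonneg
  exact ⟨h1, h2, h3, h4, h5, by linarith, by linarith, by linarith⟩

theorem eulerSeq_succ (j : ℕ) :
    eulerSeq a₁ a₂ b₁ b₂ c₁ c₂ e (j + 1) = (∏ i ∈ Finset.range j, (e + i)) * ((e + j) *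
      eulerInt a₁ a₂ b₁ b₂ c₁ (c₂ + j + 1) (e + j + 1)) := by
  rw [eulerSeq, Finset.prod_range_succ]
  push_cast
  rw [← add_assoc, ← add_assoc]
  ring

theorem eulerSeq_succ' (j : ℕ) :
    eulerSeq a₁ a₂ b₁ b₂ c₁ c₂ e (j + 1) =
      e * eulerSeq a₁ a₂ b₁ b₂ c₁ (c₂ + 1) (e + 1) j := by
  rw [eulerSeq, Finset.prod_range_succ', eulerSeq]
  push_cast
  rw [add_zero, show c₂ + (j + 1 : ℝ) = c₂ + 1 + j by ring,
    show e + (j + 1 : ℝ) = e + 1 + j by ring]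
  have : ∀ i : ℕ, e + ((i : ℝ) + 1) = e + 1 + i := fun i => by ring
  simp only [this]
  ring

/-- Raising `e` and `c₂` together. -/
theorem eulerFun_e_mul (q : ℝ[X]) :
    eulerFun a₁ a₂ b₁ b₂ c₁ c₂ e ((C e + X) * q) =
      e * eulerFun a₁ a₂ b₁ b₂ c₁ (c₂ + 1) (e + 1) q := by
  have h1 : ∀ f : ℕ → ℝ, aeval (thetaOp e) (C e + X) f 0 = f 1 := fun f => by
    rw [aeval_thetaOp_C_add_X]; simp
  rw [eulerFun, map_mul, Module.End.mul_apply, h1]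
  -- the shift of sequences intertwines the operators for `e` and `e + 1`
  have h2 := aeval_intertwine (thetaOp e) (thetaOp (e + 1)) (LinearMap.funLeft ℝ ℝ Nat.succ)
    (fun v => by
      funext j
      simp only [LinearMap.funLeft_apply, thetaOp_apply, Nat.succ_eq_add_one]
      push_cast
      ring) q
    (eulerSeq a₁ a₂ b₁ b₂ c₁ c₂ e)
  have h3 : LinearMap.funLeft ℝ ℝ Nat.succ (eulerSeq a₁ a₂ b₁ b₂ c₁ c₂ e) =
      e • eulerSeq a₁ a₂ b₁ b₂ c₁ (c₂ + 1) (e + 1) := by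
    funext j
    exact eulerSeq_succ' j
  rw [h3, map_smul] at h2
  exact congrFun h2 0

/-- Raising `c₁`. -/
theorem eulerFun_c₁_mul (h : EulerDom a₁ a₂ b₁ b₂ c₁ c₂ e) (q : ℝ[X]) :
    eulerFun a₁ a₂ b₁ b₂ c₁ c₂ e ((C (c₁ + 1) + X) * q) =
      (c₁ + c₂ + 2 - e) * eulerFun a₁ a₂ b₁ b₂ (c₁ + 1) c₂ e q := by
  refine eulerFun_mul_of_seq ?_ q
  funext j
  rw [aeval_thetaOp_C_add_X, eulerSeq_succ]
  have h1 := eulerInt_parts_trd (h.add_nat j)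
  have h2 := eulerInt_split_trd (h.add_nat j)
  simp only [eulerSeq, Pi.smul_apply, smul_eq_mul]
  linear_combination (∏ i ∈ Finset.range j, (e + i)) * h1
    + (∏ i ∈ Finset.range j, (e + i)) * (c₁ + 1 - e - j) * h2

/-- Raising `c₂`. -/
theorem eulerFun_c₂_mul (h : EulerDom a₁ a₂ b₁ b₂ c₁ c₂ e) (q : ℝ[X]) :
    eulerFun a₁ a₂ b₁ b₂ c₁ c₂ e ((C (c₂ + 1 - e) - X) * q) =
      (c₁ + c₂ + 2 - e) * eulerFun a₁ a₂ b₁ b₂ c₁ (c₂ + 1) e q := by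
  refine eulerFun_mul_of_seq ?_ q
  funext j
  have h0 : aeval (thetaOp e) (C (c₂ + 1 - e) - X) (eulerSeq a₁ a₂ b₁ b₂ c₁ c₂ e) j =
      (c₂ + 1 + j) * eulerSeq a₁ a₂ b₁ b₂ c₁ c₂ e j
        - eulerSeq a₁ a₂ b₁ b₂ c₁ c₂ e (j + 1) := by
    simp
    ring
  rw [h0, eulerSeq_succ]
  have h1 := eulerInt_parts_trd (h.add_nat j)
  have h2 := eulerInt_split_trd (h.add_nat j)
  simp only [eulerSeq, Pi.smul_apply, smul_eq_mul]
  rw [show c₂ + 1 + (j : ℝ) = c₂ + j + 1 by ring]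
  linear_combination (-(∏ i ∈ Finset.range j, (e + i))) * h1
    + (∏ i ∈ Finset.range j, (e + i)) * (c₂ + j + 1) * h2

/-- Raising `a₁` at the expense of `a₂`. -/
theorem eulerFun_a₁_mul (h : EulerDom a₁ a₂ b₁ b₂ c₁ c₂ e) (ha₂ : 0 < a₂) (q : ℝ[X]) :
    eulerFun a₁ a₂ b₁ b₂ c₁ c₂ e ((C (a₁ + 1) + X) * q) =
      a₂ * eulerFun (a₁ + 1) (a₂ - 1) b₁ b₂ c₁ c₂ e q := by
  refine eulerFun_mul_of_seq ?_ q
  funext j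
  rw [aeval_thetaOp_C_add_X, eulerSeq_succ]
  have h1 := eulerInt_parts_fst (h.add_nat j) ha₂
  have h2 := eulerInt_split_den (h.add_nat j)
  simp only [eulerSeq, Pi.smul_apply, smul_eq_mul]
  linear_combination (∏ i ∈ Finset.range j, (e + i)) * h1
    - (∏ i ∈ Finset.range j, (e + i)) * (e + j) * h2

/-- Lowering `a₂`. -/
theorem eulerFun_a₂_mul (h : EulerDom a₁ a₂ b₁ b₂ c₁ c₂ e) (ha₂ : 0 < a₂) (q : ℝ[X]) :
    eulerFun a₁ a₂ b₁ b₂ c₁ c₂ e ((C (a₁ + a₂ + 1) + X) * q) =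
      a₂ * eulerFun a₁ (a₂ - 1) b₁ b₂ c₁ c₂ e q := by
  refine eulerFun_mul_of_seq ?_ q
  funext j
  rw [aeval_thetaOp_C_add_X, eulerSeq_succ]
  have h1 := eulerInt_parts_fst (h.add_nat j) ha₂
  have h2 := eulerInt_split_den (h.add_nat j)
  have h' := h.add_nat j
  obtain ⟨g1, g2, g3, g4, g5, g6, g7, g8⟩ := h'
  have h3 := eulerInt_split_fst (a₁ := a₁) (a₂ := a₂ - 1) (b₁ := b₁) (b₂ := b₂) (c₁ := c₁)
    (c₂ := c₂ + j) (e := e + j) ⟨g1, by linarith, g3, g4, g5, g6, g7, g8⟩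
  rw [sub_add_cancel] at h3
  simp only [eulerSeq, Pi.smul_apply, smul_eq_mul]
  linear_combination (∏ i ∈ Finset.range j, (e + i)) * h1
    - (∏ i ∈ Finset.range j, (e + i)) * (e + j) * h2
    - (∏ i ∈ Finset.range j, (e + i)) * a₂ * h3

theorem eulerFun_swap (q : ℝ[X]) :
    eulerFun b₁ b₂ a₁ a₂ c₁ c₂ e q = eulerFun a₁ a₂ b₁ b₂ c₁ c₂ e q := by
  have : eulerSeq b₁ b₂ a₁ a₂ c₁ c₂ e = eulerSeq a₁ a₂ b₁ b₂ c₁ c₂ e := by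
    funext j; rw [eulerSeq, eulerInt_swap]; rfl
  rw [eulerFun, this]; rfl

theorem eulerFun_b₁_mul (h : EulerDom a₁ a₂ b₁ b₂ c₁ c₂ e) (hb₂ : 0 < b₂) (q : ℝ[X]) :
    eulerFun a₁ a₂ b₁ b₂ c₁ c₂ e ((C (b₁ + 1) + X) * q) =
      b₂ * eulerFun a₁ a₂ (b₁ + 1) (b₂ - 1) c₁ c₂ e q := by
  rw [← eulerFun_swap, eulerFun_a₁_mul h.swap hb₂, eulerFun_swap]

theorem eulerFun_b₂_mul (h : EulerDom a₁ a₂ b₁ b₂ c₁ c₂ e) (hb₂ : 0 < b₂) (q : ℝ[X]) :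
    eulerFun a₁ a₂ b₁ b₂ c₁ c₂ e ((C (b₁ + b₂ + 1) + X) * q) =
      b₂ * eulerFun a₁ a₂ b₁ (b₂ - 1) c₁ c₂ e q := by
  rw [← eulerFun_swap, eulerFun_a₂_mul h.swap hb₂, eulerFun_swap]

/-- The variable itself acts as multiplication of the integrand by `-e xyz / (1 - z + xyz)`. -/
theorem eulerFun_X_mul (h : EulerDom a₁ a₂ b₁ b₂ c₁ c₂ e) (q : ℝ[X]) :
    eulerFun a₁ a₂ b₁ b₂ c₁ c₂ e (X * q) =
      -e * eulerFun (a₁ + 1) a₂ (b₁ + 1) b₂ (c₁ + 1) c₂ (e + 1) (q.comp (X + 1)) := by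
  have hs : thetaOp e (eulerSeq a₁ a₂ b₁ b₂ c₁ c₂ e) =
      (-e) • eulerSeq (a₁ + 1) a₂ (b₁ + 1) b₂ (c₁ + 1) c₂ (e + 1) := by
    funext j
    have h2 := eulerInt_split_den (h.add_nat j)
    have h3 : (∏ i ∈ Finset.range j, (e + i)) * (e + j) =
        e * ∏ i ∈ Finset.range j, (e + 1 + i) := by
      rw [← Finset.prod_range_succ, Finset.prod_range_succ', mul_comm]
      push_cast
      rw [add_zero]
      congr 1
      exact Finset.prod_congr rfl fun i _ => by ring
    rw [thetaOp_apply, eulerSeq_succ]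
    simp only [eulerSeq, Pi.smul_apply, smul_eq_mul]
    rw [show e + 1 + (j : ℝ) = e + j + 1 by ring]
    linear_combination (-(∏ i ∈ Finset.range j, (e + i)) * (e + j)) * h2
      - eulerInt (a₁ + 1) a₂ (b₁ + 1) b₂ (c₁ + 1) (c₂ + j) (e + j + 1) * h3
  have ht : aeval (thetaOp (e + 1)) (X + 1 : ℝ[X]) = thetaOp e := by
    refine LinearMap.ext fun f => funext fun j => ?_
    simp
    ring
  rw [eulerFun, mul_comm, map_mul, aeval_X, Module.End.mul_apply, hs, map_smul, eulerFun,
    aeval_comp, ht]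
  rfl

theorem eulerFun_X_mul_c₂ (h : EulerDom a₁ a₂ b₁ b₂ c₁ c₂ e) (q : ℝ[X]) :
    eulerFun a₁ a₂ b₁ b₂ c₁ c₂ e (X * (X - C (c₂ + 1 - e)) * q) =
      e * (c₁ + c₂ + 2 - e) *
        eulerFun (a₁ + 1) a₂ (b₁ + 1) b₂ (c₁ + 1) (c₂ + 1) (e + 1) (q.comp (X + 1)) := by
  have h' : EulerDom a₁ a₂ b₁ b₂ c₁ (c₂ + 1) e := by
    obtain ⟨g1, g2, g3, g4, g5, g6, g7, g8⟩ := h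
    exact ⟨g1, g2, g3, g4, g5, by linarith, by linarith, by linarith⟩
  rw [show X * (X - C (c₂ + 1 - e)) * q = (C (c₂ + 1 - e) - X) * (-(X * q)) by ring,
    eulerFun_c₂_mul h, eulerFun_eq_eulerLin, map_neg, ← eulerFun_eq_eulerLin, eulerFun_X_mul h']
  ring

/-- The vanishing of the functional on exact polynomials, the differences
`U(X) q(X + 1) - V(X) q(X)`. -/
theorem eulerFun_exact (h : EulerDom a₁ a₂ b₁ b₂ c₁ c₂ e) (ha₂ : 0 < a₂) (hb₂ : 0 < b₂)
    (q : ℝ[X]) :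
    eulerFun a₁ a₂ b₁ b₂ c₁ c₂ e
      ((C e + X) * (C (c₁ + 1) + X) * (C (a₁ + 1) + X) * (C (b₁ + 1) + X) * q.comp (X + 1)
        - X * (X - C (c₂ + 1 - e)) * (C (a₁ + a₂ + 1) + X) * (C (b₁ + b₂ + 1) + X) * q) = 0 := by
  have h0 := h
  obtain ⟨g1, g2, g3, g4, g5, g6, g7, g8⟩ := h
  rw [eulerFun_eq_eulerLin, map_sub, ← eulerFun_eq_eulerLin, ← eulerFun_eq_eulerLin]
  rw [show (C e + X) * (C (c₁ + 1) + X) * (C (a₁ + 1) + X) * (C (b₁ + 1) + X) * q.comp (X + 1) =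
    (C (a₁ + 1) + X) * ((C (b₁ + 1) + X) * ((C e + X) * ((C (c₁ + 1) + X) * q.comp (X + 1)))) by
      ring]
  rw [show X * (X - C (c₂ + 1 - e)) * (C (a₁ + a₂ + 1) + X) * (C (b₁ + b₂ + 1) + X) * q =
    (C (a₁ + a₂ + 1) + X) * ((C (b₁ + b₂ + 1) + X) * (X * (X - C (c₂ + 1 - e)) * q)) by ring]
  rw [eulerFun_a₁_mul h0 ha₂, eulerFun_b₁_mul ⟨by linarith, by linarith, g3, g4, g5, g6,
      by linarith, g8⟩ hb₂, eulerFun_e_mul,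
    eulerFun_c₁_mul ⟨by linarith, by linarith, by linarith, by linarith, g5, by linarith,
      by linarith, by linarith⟩]
  rw [eulerFun_a₂_mul h0 ha₂, eulerFun_b₂_mul ⟨by linarith, by linarith, g3, g4, g5, g6,
      by linarith, g8⟩ hb₂, eulerFun_X_mul_c₂ ⟨by linarith, by linarith, by linarith,
      by linarith, g5, by linarith, by linarith, by linarith⟩]
  ring

end rules

/-! ### Analyticity in the parameters -/

theorem rpow_add_mul_eq_exp {x : ℝ} (hx : 0 < x) (a t v : ℝ) :
    x ^ (a + t * v) = x ^ a * Real.exp (t * (v * Real.log x)) := by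
  rw [Real.rpow_add hx, Real.rpow_def_of_pos hx (t * v)]
  congr 2; ring

/-- Along a line in the parameter space the Euler integral is a moment generating function, hence
real analytic as long as it converges. -/
theorem analyticOnNhd_eulerInt (a₁ a₂ b₁ b₂ c₁ c₂ e v₁ v₂ v₃ v₄ v₅ v₆ v₇ : ℝ) {I : Set ℝ}
    (hI : IsOpen I)
    (h : ∀ t ∈ I, EulerDom (a₁ + t * v₁) (a₂ + t * v₂) (b₁ + t * v₃) (b₂ + t * v₄)
      (c₁ + t * v₅) (c₂ + t * v₆) (e + t * v₇)) :
    AnalyticOnNhd ℝ (fun t => eulerInt (a₁ + t * v₁) (a₂ + t * v₂) (b₁ + t * v₃) (b₂ + t * v₄)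
      (c₁ + t * v₅) (c₂ + t * v₆) (e + t * v₇)) I := by
  set L : ℝ × ℝ × ℝ → ℝ := fun p => v₁ * Real.log p.1 + v₂ * Real.log (1 - p.1)
    + v₃ * Real.log p.2.1 + v₄ * Real.log (1 - p.2.1) + v₅ * Real.log p.2.2
    + v₆ * Real.log (1 - p.2.2) - v₇ * Real.log (den p.1 p.2.1 p.2.2) with hL
  set w := eulerWeight a₁ a₂ b₁ b₂ c₁ c₂ e with hw
  have hwm : Measurable w := measurable_eulerWeight ..
  set μ : Measure (ℝ × ℝ × ℝ) :=
    (volume.restrict unitCube).withDensity fun p => ((w p).toNNReal : ENNReal) with hμ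
  have hdens : Measurable fun p => (w p).toNNReal := hwm.real_toNNReal
  have hexp : ∀ t, ∀ p ∈ unitCube, (w p).toNNReal • Real.exp (t * L p) =
      eulerWeight (a₁ + t * v₁) (a₂ + t * v₂) (b₁ + t * v₃) (b₂ + t * v₄)
        (c₁ + t * v₅) (c₂ + t * v₆) (e + t * v₇) p := by
    intro t p hp
    have hpos : 0 ≤ w p := (eulerWeight_pos hp).le
    obtain ⟨hx, hy, hz⟩ := hp
    have hD := den_pos hx hy hz
    rw [NNReal.smul_def, Real.coe_toNNReal _ hpos, smul_eq_mul]
    simp only [hw, eulerWeight, hL]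
    rw [show -(e + t * v₇) = -e + t * (-v₇) by ring, rpow_add_mul_eq_exp hx.1,
      rpow_add_mul_eq_exp (sub_pos.2 hx.2), rpow_add_mul_eq_exp hy.1,
      rpow_add_mul_eq_exp (sub_pos.2 hy.2), rpow_add_mul_eq_exp hz.1,
      rpow_add_mul_eq_exp (sub_pos.2 hz.2), rpow_add_mul_eq_exp hD]
    rw [show ∀ A B C D E F G : ℝ, t * (A + B + C + D + E + F - G) =
      t * A + t * B + t * C + t * D + t * E + t * F + t * (-G) from fun A B C D E F G => by ring]
    simp only [Real.exp_add, neg_mul]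
    ring
  have hmgf : (fun t => eulerInt (a₁ + t * v₁) (a₂ + t * v₂) (b₁ + t * v₃) (b₂ + t * v₄)
      (c₁ + t * v₅) (c₂ + t * v₆) (e + t * v₇)) = ProbabilityTheory.mgf L μ := by
    funext t
    rw [ProbabilityTheory.mgf, hμ, integral_withDensity_eq_integral_smul hdens]
    exact (setIntegral_congr_fun measurableSet_unitCube (hexp t)).symm
  rw [hmgf]
  refine ProbabilityTheory.analyticOnNhd_mgf.mono (interior_maximal (fun t ht => ?_) hI)
  rw [ProbabilityTheory.integrableExpSet, Set.mem_ofPred_eq, hμ,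
    integrable_withDensity_iff_integrable_smul hdens]
  exact (integrableOn_eulerWeight (h t ht)).congr_fun (fun p hp => (hexp t p hp).symm)
    measurableSet_unitCube

/-- The Euler integral with all parameters increased by `t`. -/
def diagInt (a₁ a₂ b₁ b₂ c₁ c₂ e t : ℝ) : ℝ :=
  eulerInt (a₁ + t) (a₂ + t) (b₁ + t) (b₂ + t) (c₁ + t) (c₂ + t) (e + t)

theorem EulerDom.exists_diag {a₁ a₂ b₁ b₂ c₁ c₂ e : ℝ} (h : EulerDom a₁ a₂ b₁ b₂ c₁ c₂ e) :
    ∃ r > 0, ∀ t ∈ Set.Ioi (-r), EulerDom (a₁ + t) (a₂ + t) (b₁ + t) (b₂ + t) (c₁ + t)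
      (c₂ + t) (e + t) := by
  obtain ⟨h1, h2, h3, h4, h5, h6, h7, h8⟩ := h
  refine ⟨min (a₁ + 1) (min (a₂ + 1) (min (b₁ + 1) (min (b₂ + 1) (min (c₁ + 1) (min (c₂ + 1)
    (min (a₁ + c₂ + 2 - e) (b₁ + c₂ + 2 - e))))))), ?_, ?_⟩
  · simp only [gt_iff_lt, lt_min_iff]
    refine ⟨?_, ?_, ?_, ?_, ?_, ?_, ?_, ?_⟩ <;> linarith
  · intro t ht
    have ht' := neg_lt.1 (Set.mem_Ioi.1 ht)
    simp only [lt_min_iff] at ht'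
    obtain ⟨g1, g2, g3, g4, g5, g6, g7, g8⟩ := ht'
    refine ⟨?_, ?_, ?_, ?_, ?_, ?_, ?_, ?_⟩ <;> linarith

theorem analyticOnNhd_diagInt {a₁ a₂ b₁ b₂ c₁ c₂ e r : ℝ}
    (h : ∀ t ∈ Set.Ioi (-r), EulerDom (a₁ + t) (a₂ + t) (b₁ + t) (b₂ + t) (c₁ + t)
      (c₂ + t) (e + t)) :
    AnalyticOnNhd ℝ (diagInt a₁ a₂ b₁ b₂ c₁ c₂ e) (Set.Ioi (-r)) := by
  have := analyticOnNhd_eulerInt a₁ a₂ b₁ b₂ c₁ c₂ e 1 1 1 1 1 1 1 isOpen_Ioi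
    (I := Set.Ioi (-r)) (by simpa only [mul_one] using h)
  simp only [mul_one] at this
  exact this

/-- An analytic function on a half line that vanishes far out vanishes identically. -/
theorem AnalyticOnNhd.eq_zero_of_eventually {f : ℝ → ℝ} {r : ℝ}
    (hf : AnalyticOnNhd ℝ f (Set.Ioi r)) (h : ∀ᶠ t in atTop, f t = 0) {t : ℝ} (ht : r < t) :
    f t = 0 := by
  obtain ⟨T, hT⟩ := eventually_atTop.1 h
  have hmem : max r T + 1 ∈ Set.Ioi r := by
    rw [Set.mem_Ioi]; linarith [le_max_left r T]
  refine hf.eqOn_zero_of_preconnected_of_eventuallyEq_zero isPreconnected_Ioi hmem ?_ ht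
  filter_upwards [lt_mem_nhds (show T < max r T + 1 by linarith [le_max_right r T])] with s hs
  exact hT s hs.le

/-! ### Polynomial certificates -/

section coefficients
variable {R : Type*} [CommRing R]

/-- `AB (α+u)(β+u)(ε+u)` with `A = α + ε`, `B = β + γ`, `u = γ - δ`. -/
def kT₀ (α β γ δ ε : R) : R :=
  (α + ε) * (β + γ) * ((α + (γ - δ)) * (β + (γ - δ)) * (ε + (γ - δ)))

/-- The divided difference `(αβε(A+u)(B+u) - AB(α+u)(β+u)(ε+u)) / u`. -/
def kT₁ (α β γ δ ε : R) : R :=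
  α * β * ε * (α + ε + (β + γ) + (γ - δ)) - (α + ε) * (β + γ) *
    (α * β + α * ε + β * ε + (γ - δ) * (α + β + ε) + (γ - δ) ^ 2)

/-- The factor of the recurrence coefficients that is not a product of linear forms. -/
def kRho (α β γ δ ε : R) : R := kT₀ α β γ δ ε - δ * kT₁ α β γ δ ε

/-- The middle coefficient of the first contiguity relation, up to linear factors. -/
def kSigma (α β γ ε : R) : R :=
  (α + ε) * (β + γ) * (α + ε + (β + γ)) - (α + β + ε) * ((α + ε) * (β + γ)) + α * β * ε

/-- `αβε(α+u)(β+u)(ε+u)`. -/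
def kLam (α β γ δ ε : R) : R :=
  α * β * ε * ((α + (γ - δ)) * (β + (γ - δ)) * (ε + (γ - δ)))

/-- The linear coefficient of the certificate of the second contiguity relation. -/
def kQ₁ (α β γ δ ε : R) : R :=
  kT₀ α β γ δ ε + (α + β + ε + (γ - δ)) * kT₁ α β γ δ ε

/-- The constant coefficient of the certificate of the second contiguity relation. -/
def kQ₀ (α β γ δ ε : R) : R :=
  (α + β + ε) * kT₀ α β γ δ ε + (α * β + α * ε + β * ε) * kT₁ α β γ δ ε
    - kLam α β γ δ ε + (γ - δ) * kQ₁ α β γ δ ε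

/-- The middle coefficient of the second contiguity relation, up to a linear factor. -/
def kMu (α β γ δ ε : R) : R :=
  γ * (kQ₀ α β γ δ ε + kQ₁ α β γ δ ε + kT₁ α β γ δ ε)
    + δ * γ * (kQ₁ α β γ δ ε + 2 * kT₁ α β γ δ ε)
    - (α + ε - δ + 1) * (β + γ - δ + 1) * kRho α β γ δ ε
    - γ * (kT₁ α β γ δ ε * (α + ε + 1) * (β + γ + 1)
      + kT₀ α β γ δ ε * (α + ε + (β + γ) + 2))

end coefficients

/-- The certificate of the first contiguity relation; `e₁, e₂, e₃` stand for the elementary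
symmetric functions of `α, β, ε`, and `γ = A + B - e₁`, `d = γ - u - 1`. -/
theorem certificate_fst {A B u e₁ e₂ e₃ w σ d ρ p r r₁ r₀ G s : ℝ}
    (hG : G = s ^ 3 + e₁ * s ^ 2 + e₂ * s + e₃) (hw : w = u ^ 3 + e₁ * u ^ 2 + e₂ * u + e₃)
    (hσ : σ = A * B * (A + B) - e₁ * (A * B) + e₃)
    (hd : d = A + B - e₁ - u - 1)
    (hρ : ρ = A * B * w - (d + 1) * (e₃ * (A + B + u) - A * B * (e₂ + u * e₁ + u ^ 2)))
    (hp : p = A ^ 3 - e₁ * A ^ 2 + e₂ * A - e₃) (hr : r = B ^ 3 - e₁ * B ^ 2 + e₂ * B - e₃)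
    (hr₁ : r₁ = A ^ 2 * B ^ 2 - e₂ * (A * B) + e₃ * (A + B) + u * σ)
    (hr₀ : r₀ = B * (B + u) * p + B * r₁) :
    (d + s) * G *
        (p * r * (d + 1 + s) - (B + 1 + s) * (A + 1 + s) * (r₀ + r₁ * s))
      - s * (s - u) * ((B + 1 + s) * (A + 1 + s)) *
        (p * r * (d + s) - (B + s) * (A + s) * (r₀ + r₁ * (s - 1))) =
      p * r * ((d + s) * (d + 1 + s) * G)
        + d * ρ * ((u - s) * ((B + s) * (A + s) * ((B + 1 + s) * (A + 1 + s))))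
        - w * σ * ((d + s) * ((B + s) * (A + s) * ((B + 1 + s) * (A + 1 + s)))) := by
  -- after division by `(B + 1 + s)(A + 1 + s)`
  have key : (d + s) * G * (r₀ + r₁ * s)
      + s * (s - u) * (p * r * (d + s) - (B + s) * (A + s) * (r₀ + r₁ * (s - 1))) =
      -(d * ρ * (u - s) - w * σ * (d + s)) * ((B + s) * (A + s)) := by
    subst hG hr₀ hr₁ hp hr hρ hd hσ hw
    ring
  linear_combination (-(B + 1 + s) * (A + 1 + s)) * key

/-- The certificate of the second contiguity relation, with the notation of
`certificate_fst`. -/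
theorem certificate_snd {A B u e₁ e₂ e₃ w γ δ T₀ T₁ ρ Q₁ Q₀ L μ G s : ℝ}
    (hG : G = s ^ 3 + e₁ * s ^ 2 + e₂ * s + e₃) (hw : w = u ^ 3 + e₁ * u ^ 2 + e₂ * u + e₃)
    (hγ : γ = A + B - e₁) (hδ : δ = γ - u)
    (hT₀ : T₀ = A * B * w) (hT₁ : T₁ = e₃ * (A + B + u) - A * B * (e₂ + u * e₁ + u ^ 2))
    (hρ : ρ = T₀ - δ * T₁) (hL : L = e₃ * w) (hQ₁ : Q₁ = T₀ + (e₁ + u) * T₁)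
    (hQ₀ : Q₀ = e₁ * T₀ + e₂ * T₁ - L + u * Q₁)
    (hμ : μ = γ * (Q₀ + Q₁ + T₁) + δ * γ * (Q₁ + 2 * T₁) - (A - δ + 1) * (B - δ + 1) * ρ
      - γ * (T₁ * (A + 1) * (B + 1) + T₀ * (A + B + 2))) :
    (δ + s) * G *
        (γ * (T₁ * (s + 1) ^ 2 + Q₁ * (s + 1) + Q₀))
      - s * (s - u) * ((B + 1 + s) * (A + 1 + s)) * (γ * (T₁ * s ^ 2 + Q₁ * s + Q₀)) =
      γ * L * ((B + s) * (A + s) * ((B + 1 + s) * (A + 1 + s)))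
        + μ * ((δ + s) * G)
        - (A - δ + 1) * (B - δ + 1) * ρ * ((u - s) * G) := by
  have h₁ : s * (s - u) * (T₁ * s ^ 2 + Q₁ * s + Q₀) =
      (T₀ + T₁ * s) * G - L * ((B + s) * (A + s)) := by
    subst hG hQ₀ hQ₁ hL hT₁ hT₀ hw
    ring
  have h₂ : (δ + s) * (γ * (T₁ * (s + 1) ^ 2 + Q₁ * (s + 1) + Q₀) - μ) =
      -(A - δ + 1) * (B - δ + 1) * ρ * (u - s)
        + γ * ((B + 1 + s) * (A + 1 + s)) * (T₀ + T₁ * s) := by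
    subst hμ hQ₀ hQ₁ hL hρ hT₁ hT₀ hδ hγ hw
    ring
  linear_combination G * h₂
    - γ * ((B + 1 + s) * (A + 1 + s)) * h₁

/-! ### Contiguity relations for large parameters -/

section values
variable {a b c d e : ℝ}

/-- Lowering `a₂` and `b₂` twice. -/
theorem eulerFun_lower_mul {c₁ c₂ d' : ℝ} (hb : -1 < b) (hc : -1 < c) (he : -1 < e) (ha : -1 < a)
    (h₁ : -1 < c₁) (h₂ : -1 < c₂) (hd : d' < b + c₂ + 2) (hd' : d' < e + c₂ + 2) :
    eulerFun b (c + 2) e (a + 2) c₁ c₂ d' ((C (b + (c + 2) + 1) + X) *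
      ((C (b + (c + 2 - 1) + 1) + X) * ((C (e + (a + 2) + 1) + X) *
        ((C (e + (a + 2 - 1) + 1) + X) * 1)))) =
      (c + 2) * (c + 1) * (a + 2) * (a + 1) * eulerInt b c e a c₁ c₂ d' := by
  rw [eulerFun_a₂_mul (by refine ⟨?_, ?_, ?_, ?_, ?_, ?_, ?_, ?_⟩ <;> linarith) (by linarith),
    eulerFun_a₂_mul (by refine ⟨?_, ?_, ?_, ?_, ?_, ?_, ?_, ?_⟩ <;> linarith) (by linarith),
    eulerFun_b₂_mul (by refine ⟨?_, ?_, ?_, ?_, ?_, ?_, ?_, ?_⟩ <;> linarith) (by linarith),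
    eulerFun_b₂_mul (by refine ⟨?_, ?_, ?_, ?_, ?_, ?_, ?_, ?_⟩ <;> linarith) (by linarith),
    eulerFun_one, show c + 2 - 1 - 1 = c by ring, show a + 2 - 1 - 1 = a by ring]
  ring

/-- Raising `a₁` and `b₁` at the expense of `a₂` and `b₂`. -/
theorem eulerFun_shift_mul {c₁ c₂ d' : ℝ} (hb : -1 < b) (hc : -1 < c) (he : -1 < e) (ha : -1 < a)
    (h₁ : -1 < c₁) (h₂ : -1 < c₂) (hd : d' < b + c₂ + 2) (hd' : d' < e + c₂ + 2) (q : ℝ[X]) :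
    eulerFun b (c + 2) e (a + 2) c₁ c₂ d' ((C (b + 1) + X) * ((C (e + 1) + X) * q)) =
      (c + 2) * (a + 2) * eulerFun (b + 1) (c + 1) (e + 1) (a + 1) c₁ c₂ d' q := by
  rw [eulerFun_a₁_mul (by refine ⟨?_, ?_, ?_, ?_, ?_, ?_, ?_, ?_⟩ <;> linarith) (by linarith),
    eulerFun_b₁_mul (by refine ⟨?_, ?_, ?_, ?_, ?_, ?_, ?_, ?_⟩ <;> linarith) (by linarith),
    show c + 2 - 1 = c + 1 by ring, show a + 2 - 1 = a + 1 by ring]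
  ring

/-- The relation of `contiguity_snd` as long as the common factor `a + c + 1 - d` of the terms that
`certificate_snd` produces can be cancelled. -/
theorem contiguity_snd_aux (ha : -1 < a) (hb : -1 < b) (hc : -1 < c) (he : -1 < e)
    (hd : d < b + c + 1) (hd' : d < e + c + 1) (hne : a + c + 1 - d ≠ 0) :
    (a + 1) ^ 2 * (b + 1) * (c + 1) ^ 2 * (e + 1) * (b + 1 + (c + 1) - (d + 1)) *
        (e + 1 + (c + 1) - (d + 1)) * eulerInt b c e a a c (d + 1)
      + kMu (a + 1) (b + 1) (c + 1) (d + 1) (e + 1) * (d + 1) *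
        eulerInt (b + 1) (c + 1) (e + 1) (a + 1) (a + 1) (c + 1) (d + 1 + 1)
      - (b + 1 + (c + 1) - (d + 1) + 1) * (a + 1 + (e + 1) - (d + 1) + 1) *
        (a + 1 + (c + 1) - (d + 1) + 1) * kRho (a + 1) (b + 1) (c + 1) (d + 1) (e + 1) *
        eulerInt (b + 1) (c + 1) (e + 1) (a + 1) (a + 1) (c + 1) (d + 1) = 0 := by
  set ρ := kRho (a + 1) (b + 1) (c + 1) (d + 1) (e + 1) with hρ
  set μ := kMu (a + 1) (b + 1) (c + 1) (d + 1) (e + 1) with hμ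
  set T₁ := kT₁ (a + 1) (b + 1) (c + 1) (d + 1) (e + 1) with hT₁
  set Q₁ := kQ₁ (a + 1) (b + 1) (c + 1) (d + 1) (e + 1) with hQ₁
  set Q₀ := kQ₀ (a + 1) (b + 1) (c + 1) (d + 1) (e + 1) with hQ₀
  set Λ := kLam (a + 1) (b + 1) (c + 1) (d + 1) (e + 1) with hΛ
  have hdom : EulerDom b (c + 2) e (a + 2) a c (d + 1) := by
    refine ⟨?_, ?_, ?_, ?_, ?_, ?_, ?_, ?_⟩ <;> linarith
  have hex := eulerFun_exact hdom (by linarith) (by linarith)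
    (C (c + 1) * (C T₁ * X ^ 2 + C Q₁ * X + C Q₀))
  set N : ℝ[X] := (C (b + (c + 2) + 1) + X) * ((C (b + (c + 2 - 1) + 1) + X)
      * ((C (e + (a + 2) + 1) + X) * ((C (e + (a + 2 - 1) + 1) + X) * 1))) with hN
  have hpoly : (C (d + 1) + X) * (C (a + 1) + X) * (C (b + 1) + X) * (C (e + 1) + X) *
        (C (c + 1) * (C T₁ * X ^ 2 + C Q₁ * X + C Q₀)).comp (X + 1)
        - X * (X - C (c + 1 - (d + 1))) * (C (b + (c + 2) + 1) + X) * (C (e + (a + 2) + 1) + X) *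
          (C (c + 1) * (C T₁ * X ^ 2 + C Q₁ * X + C Q₀)) =
      ((c + 1) * Λ) • N
      + μ • ((C (b + 1) + X) * ((C (e + 1) + X) * ((C (d + 1) + X) * ((C (a + 1) + X) * 1))))
      + (-((a + e + 2 - (d + 1) + 1) * (b + c + 2 - (d + 1) + 1) * ρ)) •
        ((C (b + 1) + X) * ((C (e + 1) + X) * ((C (c + 1 - (d + 1)) - X) *
          ((C (a + 1) + X) * 1)))) := by
    refine Polynomial.funext fun s => ?_
    have := certificate_snd (A := a + e + 2) (B := b + c + 2) (u := c - d)
      (e₁ := a + b + e + 3)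
      (e₂ := (a + 1) * (b + 1) + (a + 1) * (e + 1) + (b + 1) * (e + 1))
      (e₃ := (a + 1) * (b + 1) * (e + 1)) (w := (a + c + 1 - d) * (b + c + 1 - d) * (e + c + 1 - d))
      (γ := c + 1) (δ := d + 1) (T₀ := kT₀ (a + 1) (b + 1) (c + 1) (d + 1) (e + 1)) (T₁ := T₁)
      (ρ := ρ) (Q₁ := Q₁) (Q₀ := Q₀) (L := Λ) (μ := μ)
      (G := (a + 1 + s) * (b + 1 + s) * (e + 1 + s)) (s := s)
      (by ring) (by ring) (by ring) (by ring)
      (by rw [kT₀]; ring) (by rw [hT₁, kT₁]; ring) (by rw [hρ, kRho]) (by rw [hΛ, kLam]; ring)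
      (by rw [hQ₁, kQ₁]; ring) (by rw [hQ₀, kQ₀]; ring) (by rw [hμ, kMu]; ring)
    clear_value ρ μ T₁ Q₁ Q₀ Λ
    simp only [hN]
    simp only [eval_add, eval_sub, eval_mul, eval_C, eval_X, eval_comp, eval_pow, eval_one,
      eval_smul, smul_eq_mul]
    rw [show c + 1 - (d + 1) = c - d by ring]
    rw [show b + (c + 2) + 1 + s = b + c + 2 + 1 + s by ring,
      show b + (c + 2 - 1) + 1 + s = b + c + 2 + s by ring,
      show e + (a + 2) + 1 + s = a + e + 2 + 1 + s by ring,
      show e + (a + 2 - 1) + 1 + s = a + e + 2 + s by ring]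
    generalize b + c + 2 + 1 + s = n₁ at this ⊢
    generalize b + c + 2 + s = n₂ at this ⊢
    generalize a + e + 2 + 1 + s = n₃ at this ⊢
    generalize a + e + 2 + s = n₄ at this ⊢
    generalize a + 1 + s = x₁ at this ⊢
    generalize b + 1 + s = x₂ at this ⊢
    generalize e + 1 + s = x₃ at this ⊢
    generalize d + 1 + s = x₄ at this ⊢
    generalize T₁ * (s + 1) ^ 2 + Q₁ * (s + 1) + Q₀ = q₁ at this ⊢
    generalize T₁ * s ^ 2 + Q₁ * s + Q₀ = q₀ at this ⊢
    generalize (a + e + 2 - (d + 1) + 1) * (b + c + 2 - (d + 1) + 1) * ρ = k at this ⊢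
    generalize c - d = u at this ⊢
    generalize c + 1 = γ at this ⊢
    clear * - this
    linear_combination this
  rw [hpoly] at hex
  simp only [eulerFun_eq_eulerLin, LinearMap.map_add, LinearMap.map_smul, smul_eq_mul] at hex
  simp only [← eulerFun_eq_eulerLin] at hex
  rw [hN, eulerFun_lower_mul hb hc he ha ha hc (by linarith) (by linarith),
    eulerFun_shift_mul hb hc he ha ha hc (by linarith) (by linarith),
    eulerFun_shift_mul hb hc he ha ha hc (by linarith) (by linarith),
    eulerFun_e_mul,
    eulerFun_c₁_mul (by refine ⟨?_, ?_, ?_, ?_, ?_, ?_, ?_, ?_⟩ <;> linarith), eulerFun_one,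
    eulerFun_c₂_mul (by refine ⟨?_, ?_, ?_, ?_, ?_, ?_, ?_, ?_⟩ <;> linarith),
    eulerFun_c₁_mul (by refine ⟨?_, ?_, ?_, ?_, ?_, ?_, ?_, ?_⟩ <;> linarith),
    eulerFun_one] at hex
  have h1 : c + 2 ≠ 0 := by linarith
  have h2 : a + 2 ≠ 0 := by linarith
  have h3 : Λ = (a + 1) * (b + 1) * (e + 1) * ((a + c + 1 - d) *
      (b + 1 + (c + 1) - (d + 1)) * (e + 1 + (c + 1) - (d + 1))) := by
    rw [hΛ, kLam]; ring
  refine mul_left_cancel₀ (mul_ne_zero (mul_ne_zero h1 h2) hne) ?_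
  rw [h3, show a + (c + 1) + 2 - (d + 1 + 1) = a + c + 1 - d by ring,
    show a + c + 2 - (d + 1) = a + c + 1 - d by ring,
    show a + (c + 1) + 2 - (d + 1) = a + 1 + (c + 1) - (d + 1) + 1 by ring,
    show a + e + 2 - (d + 1) + 1 = a + 1 + (e + 1) - (d + 1) + 1 by ring,
    show b + c + 2 - (d + 1) + 1 = b + 1 + (c + 1) - (d + 1) + 1 by ring] at hex
  generalize a + c + 1 - d = f₁ at hex ⊢
  generalize a + 1 + (c + 1) - (d + 1) + 1 = f₂ at hex ⊢
  generalize a + 1 + (e + 1) - (d + 1) + 1 = f₃ at hex ⊢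
  generalize b + 1 + (c + 1) - (d + 1) + 1 = f₄ at hex ⊢
  generalize b + 1 + (c + 1) - (d + 1) = f₅ at hex ⊢
  generalize e + 1 + (c + 1) - (d + 1) = f₆ at hex ⊢
  generalize eulerInt b c e a a c (d + 1) = Y₀ at hex ⊢
  generalize eulerInt (b + 1) (c + 1) (e + 1) (a + 1) (a + 1) (c + 1) (d + 1 + 1) = Y₁ at hex ⊢
  generalize eulerInt (b + 1) (c + 1) (e + 1) (a + 1) (a + 1) (c + 1) (d + 1) = X₁ at hex ⊢
  clear_value ρ μ
  generalize a + 1 = α at hex ⊢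
  generalize b + 1 = β at hex ⊢
  generalize c + 1 = γ at hex ⊢
  generalize d + 1 = δ at hex ⊢
  generalize e + 1 = ε at hex ⊢
  generalize a + 2 = α' at hex ⊢
  generalize c + 2 = γ' at hex ⊢
  clear * - hex
  linear_combination hex

/-- The relation of `contiguity_fst` as long as the common factor `d (a + c + 1 - d)` of the terms
that `certificate_fst` produces can be cancelled. The certificate applies to the functional with
`c₂ = c - 1`, whence the condition `0 < c`. -/
theorem contiguity_fst_aux (ha : -1 < a) (hb : -1 < b) (hc : 0 < c) (he : -1 < e)
    (hd : d < b + c + 1) (hd' : d < e + c + 1) (hne : a + c + 1 - d ≠ 0) (hd0 : d ≠ 0) :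
    kRho (a + 1) (b + 1) (c + 1) (d + 1) (e + 1) * eulerInt b c e a a c d
      - (b + 1 + (c + 1) - (d + 1)) * (e + 1 + (c + 1) - (d + 1)) *
        kSigma (a + 1) (b + 1) (c + 1) (e + 1) * eulerInt b c e a a c (d + 1)
      + (d + 1) * (e + 1) * (a + 1 + (e + 1) - (b + 1)) * (b + 1 + (c + 1) - (a + 1)) *
        (b + 1 + (c + 1) - (e + 1)) *
        eulerInt (b + 1) (c + 1) (e + 1) (a + 1) (a + 1) (c + 1) (d + 1 + 1) = 0 := by
  set ρ := kRho (a + 1) (b + 1) (c + 1) (d + 1) (e + 1) with hρ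
  set σ := kSigma (a + 1) (b + 1) (c + 1) (e + 1) with hσ
  have hdom : EulerDom b (c + 2) e (a + 2) a (c - 1) d := by
    refine ⟨?_, ?_, ?_, ?_, ?_, ?_, ?_, ?_⟩ <;> linarith
  set N : ℝ[X] := (C (b + (c + 2) + 1) + X) * ((C (b + (c + 2 - 1) + 1) + X)
      * ((C (e + (a + 2) + 1) + X) * ((C (e + (a + 2 - 1) + 1) + X) * 1))) with hN
  -- `k` is the product `(A-α)(A-β)(A-ε)(B-α)(B-β)(B-ε)`
  set k := (e + 1) * (a + e + 1 - b) * (a + 1) * ((b + c + 1 - a) * (c + 1) * (b + c + 1 - e))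
    with hk
  set w := (a + c + 1 - d) * ((b + 1 + (c + 1) - (d + 1)) * (e + 1 + (c + 1) - (d + 1))) with hw
  obtain ⟨q, hpoly⟩ : ∃ q : ℝ[X],
      (C d + X) * (C (a + 1) + X) * (C (b + 1) + X) * (C (e + 1) + X) * q.comp (X + 1)
        - X * (X - C (c - 1 + 1 - d)) * (C (b + (c + 2) + 1) + X) *
          (C (e + (a + 2) + 1) + X) * q =
      k • ((C (b + 1) + X) * ((C (e + 1) + X) * ((C d + X) * ((C (d + 1) + X) *
          ((C (a + 1) + X) * 1)))))
      + (d * ρ) • ((C (c - 1 + 1 - d) - X) * N) + (-(w * σ)) • ((C d + X) * N) := by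
    obtain ⟨r₁, hr₁⟩ : ∃ r₁ : ℝ, r₁ = (a + e + 2) ^ 2 * (b + c + 2) ^ 2
        - ((a + 1) * (b + 1) + (a + 1) * (e + 1) + (b + 1) * (e + 1)) *
          ((a + e + 2) * (b + c + 2)) + (a + 1) * (b + 1) * (e + 1) * (a + e + 2 + (b + c + 2))
        + (c - d) * σ := ⟨_, rfl⟩
    obtain ⟨p, hp⟩ : ∃ p : ℝ, p = (e + 1) * (a + e + 1 - b) * (a + 1) := ⟨_, rfl⟩
    obtain ⟨r, hr⟩ : ∃ r : ℝ, r = (b + c + 1 - a) * (c + 1) * (b + c + 1 - e) := ⟨_, rfl⟩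
    obtain ⟨r₀, hr₀⟩ : ∃ r₀ : ℝ, r₀ = (b + c + 2) * (b + c + 2 + (c - d)) * p
        + (b + c + 2) * r₁ := ⟨_, rfl⟩
    refine ⟨C (p * r) * (C d + X) - (C (b + c + 2) + X) * (C (a + e + 2) + X) *
      (C r₀ + C r₁ * (X - 1)), ?_⟩
    refine Polynomial.funext fun s => ?_
    have := certificate_fst (A := a + e + 2) (B := b + c + 2) (u := c - d)
      (e₁ := a + b + e + 3)
      (e₂ := (a + 1) * (b + 1) + (a + 1) * (e + 1) + (b + 1) * (e + 1))
      (e₃ := (a + 1) * (b + 1) * (e + 1)) (w := w) (σ := σ) (d := d) (ρ := ρ) (p := p) (r := r)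
      (r₁ := r₁) (r₀ := r₀)
      (G := (a + 1 + s) * (b + 1 + s) * (e + 1 + s)) (s := s)
      (by ring) (by rw [hw]; ring) (by rw [hσ, kSigma]; ring) (by ring)
      (by rw [hρ, kRho, kT₀, kT₁, hw]; ring) (by rw [hp]; ring) (by rw [hr]; ring) hr₁ hr₀
    have hk' : k = p * r := by rw [hk, hp, hr]
    clear_value ρ σ w k
    subst hk'
    simp only [hN]
    simp only [eval_add, eval_sub, eval_mul, eval_C, eval_X, eval_comp, eval_one,
      eval_smul, smul_eq_mul]
    rw [show c - 1 + 1 - d = c - d by ring, show b + c + 2 + (s + 1) = b + c + 2 + 1 + s by ring,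
      show a + e + 2 + (s + 1) = a + e + 2 + 1 + s by ring,
      show d + (s + 1) = d + 1 + s by ring, show s + 1 - 1 = s by ring]
    rw [show b + (c + 2) + 1 + s = b + c + 2 + 1 + s by ring,
      show b + (c + 2 - 1) + 1 + s = b + c + 2 + s by ring,
      show e + (a + 2) + 1 + s = a + e + 2 + 1 + s by ring,
      show e + (a + 2 - 1) + 1 + s = a + e + 2 + s by ring]
    generalize b + c + 2 + 1 + s = n₁ at this ⊢
    generalize b + c + 2 + s = n₂ at this ⊢
    generalize a + e + 2 + 1 + s = n₃ at this ⊢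
    generalize a + e + 2 + s = n₄ at this ⊢
    generalize a + 1 + s = x₁ at this ⊢
    generalize b + 1 + s = x₂ at this ⊢
    generalize e + 1 + s = x₃ at this ⊢
    generalize d + 1 + s = x₄ at this ⊢
    generalize d + s = x₅ at this ⊢
    generalize r₀ + r₁ * s = q₁ at this ⊢
    generalize r₀ + r₁ * (s - 1) = q₀ at this ⊢
    generalize c - d = u at this ⊢
    clear * - this
    linear_combination this
  have hex := eulerFun_exact hdom (by linarith) (by linarith) q
  rw [hpoly] at hex
  simp only [eulerFun_eq_eulerLin, LinearMap.map_add, LinearMap.map_smul, smul_eq_mul] at hex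
  simp only [← eulerFun_eq_eulerLin] at hex
  rw [eulerFun_shift_mul hb (by linarith) he ha ha (by linarith) (by linarith) (by linarith),
    eulerFun_e_mul, eulerFun_e_mul,
    eulerFun_c₁_mul (by refine ⟨?_, ?_, ?_, ?_, ?_, ?_, ?_, ?_⟩ <;> linarith), eulerFun_one,
    eulerFun_c₂_mul hdom, eulerFun_e_mul, sub_add_cancel, hN,
    eulerFun_lower_mul hb (by linarith) he ha ha (by linarith) (by linarith) (by linarith),
    eulerFun_lower_mul hb (by linarith) he ha ha (by linarith) (by linarith) (by linarith)] at hex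
  have h1 : c + 2 ≠ 0 := by linarith
  have h2 : a + 2 ≠ 0 := by linarith
  have h3 : c + 1 ≠ 0 := by linarith
  have h4 : a + 1 ≠ 0 := by linarith
  refine mul_left_cancel₀ (mul_ne_zero (mul_ne_zero (mul_ne_zero h1 h2) (mul_ne_zero h3 h4))
    (mul_ne_zero hd0 hne)) ?_
  rw [hk, hw, show a + (c - 1) + 2 - d = a + c + 1 - d by ring,
    show a + (c + 1) + 2 - (d + 1 + 1) = a + c + 1 - d by ring,
    show a + e + 1 - b = a + 1 + (e + 1) - (b + 1) by ring,
    show b + c + 1 - a = b + 1 + (c + 1) - (a + 1) by ring,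
    show b + c + 1 - e = b + 1 + (c + 1) - (e + 1) by ring] at hex
  generalize a + c + 1 - d = f₁ at hex ⊢
  generalize a + 1 + (e + 1) - (b + 1) = f₂ at hex ⊢
  generalize b + 1 + (c + 1) - (a + 1) = f₃ at hex ⊢
  generalize b + 1 + (c + 1) - (e + 1) = f₄ at hex ⊢
  generalize b + 1 + (c + 1) - (d + 1) = f₅ at hex ⊢
  generalize e + 1 + (c + 1) - (d + 1) = f₆ at hex ⊢
  generalize eulerInt b c e a a c (d + 1) = Y₀ at hex ⊢
  generalize eulerInt b c e a a c d = X₀ at hex ⊢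
  generalize eulerInt (b + 1) (c + 1) (e + 1) (a + 1) (a + 1) (c + 1) (d + 1 + 1) = Y₁ at hex ⊢
  clear_value ρ σ
  generalize a + 1 = α at hex ⊢
  generalize c + 1 = γ at hex ⊢
  generalize d + 1 = δ at hex ⊢
  generalize e + 1 = ε at hex ⊢
  generalize a + 2 = α' at hex ⊢
  generalize c + 2 = γ' at hex ⊢
  clear * - hex
  linear_combination hex

end values

/-! ### Contiguity relations on the whole domain -/

/-- Positivity of `kRho` on the admissible cone: after the substitution `δ = min β ε + γ - u`,
`max β ε = min β ε + w` it is a polynomial with nonnegative coefficients. -/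
theorem kRho_pos {α β γ δ ε : ℝ} (hα : 0 < α) (hβ : 0 < β) (hγ : 0 < γ) (hε : 0 < ε)
    (h₁ : δ < β + γ) (h₂ : δ < ε + γ) : 0 < kRho α β γ δ ε := by
  rcases le_total β ε with h | h
  · obtain ⟨w, hw, rfl⟩ : ∃ w, 0 ≤ w ∧ ε = β + w := ⟨ε - β, by linarith, by ring⟩
    obtain ⟨u, hu, rfl⟩ : ∃ u, 0 < u ∧ δ = β + γ - u := ⟨β + γ - δ, by linarith, by ring⟩
    have : kRho α β γ (β + γ - u) (β + w) =
        α ^ 2 * β ^ 2 * γ + α ^ 2 * β ^ 2 * u + α ^ 2 * β * γ ^ 2 + α ^ 2 * β * γ * u + α ^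
        2 * β * γ * w + α ^ 2 * β * u * w + α ^ 2 * γ ^ 2 * u + α ^ 2 * γ ^ 2 * w + α * β ^
        2 * γ * u + α * β ^ 2 * γ * w + α * β ^ 2 * u ^ 2 + α * β ^ 2 * u * w + α * β * γ ^
        2 * u + α * β * γ ^ 2 * w + α * β * γ * u ^ 2 + 2 * α * β * γ * u * w + α * β * γ *
        w ^ 2 + α * β * u ^ 2 * w + α * β * u * w ^ 2 + α * γ ^ 2 * u ^ 2 + 2 * α * γ ^ 2 *
        u * w + α * γ ^ 2 * w ^ 2 + β ^ 2 * γ * u ^ 2 + β ^ 2 * γ * u * w + β * γ ^ 2 * u ^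
        2 + β * γ ^ 2 * u * w + β * γ * u ^ 2 * w + β * γ * u * w ^ 2 + γ ^ 2 * u ^ 2 * w +
        γ ^ 2 * u * w ^ 2 := by
      simp only [kRho, kT₀, kT₁]; ring
    rw [this]; positivity
  · obtain ⟨w, hw, rfl⟩ : ∃ w, 0 ≤ w ∧ β = ε + w := ⟨β - ε, by linarith, by ring⟩
    obtain ⟨u, hu, rfl⟩ : ∃ u, 0 < u ∧ δ = ε + γ - u := ⟨ε + γ - δ, by linarith, by ring⟩
    have : kRho α (ε + w) γ (ε + γ - u) ε =
        α ^ 2 * γ ^ 2 * ε + α ^ 2 * γ ^ 2 * u + α ^ 2 * γ ^ 2 * w + α ^ 2 * γ * ε ^ 2 + α ^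
        2 * γ * ε * u + 2 * α ^ 2 * γ * ε * w + α ^ 2 * γ * u * w + α ^ 2 * γ * w ^ 2 + α ^
        2 * ε ^ 2 * u + α ^ 2 * ε ^ 2 * w + α ^ 2 * ε * u * w + α ^ 2 * ε * w ^ 2 + α * γ ^
        2 * ε * u + α * γ ^ 2 * u ^ 2 + α * γ ^ 2 * u * w + α * γ * ε ^ 2 * u + α * γ * ε *
        u ^ 2 + 2 * α * γ * ε * u * w + α * γ * u ^ 2 * w + α * γ * u * w ^ 2 + α * ε ^ 2 *
        u ^ 2 + α * ε ^ 2 * u * w + α * ε * u ^ 2 * w + α * ε * u * w ^ 2 + γ ^ 2 * ε * u ^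
        2 + γ ^ 2 * ε * u * w + γ * ε ^ 2 * u ^ 2 + γ * ε ^ 2 * u * w + γ * ε * u ^ 2 * w +
        γ * ε * u * w ^ 2 := by
      simp only [kRho, kT₀, kT₁]; ring
    rw [this]; positivity

section relations
variable {a b c d e : ℝ}

/-- The relation between `F(d)`, `F(d + 1)` and the shift of the latter by one in all parameters,
for the Euler integral `F(d)` of the five-parameter family. -/
theorem contiguity_fst (h : Admissible b c e a a c d) :
    kRho (a + 1) (b + 1) (c + 1) (d + 1) (e + 1) * eulerInt b c e a a c d
      - (b + 1 + (c + 1) - (d + 1)) * (e + 1 + (c + 1) - (d + 1)) *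
        kSigma (a + 1) (b + 1) (c + 1) (e + 1) * eulerInt b c e a a c (d + 1)
      + (d + 1) * (e + 1) * (a + 1 + (e + 1) - (b + 1)) * (b + 1 + (c + 1) - (a + 1)) *
        (b + 1 + (c + 1) - (e + 1)) *
        eulerInt (b + 1) (c + 1) (e + 1) (a + 1) (a + 1) (c + 1) (d + 1 + 1) = 0 := by
  have hX := h.eulerDom_zero
  have hY : EulerDom b c e a a c (d + 1) := by simpa using h.eulerDom le_rfl
  have hY1 : EulerDom (b + 1) (c + 1) (e + 1) (a + 1) (a + 1) (c + 1) (d + 1 + 1) :=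
    h.eulerDom zero_le_one
  obtain ⟨r₁, hr₁, g₁⟩ := hX.exists_diag
  obtain ⟨r₂, hr₂, g₂⟩ := hY.exists_diag
  obtain ⟨r₃, hr₃, g₃⟩ := hY1.exists_diag
  obtain ⟨r, hr, k₁, k₂, k₃⟩ : ∃ r > 0, r ≤ r₁ ∧ r ≤ r₂ ∧ r ≤ r₃ :=
    ⟨min r₁ (min r₂ r₃), by positivity, min_le_left _ _,
      (min_le_right _ _).trans (min_le_left _ _), (min_le_right _ _).trans (min_le_right _ _)⟩
  have f₁ := (analyticOnNhd_diagInt g₁).mono (Set.Ioi_subset_Ioi (neg_le_neg k₁))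
  have f₂ := (analyticOnNhd_diagInt g₂).mono (Set.Ioi_subset_Ioi (neg_le_neg k₂))
  have f₃ := (analyticOnNhd_diagInt g₃).mono (Set.Ioi_subset_Ioi (neg_le_neg k₃))
  have p₁ : AnalyticOnNhd ℝ (fun t => kRho (a + 1 + t) (b + 1 + t) (c + 1 + t) (d + 1 + t)
      (e + 1 + t)) (Set.Ioi (-r)) := fun t _ => by
    simp only [kRho, kT₀, kT₁]; fun_prop
  have p₂ : AnalyticOnNhd ℝ (fun t => (b + 1 + t + (c + 1 + t) - (d + 1 + t)) *
      (e + 1 + t + (c + 1 + t) - (d + 1 + t)) *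
      kSigma (a + 1 + t) (b + 1 + t) (c + 1 + t) (e + 1 + t)) (Set.Ioi (-r)) := fun t _ => by
    simp only [kSigma]; fun_prop
  have p₃ : AnalyticOnNhd ℝ (fun t => (d + 1 + t) * (e + 1 + t) * (a + 1 + t + (e + 1 + t) -
      (b + 1 + t)) * (b + 1 + t + (c + 1 + t) - (a + 1 + t)) *
      (b + 1 + t + (c + 1 + t) - (e + 1 + t))) (Set.Ioi (-r)) := fun t _ => by
    fun_prop
  have hev := AnalyticOnNhd.eq_zero_of_eventually
    (((p₁.mul f₁).sub (p₂.mul f₂)).add (p₃.mul f₃)) (t := 0) ?_ (by linarith)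
  · simpa [diagInt] using hev
  · obtain ⟨ha, hb, hc, he, hd, hd'⟩ :
        -1 < a ∧ -1 < b ∧ -1 < c ∧ -1 < e ∧ d < b + c + 1 ∧ d < e + c + 1 := by
      obtain ⟨h1, h2, h3, h4, h5, h6, h7, h8⟩ := h
      exact ⟨h4, h1, h2, h3, h7, h8⟩
    filter_upwards [eventually_gt_atTop (1 + |d|), eventually_gt_atTop (|a + c + 1 - d|)]
      with t ht ht'
    have := contiguity_fst_aux (a := a + t) (b := b + t) (c := c + t) (d := d + t) (e := e + t)
      (by linarith [abs_nonneg d]) (by linarith [abs_nonneg d]) (by linarith [abs_nonneg d])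
      (by linarith [abs_nonneg d]) (by linarith [abs_nonneg d]) (by linarith [abs_nonneg d])
      (by linarith [neg_abs_le (a + c + 1 - d)]) (by linarith [neg_abs_le d])
    simp only [diagInt, Pi.add_apply, Pi.sub_apply]
    simp only [add_right_comm _ t (1 : ℝ)] at this
    exact this

/-- The relation between `F(d + 1)` and the shifts of `F(d)` and `F(d + 1)` by one in all
parameters. -/
theorem contiguity_snd (h : Admissible b c e a a c d) :
    (a + 1) ^ 2 * (b + 1) * (c + 1) ^ 2 * (e + 1) * (b + 1 + (c + 1) - (d + 1)) *
        (e + 1 + (c + 1) - (d + 1)) * eulerInt b c e a a c (d + 1)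
      + kMu (a + 1) (b + 1) (c + 1) (d + 1) (e + 1) * (d + 1) *
        eulerInt (b + 1) (c + 1) (e + 1) (a + 1) (a + 1) (c + 1) (d + 1 + 1)
      - (b + 1 + (c + 1) - (d + 1) + 1) * (a + 1 + (e + 1) - (d + 1) + 1) *
        (a + 1 + (c + 1) - (d + 1) + 1) * kRho (a + 1) (b + 1) (c + 1) (d + 1) (e + 1) *
        eulerInt (b + 1) (c + 1) (e + 1) (a + 1) (a + 1) (c + 1) (d + 1) = 0 := by
  have hY : EulerDom b c e a a c (d + 1) := by simpa using h.eulerDom le_rfl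
  have hY1 : EulerDom (b + 1) (c + 1) (e + 1) (a + 1) (a + 1) (c + 1) (d + 1 + 1) :=
    h.eulerDom zero_le_one
  have hX1 : EulerDom (b + 1) (c + 1) (e + 1) (a + 1) (a + 1) (c + 1) (d + 1) := by
    obtain ⟨h1, h2, h3, h4, h5, h6, h7, h8⟩ := hY1
    exact ⟨h1, h2, h3, h4, h5, h6, by linarith, by linarith⟩
  obtain ⟨r₁, hr₁, g₁⟩ := hY.exists_diag
  obtain ⟨r₂, hr₂, g₂⟩ := hY1.exists_diag
  obtain ⟨r₃, hr₃, g₃⟩ := hX1.exists_diag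
  obtain ⟨r, hr, k₁, k₂, k₃⟩ : ∃ r > 0, r ≤ r₁ ∧ r ≤ r₂ ∧ r ≤ r₃ :=
    ⟨min r₁ (min r₂ r₃), by positivity, min_le_left _ _,
      (min_le_right _ _).trans (min_le_left _ _), (min_le_right _ _).trans (min_le_right _ _)⟩
  have f₁ := (analyticOnNhd_diagInt g₁).mono (Set.Ioi_subset_Ioi (neg_le_neg k₁))
  have f₂ := (analyticOnNhd_diagInt g₂).mono (Set.Ioi_subset_Ioi (neg_le_neg k₂))
  have f₃ := (analyticOnNhd_diagInt g₃).mono (Set.Ioi_subset_Ioi (neg_le_neg k₃))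
  have p₁ : AnalyticOnNhd ℝ (fun t => (a + 1 + t) ^ 2 * (b + 1 + t) * (c + 1 + t) ^ 2 *
      (e + 1 + t) * (b + 1 + t + (c + 1 + t) - (d + 1 + t)) *
      (e + 1 + t + (c + 1 + t) - (d + 1 + t))) (Set.Ioi (-r)) := fun t _ => by
    fun_prop
  have p₂ : AnalyticOnNhd ℝ (fun t => kMu (a + 1 + t) (b + 1 + t) (c + 1 + t) (d + 1 + t)
      (e + 1 + t) * (d + 1 + t)) (Set.Ioi (-r)) := fun t _ => by
    simp only [kMu, kQ₀, kQ₁, kLam, kRho, kT₀, kT₁]; fun_prop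
  have p₃ : AnalyticOnNhd ℝ (fun t => (b + 1 + t + (c + 1 + t) - (d + 1 + t) + 1) *
      (a + 1 + t + (e + 1 + t) - (d + 1 + t) + 1) * (a + 1 + t + (c + 1 + t) - (d + 1 + t) + 1) *
      kRho (a + 1 + t) (b + 1 + t) (c + 1 + t) (d + 1 + t) (e + 1 + t)) (Set.Ioi (-r)) :=
    fun t _ => by simp only [kRho, kT₀, kT₁]; fun_prop
  have hev := AnalyticOnNhd.eq_zero_of_eventually
    (((p₁.mul f₁).add (p₂.mul f₂)).sub (p₃.mul f₃)) (t := 0) ?_ (by linarith)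
  · simpa [diagInt] using hev
  · obtain ⟨ha, hb, hc, he, hd, hd'⟩ :
        -1 < a ∧ -1 < b ∧ -1 < c ∧ -1 < e ∧ d < b + c + 1 ∧ d < e + c + 1 := by
      obtain ⟨h1, h2, h3, h4, h5, h6, h7, h8⟩ := h
      exact ⟨h4, h1, h2, h3, h7, h8⟩
    filter_upwards [eventually_gt_atTop 0, eventually_gt_atTop (|a + c + 1 - d|)] with t ht ht'
    have := contiguity_snd_aux (a := a + t) (b := b + t) (c := c + t) (d := d + t) (e := e + t)
      (by linarith) (by linarith) (by linarith) (by linarith) (by linarith) (by linarith)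
      (by linarith [neg_abs_le (a + c + 1 - d)])
    simp only [diagInt, Pi.add_apply, Pi.sub_apply]
    simp only [add_right_comm _ t (1 : ℝ)] at this
    exact this

end relations

/-! ### The second-order recurrence and rational approximation -/

section coefficients
variable {R : Type*} [CommRing R]

/-- The coefficient of `F(d + 1)` in `contiguity_fst`, up to sign. -/
def kW (α β γ δ ε : R) : R := (β + γ - δ) * (ε + γ - δ) * kSigma α β γ ε

/-- The coefficient of the shifted integral in `contiguity_fst`. -/
def kG (α β γ δ ε : R) : R := δ * ε * (α + ε - β) * (β + γ - α) * (β + γ - ε)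

/-- The coefficient of `F(d + 1)` in `contiguity_snd`. -/
def kH (α β γ δ ε : R) : R := α ^ 2 * β * γ ^ 2 * ε * (β + γ - δ) * (ε + γ - δ)

/-- The linear factors of the last coefficient in `contiguity_snd`. -/
def kK (α β γ δ ε : R) : R := (β + γ - δ + 1) * (α + ε - δ + 1) * (α + γ - δ + 1)

/-- The coefficients of the second-order recurrence, obtained by eliminating `F(d)` from the two
contiguity relations. -/
def recCoeff (α β γ δ ε : R) : Fin 3 → R :=
  ![kRho (α + 1) (β + 1) (γ + 1) (δ + 1) (ε + 1) * kH α β γ δ ε,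
    kRho (α + 1) (β + 1) (γ + 1) (δ + 1) (ε + 1) * (kMu α β γ δ ε * δ)
      - kK α β γ δ ε * kRho α β γ δ ε * kW (α + 1) (β + 1) (γ + 1) (δ + 1) (ε + 1),
    kK α β γ δ ε * kRho α β γ δ ε * kG (α + 1) (β + 1) (γ + 1) (δ + 1) (ε + 1)]

section map
variable {S : Type*} [CommRing S] (f : R →+* S) (α β γ δ ε : R)

theorem map_kT₀ : f (kT₀ α β γ δ ε) = kT₀ (f α) (f β) (f γ) (f δ) (f ε) := by
  simp only [kT₀, map_mul, map_add, map_sub]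

theorem map_kT₁ : f (kT₁ α β γ δ ε) = kT₁ (f α) (f β) (f γ) (f δ) (f ε) := by
  simp only [kT₁, map_mul, map_add, map_sub, map_pow]

theorem map_kRho : f (kRho α β γ δ ε) = kRho (f α) (f β) (f γ) (f δ) (f ε) := by
  simp only [kRho, map_kT₀, map_kT₁, map_mul, map_sub]

theorem map_kW : f (kW α β γ δ ε) = kW (f α) (f β) (f γ) (f δ) (f ε) := by
  simp only [kW, kSigma, map_mul, map_add, map_sub]

theorem map_kG : f (kG α β γ δ ε) = kG (f α) (f β) (f γ) (f δ) (f ε) := by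
  simp only [kG, map_mul, map_add, map_sub]

theorem map_kH : f (kH α β γ δ ε) = kH (f α) (f β) (f γ) (f δ) (f ε) := by
  simp only [kH, map_mul, map_add, map_sub, map_pow]

theorem map_kK : f (kK α β γ δ ε) = kK (f α) (f β) (f γ) (f δ) (f ε) := by
  simp only [kK, map_mul, map_add, map_sub, map_one]

theorem map_kMu : f (kMu α β γ δ ε) = kMu (f α) (f β) (f γ) (f δ) (f ε) := by
  simp only [kMu, kQ₀, kQ₁, kLam, map_kT₀, map_kT₁, map_kRho, map_mul, map_add, map_sub, map_one,
    map_ofNat]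

theorem map_recCoeff (k : Fin 3) :
    f (recCoeff α β γ δ ε k) = recCoeff (f α) (f β) (f γ) (f δ) (f ε) k := by
  fin_cases k <;>
  simp [recCoeff, map_kRho, map_kH, map_kK, map_kG, map_kW, map_kMu]

end map

/-- The coefficients of the second-order recurrence as polynomials in `a, b, c, d, e, n`. -/
def kPoly (k : Fin 3) : MvPolynomial (Fin 6) ℤ :=
  recCoeff (MvPolynomial.X 0 + MvPolynomial.X 5 + 1) (MvPolynomial.X 1 + MvPolynomial.X 5 + 1)
    (MvPolynomial.X 2 + MvPolynomial.X 5 + 1) (MvPolynomial.X 3 + MvPolynomial.X 5 + 1)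
    (MvPolynomial.X 4 + MvPolynomial.X 5 + 1) k

theorem aeval_kPoly (a b c d e n : R) (k : Fin 3) :
    MvPolynomial.aeval ![a, b, c, d, e, n] (kPoly k) =
      recCoeff (a + n + 1) (b + n + 1) (c + n + 1) (d + n + 1) (e + n + 1) k := by
  have := map_recCoeff (MvPolynomial.aeval ![a, b, c, d, e, n] :
    MvPolynomial (Fin 6) ℤ →ₐ[ℤ] R).toRingHom (MvPolynomial.X 0 + MvPolynomial.X 5 + 1)
    (MvPolynomial.X 1 + MvPolynomial.X 5 + 1)
    (MvPolynomial.X 2 + MvPolynomial.X 5 + 1) (MvPolynomial.X 3 + MvPolynomial.X 5 + 1)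
    (MvPolynomial.X 4 + MvPolynomial.X 5 + 1) k
  simpa [kPoly] using this

theorem kRho_mul (x α β γ δ ε : R) :
    kRho (x * α) (x * β) (x * γ) (x * δ) (x * ε) = x ^ 5 * kRho α β γ δ ε := by
  simp only [kRho, kT₀, kT₁]; ring

theorem kH_mul (x α β γ δ ε : R) :
    kH (x * α) (x * β) (x * γ) (x * δ) (x * ε) = x ^ 8 * kH α β γ δ ε := by
  simp only [kH, ← mul_add, ← mul_sub]
  generalize β + γ - δ = s
  generalize ε + γ - δ = t
  ring

theorem kG_mul (x α β γ δ ε : R) :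
    kG (x * α) (x * β) (x * γ) (x * δ) (x * ε) = x ^ 5 * kG α β γ δ ε := by
  simp only [kG, ← mul_add, ← mul_sub]
  generalize α + ε - β = s
  generalize β + γ - α = t
  generalize β + γ - ε = r
  ring

end coefficients

section family
variable {a b c d e : ℝ}

theorem KFamily_eq (a b c d e : ℝ) (n : ℕ) :
    KFamily a b c d e n = diagInt b c e a a c (d + 1) n / eulerInt b c e a a c d := by
  rw [KFamily, I3, J3_eq_eulerInt, J3_zero, diagInt]

theorem Admissible.add_nat {a₁ a₂ b₁ b₂ c₁ c₂ e : ℝ} (h : Admissible a₁ a₂ b₁ b₂ c₁ c₂ e)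
    (n : ℕ) : Admissible (a₁ + n) (a₂ + n) (b₁ + n) (b₂ + n) (c₁ + n) (c₂ + n) (e + n) := by
  obtain ⟨h1, h2, h3, h4, h5, h6, h7, h8⟩ := h
  have := Nat.cast_nonneg (α := ℝ) n
  refine ⟨?_, ?_, ?_, ?_, ?_, ?_, ?_, ?_⟩ <;> linarith

theorem diagInt_fst_rel (h : Admissible b c e a a c d) (n : ℕ) :
    kRho (a + n + 1) (b + n + 1) (c + n + 1) (d + n + 1) (e + n + 1) * diagInt b c e a a c d n
      - kW (a + n + 1) (b + n + 1) (c + n + 1) (d + n + 1) (e + n + 1) *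
        diagInt b c e a a c (d + 1) n
      + kG (a + n + 1) (b + n + 1) (c + n + 1) (d + n + 1) (e + n + 1) *
        diagInt b c e a a c (d + 1) (n + 1 : ℕ) = 0 := by
  have := contiguity_fst (h.add_nat n)
  simp only [kW, kG, diagInt, Nat.cast_add, Nat.cast_one, ← add_assoc,
    add_right_comm _ (1 : ℝ) (n : ℝ)] at this ⊢
  exact this

theorem diagInt_snd_rel (h : Admissible b c e a a c d) (n : ℕ) :
    kH (a + n + 1) (b + n + 1) (c + n + 1) (d + n + 1) (e + n + 1) *
        diagInt b c e a a c (d + 1) n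
      + kMu (a + n + 1) (b + n + 1) (c + n + 1) (d + n + 1) (e + n + 1) * (d + n + 1) *
        diagInt b c e a a c (d + 1) (n + 1 : ℕ)
      - kK (a + n + 1) (b + n + 1) (c + n + 1) (d + n + 1) (e + n + 1) *
        kRho (a + n + 1) (b + n + 1) (c + n + 1) (d + n + 1) (e + n + 1) *
        diagInt b c e a a c d (n + 1 : ℕ) = 0 := by
  have := contiguity_snd (h.add_nat n)
  simp only [kH, kK, diagInt, Nat.cast_add, Nat.cast_one, ← add_assoc,
    add_right_comm _ (1 : ℝ) (n : ℝ)] at this ⊢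
  exact this

theorem KFamily_recurrence (h : Admissible b c e a a c d) (n : ℕ) :
    ∑ k : Fin 3, recCoeff (a + n + 1) (b + n + 1) (c + n + 1) (d + n + 1) (e + n + 1) k *
      KFamily a b c d e (n + k) = 0 := by
  have h1 := diagInt_fst_rel h (n + 1)
  have h2 := diagInt_snd_rel h n
  simp only [KFamily_eq, mul_div_assoc', ← Finset.sum_div]
  rw [div_eq_zero_iff]; left
  simp only [Fin.sum_univ_three, Fin.val_zero, Fin.val_one, Fin.val_two, recCoeff, add_zero,
    Matrix.cons_val_zero, Matrix.cons_val_one, Matrix.cons_val]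
  simp only [show n + 1 + 1 = n + 2 from rfl, Nat.cast_add, Nat.cast_one, Nat.cast_ofNat,
    ← add_assoc] at h1 h2 ⊢
  linear_combination kRho (a + n + 1 + 1) (b + n + 1 + 1) (c + n + 1 + 1) (d + n + 1 + 1)
    (e + n + 1 + 1) * h2 + kK (a + n + 1) (b + n + 1) (c + n + 1) (d + n + 1) (e + n + 1) *
        kRho (a + n + 1) (b + n + 1) (c + n + 1) (d + n + 1) (e + n + 1) * h1

theorem Admissible.kRho_pos (h : Admissible b c e a a c d) {t : ℝ} (ht : 0 ≤ t) :
    0 < kRho (a + t + 1) (b + t + 1) (c + t + 1) (d + t + 1) (e + t + 1) := by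
  obtain ⟨h1, h2, h3, h4, h5, h6, h7, h8⟩ := h
  exact _root_.kRho_pos (by linarith) (by linarith) (by linarith) (by linarith) (by linarith)
    (by linarith)

theorem recCoeff_zero_pos (h : Admissible b c e a a c d) (n : ℕ) :
    0 < recCoeff (a + n + 1) (b + n + 1) (c + n + 1) (d + n + 1) (e + n + 1) 0 := by
  have h0 := Nat.cast_nonneg (α := ℝ) n
  have hρ := h.kRho_pos (t := n + 1) (by linarith)
  obtain ⟨h1, h2, h3, h4, h5, h6, h7, h8⟩ := h
  simp only [← add_assoc] at hρ
  have i1 : 0 < a + n + 1 := by linarith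
  have i2 : 0 < b + n + 1 := by linarith
  have i3 : 0 < c + n + 1 := by linarith
  have i4 : 0 < e + n + 1 := by linarith
  have i5 : 0 < b + n + 1 + (c + n + 1) - (d + n + 1) := by linarith
  have i6 : 0 < e + n + 1 + (c + n + 1) - (d + n + 1) := by linarith
  simp only [recCoeff, Matrix.cons_val_zero, kH]
  positivity

/-- The last coefficient vanishes only if one of six linear factors does. -/
theorem recCoeff_two_ne_zero (h : Admissible b c e a a c d) {n : ℕ} (h₁ : d + n + 2 ≠ 0)
    (h₂ : a + c - d + n + 2 ≠ 0) (h₃ : a + e - d + n + 2 ≠ 0) (h₄ : a + e - b + n + 2 ≠ 0)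
    (h₅ : b + c - e + n + 2 ≠ 0) (h₆ : b + c - a + n + 2 ≠ 0) :
    recCoeff (a + n + 1) (b + n + 1) (c + n + 1) (d + n + 1) (e + n + 1) 2 ≠ 0 := by
  have h0 := Nat.cast_nonneg (α := ℝ) n
  have hρ := h.kRho_pos h0
  obtain ⟨g1, g2, g3, g4, g5, g6, g7, g8⟩ := h
  have i1 : e + n + 2 ≠ 0 := by linarith
  have i2 : b + c - d + n + 2 ≠ 0 := by linarith
  have : recCoeff (a + n + 1) (b + n + 1) (c + n + 1) (d + n + 1) (e + n + 1) 2 =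
      (b + c - d + n + 2) * (a + e - d + n + 2) * (a + c - d + n + 2) *
      kRho (a + n + 1) (b + n + 1) (c + n + 1) (d + n + 1) (e + n + 1) *
      ((d + n + 2) * (e + n + 2) * (a + e - b + n + 2) * (b + c - a + n + 2) *
        (b + c - e + n + 2)) := by
    simp only [recCoeff, Matrix.cons_val, kK, kG]
    rw [show b + n + 1 + (c + n + 1) - (d + n + 1) + 1 = b + c - d + n + 2 by ring,
      show a + n + 1 + (e + n + 1) - (d + n + 1) + 1 = a + e - d + n + 2 by ring,
      show a + n + 1 + (c + n + 1) - (d + n + 1) + 1 = a + c - d + n + 2 by ring,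
      show a + n + 1 + 1 + (e + n + 1 + 1) - (b + n + 1 + 1) = a + e - b + n + 2 by ring,
      show b + n + 1 + 1 + (c + n + 1 + 1) - (a + n + 1 + 1) = b + c - a + n + 2 by ring,
      show b + n + 1 + 1 + (c + n + 1 + 1) - (e + n + 1 + 1) = b + c - e + n + 2 by ring,
      show d + n + 1 + 1 = d + n + 2 by ring, show e + n + 1 + 1 = e + n + 2 by ring]
  rw [this]
  simp only [ne_eq, mul_eq_zero, not_or]
  exact ⟨⟨⟨⟨i2, h₃⟩, h₂⟩, hρ.ne'⟩, ⟨⟨⟨h₁, i1⟩, h₄⟩, h₆⟩, h₅⟩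

theorem eventually_recCoeff_two_ne_zero (h : Admissible b c e a a c d) :
    ∀ᶠ n : ℕ in atTop,
      recCoeff (a + n + 1) (b + n + 1) (c + n + 1) (d + n + 1) (e + n + 1) 2 ≠ 0 := by
  filter_upwards [tendsto_natCast_atTop_atTop.eventually_gt_atTop
    (|a| + |b| + |c| + |d| + |e|)] with n hn
  have := abs_nonneg a; have := abs_nonneg b; have := abs_nonneg c
  have := abs_nonneg d; have := abs_nonneg e
  have := neg_abs_le a; have := neg_abs_le b; have := neg_abs_le c
  have := neg_abs_le d; have := neg_abs_le e
  have := le_abs_self a; have := le_abs_self b; have := le_abs_self c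
  have := le_abs_self d; have := le_abs_self e
  refine recCoeff_two_ne_zero h ?_ ?_ ?_ ?_ ?_ ?_ <;> linarith

theorem Nondegenerate.recCoeff_two_ne_zero (h : Admissible b c e a a c d)
    (hn : Nondegenerate a b c d e) (n : ℕ) :
    recCoeff (a + n + 1) (b + n + 1) (c + n + 1) (d + n + 1) (e + n + 1) 2 ≠ 0 := by
  obtain ⟨k1, k2, k3, k4, k5, k6⟩ := hn (n + 1)
  push_cast at k1 k2 k3 k4 k5 k6
  refine _root_.recCoeff_two_ne_zero h ?_ ?_ ?_ ?_ ?_ ?_ <;> intro h0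
  · exact k1 (by linarith)
  · exact k2 (by linarith)
  · exact k3 (by linarith)
  · exact k4 (by linarith)
  · exact k5 (by linarith)
  · exact k6 (by linarith)

theorem tendsto_recCoeff_div (a b c d e : ℝ) :
    Tendsto (fun n : ℕ => recCoeff (a + n + 1) (b + n + 1) (c + n + 1) (d + n + 1) (e + n + 1) 0 /
      recCoeff (a + n + 1) (b + n + 1) (c + n + 1) (d + n + 1) (e + n + 1) 2) atTop (𝓝 1) := by
  -- both coefficients are `n ^ 13` times a function of `1 / n` with value `12` at `0`
  set f : ℝ → ℝ → ℝ := fun t r =>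
    kRho (t * a + 1 + r * t) (t * b + 1 + r * t) (t * c + 1 + r * t) (t * d + 1 + r * t)
      (t * e + 1 + r * t) with hf
  set g₀ : ℝ → ℝ := fun t => f t 2 * kH (t * a + 1 + 1 * t) (t * b + 1 + 1 * t)
    (t * c + 1 + 1 * t) (t * d + 1 + 1 * t) (t * e + 1 + 1 * t) with hg₀
  set g₂ : ℝ → ℝ := fun t => (t * (b + c - d) + 1 + 2 * t) * (t * (a + e - d) + 1 + 2 * t) *
    (t * (a + c - d) + 1 + 2 * t) * f t 1 * kG (t * a + 1 + 2 * t) (t * b + 1 + 2 * t)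
      (t * c + 1 + 2 * t) (t * d + 1 + 2 * t) (t * e + 1 + 2 * t) with hg₂
  have c₀ : Continuous g₀ := by
    simp only [hg₀, hf, kRho, kT₀, kT₁, kH]; fun_prop
  have c₂ : Continuous g₂ := by
    simp only [hg₂, hf, kRho, kT₀, kT₁, kG]; fun_prop
  have e₀ : g₀ 0 = 12 := by
    simp only [hg₀, hf, kRho, kT₀, kT₁, kH]; norm_num
  have e₂ : g₂ 0 = 12 := by
    simp only [hg₂, hf, kRho, kT₀, kT₁, kG]; norm_num
  have hlim : Tendsto (fun n : ℕ => g₀ ((n : ℝ)⁻¹) / g₂ ((n : ℝ)⁻¹)) atTop (𝓝 1) := by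
    have t0 := tendsto_inv_atTop_nhds_zero_nat (𝕜 := ℝ)
    have := ((c₀.tendsto 0).comp t0).div ((c₂.tendsto 0).comp t0) (by rw [e₂]; norm_num)
    rwa [e₀, e₂, div_self (by norm_num)] at this
  refine hlim.congr' ?_
  filter_upwards [eventually_gt_atTop 0] with n hn
  have hn' : (n : ℝ) ≠ 0 := by positivity
  generalize (n : ℝ) = x at hn'
  have hx : ∀ u r : ℝ, u + x + r = x * (x⁻¹ * u + 1 + r * x⁻¹) := fun u r => by
    field_simp
  have hρ : ∀ r, kRho (a + x + r) (b + x + r) (c + x + r) (d + x + r) (e + x + r) =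
      x ^ 5 * f x⁻¹ r := fun r => by
    simp only [hx, kRho_mul, hf]
  have hx2 : ∀ u : ℝ, u + x + 1 + 1 = u + x + 2 := fun u => by ring
  have r₀ : recCoeff (a + x + 1) (b + x + 1) (c + x + 1) (d + x + 1) (e + x + 1) 0 =
      x ^ 13 * g₀ x⁻¹ := by
    simp only [recCoeff, Matrix.cons_val_zero, hg₀, hx2, hρ]
    simp only [hx, kH_mul]
    generalize f x⁻¹ 2 = F
    generalize kH (x⁻¹ * a + 1 + 1 * x⁻¹) _ _ _ _ = H
    ring
  have r₂ : recCoeff (a + x + 1) (b + x + 1) (c + x + 1) (d + x + 1) (e + x + 1) 2 =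
      x ^ 13 * g₂ x⁻¹ := by
    simp only [recCoeff, Matrix.cons_val, hg₂, hx2, hρ]
    rw [show kK (a + x + 1) (b + x + 1) (c + x + 1) (d + x + 1) (e + x + 1) =
      (b + c - d + x + 2) * (a + e - d + x + 2) * (a + c - d + x + 2) by rw [kK]; ring]
    simp only [hx, kG_mul]
    generalize f x⁻¹ 1 = F
    generalize kG (x⁻¹ * a + 1 + 2 * x⁻¹) _ _ _ _ = G
    generalize x⁻¹ * (b + c - d) + 1 + 2 * x⁻¹ = u₁
    generalize x⁻¹ * (a + e - d) + 1 + 2 * x⁻¹ = u₂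
    generalize x⁻¹ * (a + c - d) + 1 + 2 * x⁻¹ = u₃
    ring
  rw [r₀, r₂, mul_div_mul_left _ _ (pow_ne_zero _ hn')]

/-- The `n`-th power in the integrand is that of a function bounded by `1 / 4`. -/
theorem diagInt_le (h : Admissible b c e a a c d) (n : ℕ) :
    diagInt b c e a a c (d + 1) n ≤ (1 / 4) ^ n * diagInt b c e a a c (d + 1) 0 := by
  have hJ : ∀ n : ℕ, diagInt b c e a a c (d + 1) n = J3 b c e a a c (d + 1) n := fun n => by
    rw [J3_eq_eulerInt, diagInt]
  have h0 := hJ 0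
  rw [Nat.cast_zero] at h0
  rw [hJ, h0, J3, J3, ← integral_const_mul]
  refine setIntegral_mono_on (h.integrableOn_J3Integrand n)
    ((h.integrableOn_J3Integrand 0).const_mul _) measurableSet_unitCube ?_
  rintro ⟨x, y, z⟩ ⟨⟨hx, hx'⟩, ⟨hy, hy'⟩, ⟨hz, hz'⟩⟩
  dsimp only at hx hx' hy hy' hz hz'
  have h1x := sub_pos.2 hx'
  have h1y := sub_pos.2 hy'
  have h1z := sub_pos.2 hz'
  have hD : 0 < 1 - z + x * y * z := by positivity
  have hle : x * (1 - x) * y * (1 - y) * z * (1 - z) / (1 - z + x * y * z) ≤ 1 / 4 := by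
    rw [div_le_iff₀ hD]
    have k1 : x * (1 - x) ≤ 1 / 4 := by nlinarith [sq_nonneg (x - 1 / 2)]
    have k2 : y * (1 - y) * z ≤ 1 := by
      have : y * (1 - y) ≤ 1 := by nlinarith
      nlinarith [mul_pos hy h1y]
    have k3 : 1 - z ≤ 1 - z + x * y * z := by nlinarith [mul_pos (mul_pos hx hy) hz]
    calc x * (1 - x) * y * (1 - y) * z * (1 - z)
        = (x * (1 - x)) * (y * (1 - y) * z) * (1 - z) := by ring
      _ ≤ 1 / 4 * 1 * (1 - z + x * y * z) := by gcongr
      _ = _ := by ring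
  simp only [J3Integrand, pow_zero, mul_one]
  rw [mul_comm]
  exact mul_le_mul_of_nonneg_right (pow_le_pow_left₀ (by positivity) hle n) (by positivity)

end family

/-- If two solutions `A`, `B` of a second-order recurrence have nonzero Casoratian, the quotient of
the outer coefficients tends to `1` and `B κ - A` is positive and decays geometrically, then
`A / B` tends to `κ`: the increments of `B / (B κ - A)` are bounded away from `0` and eventually
have constant sign. -/
theorem tendsto_div_of_casoratian {p₀ p₁ p₂ A B K : ℕ → ℝ} {κ C θ : ℝ}
    (hA : ∀ n, p₀ n * A n + p₁ n * A (n + 1) + p₂ n * A (n + 2) = 0)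
    (hB : ∀ n, p₀ n * B n + p₁ n * B (n + 1) + p₂ n * B (n + 2) = 0)
    (h₀ : ∀ n, p₀ n ≠ 0) (h₂ : ∀ n, p₂ n ≠ 0)
    (hlim : Tendsto (fun n => p₀ n / p₂ n) atTop (𝓝 1))
    (hK : ∀ n, K n = B n * κ - A n) (hpos : ∀ n, 0 < K n) (hθ : 0 < θ) (hθ' : θ < 1)
    (hle : ∀ n, K n ≤ C * θ ^ n) (hW : A 1 * B 0 - A 0 * B 1 ≠ 0) :
    Tendsto (fun n => A n / B n) atTop (𝓝 κ) := by
  set W : ℕ → ℝ := fun n => A (n + 1) * B n - A n * B (n + 1) with hWdef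
  have hWrec : ∀ n, W (n + 1) = p₀ n / p₂ n * W n := fun n => by
    rw [div_mul_eq_mul_div, eq_div_iff (h₂ n)]
    simp only [hWdef]
    linear_combination (B (n + 1)) * hA n - A (n + 1) * hB n
  have hW0 : ∀ n, W n ≠ 0 := fun n => by
    induction n with
    | zero => simpa [hWdef] using hW
    | succ n ih => rw [hWrec]; exact mul_ne_zero (div_ne_zero (h₀ n) (h₂ n)) ih
  obtain ⟨N, hN⟩ := eventually_atTop.1 (hlim.eventually (lt_mem_nhds hθ'))
  obtain ⟨s, hs, hsW⟩ : ∃ s : ℝ, s * s = 1 ∧ 0 < s * W N := by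
    rcases lt_or_gt_of_ne (hW0 N) with h | h
    · exact ⟨-1, by norm_num, by linarith⟩
    · exact ⟨1, by norm_num, by linarith⟩
  have hlow : ∀ m, θ ^ m * (s * W N) ≤ s * W (N + m) := fun m => by
    induction m with
    | zero => simp
    | succ m ih =>
      rw [← add_assoc, hWrec, pow_succ]
      have h1 := hN (N + m) (by omega)
      have h2 : 0 < s * W (N + m) := lt_of_lt_of_le (by positivity) ih
      calc θ ^ m * θ * (s * W N) = θ * (θ ^ m * (s * W N)) := by ring
        _ ≤ (p₀ (N + m) / p₂ (N + m)) * (s * W (N + m)) :=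
          mul_le_mul h1.le ih (by positivity) (hθ.le.trans h1.le)
        _ = _ := by ring
  have hC : 0 < C := by
    have := (hpos 0).trans_le (hle 0)
    simpa using this
  set η : ℝ := s * W N / (C * C) with hη
  have hηpos : 0 < η := by positivity
  set q : ℕ → ℝ := fun n => B n / K n with hq
  have hstep : ∀ m, η ≤ s * q (N + (m + 1)) - s * q (N + m) := fun m => by
    have hk := hpos (N + m)
    have hk' := hpos (N + (m + 1))
    have e1 : s * q (N + (m + 1)) - s * q (N + m) =
        s * W (N + m) / (K (N + m) * K (N + (m + 1))) := by
      simp only [hq, hWdef]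
      rw [← mul_sub, div_sub_div _ _ hk'.ne' hk.ne', mul_div_assoc, mul_comm (K (N + m))]
      congr 2
      rw [hK, hK, add_assoc]; ring
    rw [e1, hη, div_le_div_iff₀ (by positivity) (by positivity)]
    have hKK : K (N + m) * K (N + (m + 1)) ≤ (C * θ ^ m) * C := by
      refine mul_le_mul ((hle _).trans ?_) ((hle _).trans ?_) hk'.le (by positivity)
      · refine mul_le_mul_of_nonneg_left ?_ hC.le
        exact pow_le_pow_of_le_one hθ.le hθ'.le (by omega)
      · exact mul_le_of_le_one_right hC.le (pow_le_one₀ hθ.le hθ'.le)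
    calc s * W N * (K (N + m) * K (N + (m + 1))) ≤ s * W N * (C * θ ^ m * C) := by gcongr
      _ = θ ^ m * (s * W N) * (C * C) := by ring
      _ ≤ s * W (N + m) * (C * C) := mul_le_mul_of_nonneg_right (hlow m) (by positivity)
  have hgrow : ∀ m : ℕ, m * η + s * q N ≤ s * q (N + m) := fun m => by
    induction m with
    | zero => simp
    | succ m ih => push_cast; linarith [hstep m]
  have hqlim : Tendsto (fun n => s * q n) atTop atTop := by
    have : Tendsto (fun m : ℕ => s * q (m + N)) atTop atTop := by
      refine tendsto_atTop_mono (f := fun m : ℕ => m * η + s * q N)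
        (fun m => by rw [add_comm m N]; exact hgrow m) ?_
      exact tendsto_atTop_add_const_right _ _
        (tendsto_natCast_atTop_atTop.atTop_mul_const hηpos)
    exact (tendsto_add_atTop_iff_nat (f := fun n => s * q n) N).1 this
  have hinv := (hqlim.inv_tendsto_atTop.const_mul s).const_sub κ
  rw [mul_zero, sub_zero] at hinv
  refine hinv.congr' ?_
  filter_upwards [hqlim.eventually_gt_atTop 0] with n hn
  have hk := hpos n
  have hb : B n ≠ 0 := fun h => by simp [hq, h] at hn
  have hs0 : s ≠ 0 := fun h => by simp [h] at hs
  have : A n = B n * κ - K n := by rw [hK]; ring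
  simp only [Pi.inv_apply, hq]
  rw [this]
  field_simp

section approximation
variable {a b c d e : ℚ}

/-- The solution over `ℚ` of the recurrence with given initial values, as the sequence of pairs
of consecutive terms. -/
def recSol (a b c d e u v : ℚ) : ℕ → ℚ × ℚ
  | 0 => (u, v)
  | n + 1 => ((recSol a b c d e u v n).2,
      -(recCoeff (a + n + 1) (b + n + 1) (c + n + 1) (d + n + 1) (e + n + 1) 0 *
          (recSol a b c d e u v n).1 +
        recCoeff (a + n + 1) (b + n + 1) (c + n + 1) (d + n + 1) (e + n + 1) 1 *
          (recSol a b c d e u v n).2) /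
        recCoeff (a + n + 1) (b + n + 1) (c + n + 1) (d + n + 1) (e + n + 1) 2)

theorem recSol_recurrence {u v : ℚ}
    (h : ∀ n : ℕ, recCoeff (a + n + 1) (b + n + 1) (c + n + 1) (d + n + 1) (e + n + 1) 2 ≠ 0)
    (n : ℕ) : ∑ k : Fin 3,
      recCoeff (a + n + 1) (b + n + 1) (c + n + 1) (d + n + 1) (e + n + 1) k *
        (recSol a b c d e u v (n + k)).1 = 0 := by
  have := h n
  simp only [Fin.sum_univ_three, Fin.val_zero, add_zero, recSol]
  field_simp
  ring

theorem cast_recCoeff (a b c d e : ℚ) (n : ℕ) (k : Fin 3) :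
    ((recCoeff (a + n + 1) (b + n + 1) (c + n + 1) (d + n + 1) (e + n + 1) k : ℚ) : ℝ) =
      recCoeff ((a : ℝ) + n + 1) (b + n + 1) (c + n + 1) (d + n + 1) (e + n + 1) k := by
  have := map_recCoeff (Rat.castHom ℝ) (a + n + 1) (b + n + 1) (c + n + 1) (d + n + 1) (e + n + 1) k
  simpa using this

theorem exists_rat_approx (h : Admissible (b : ℝ) c e a a c d)
    (hn : Nondegenerate (a : ℝ) b c d e) : ∃ A B : ℕ → ℚ,
      (∀ n : ℕ, ∑ k : Fin 3,
        recCoeff (a + n + 1) (b + n + 1) (c + n + 1) (d + n + 1) (e + n + 1) k * A (n + k) = 0) ∧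
      (∀ n : ℕ, ∑ k : Fin 3,
        recCoeff (a + n + 1) (b + n + 1) (c + n + 1) (d + n + 1) (e + n + 1) k * B (n + k) = 0) ∧
      (∀ n : ℕ, KFamily (a : ℝ) b c d e n =
        (B n : ℝ) * KFamily (a : ℝ) b c d e 0 - (A n : ℝ)) ∧
      Tendsto (fun n : ℕ => (A n : ℝ) / (B n : ℝ)) atTop (𝓝 (KFamily (a : ℝ) b c d e 0)) := by
  have hne : ∀ n : ℕ,
      recCoeff (a + n + 1) (b + n + 1) (c + n + 1) (d + n + 1) (e + n + 1) 2 ≠ 0 := fun n h0 => by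
    refine hn.recCoeff_two_ne_zero h n ?_
    rw [← cast_recCoeff, h0, Rat.cast_zero]
  -- the relation `contiguity_fst` reads `K(1) = (w / g) K(0) - ρ / g`, which gives initial values
  set w := kW (a + 1) (b + 1) (c + 1) (d + 1) (e + 1) with hw
  set g := kG (a + 1) (b + 1) (c + 1) (d + 1) (e + 1) with hg
  set ρ := kRho (a + 1) (b + 1) (c + 1) (d + 1) (e + 1) with hρ
  set A : ℕ → ℚ := fun n => (recSol a b c d e 0 (ρ / g) n).1 with hA
  set B : ℕ → ℚ := fun n => (recSol a b c d e 1 (w / g) n).1 with hB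
  have recA := recSol_recurrence (u := 0) (v := ρ / g) hne
  have recB := recSol_recurrence (u := 1) (v := w / g) hne
  have wr : (w : ℝ) = kW ((a : ℝ) + 1) (b + 1) (c + 1) (d + 1) (e + 1) := by
    simp [hw, kW, kSigma]
  have gr : (g : ℝ) = kG ((a : ℝ) + 1) (b + 1) (c + 1) (d + 1) (e + 1) := by
    simp [hg, kG]
  have ρr : (ρ : ℝ) = kRho ((a : ℝ) + 1) (b + 1) (c + 1) (d + 1) (e + 1) := by
    simp [hρ, kRho, kT₀, kT₁]
  have ρpos : 0 < (ρ : ℝ) := by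
    have := h.kRho_pos le_rfl
    simp only [add_zero] at this
    rwa [ρr]
  have gne : (g : ℝ) ≠ 0 := by
    obtain ⟨k1, k2, k3, k4, k5, k6⟩ := hn 0
    simp only [Nat.cast_zero, zero_add] at k1 k2 k3 k4 k5 k6
    obtain ⟨h1, h2, h3, h4, h5, h6, h7, h8⟩ := h
    rw [gr, kG]
    simp only [ne_eq, mul_eq_zero, not_or]
    refine ⟨⟨⟨⟨?_, ?_⟩, ?_⟩, ?_⟩, ?_⟩ <;> intro h0
    · exact k1 (by linarith)
    · linarith
    · exact k4 (by linarith)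
    · exact k6 (by linarith)
    · exact k5 (by linarith)
  have Xpos : 0 < eulerInt (b : ℝ) c e a a c d := by
    rw [← J3_zero]; exact h.J3_pos
  have Kpos : ∀ n, 0 < KFamily (a : ℝ) b c d e n := fun n => by
    rw [KFamily_eq]
    exact div_pos (eulerInt_pos (by
      have := h.eulerDom (Nat.cast_nonneg (α := ℝ) n)
      exact this)) Xpos
  have K0 : KFamily (a : ℝ) b c d e 1 = w / g * KFamily (a : ℝ) b c d e 0 - ρ / g := by
    have := diagInt_fst_rel h 0
    simp only [Nat.cast_zero, add_zero, ← wr, ← gr, ← ρr, zero_add] at this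
    have hX : diagInt (b : ℝ) c e a a c d 0 = eulerInt (b : ℝ) c e a a c d := by simp [diagInt]
    rw [hX] at this
    rw [KFamily_eq, KFamily_eq, Nat.cast_zero]
    field_simp
    linarith
  have castsum : ∀ (n : ℕ) (y : ℕ → ℚ), ∑ k : Fin 3,
        recCoeff (a + n + 1) (b + n + 1) (c + n + 1) (d + n + 1) (e + n + 1) k * y (n + k) = 0 →
      recCoeff ((a : ℝ) + n + 1) (b + n + 1) (c + n + 1) (d + n + 1) (e + n + 1) 0 * (y n : ℝ) +
      recCoeff ((a : ℝ) + n + 1) (b + n + 1) (c + n + 1) (d + n + 1) (e + n + 1) 1 *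
        (y (n + 1) : ℝ) +
      recCoeff ((a : ℝ) + n + 1) (b + n + 1) (c + n + 1) (d + n + 1) (e + n + 1) 2 *
        (y (n + 2) : ℝ) = 0 := fun n y hy => by
    have := congrArg (Rat.cast : ℚ → ℝ) hy
    simp only [Fin.sum_univ_three, Rat.cast_add, Rat.cast_mul, cast_recCoeff, Rat.cast_zero,
      Fin.val_zero, Fin.val_one, Fin.val_two, add_zero] at this
    exact this
  have hlin : ∀ n, KFamily (a : ℝ) b c d e n = (B n : ℝ) * KFamily (a : ℝ) b c d e 0 - (A n : ℝ) ∧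
      KFamily (a : ℝ) b c d e (n + 1) =
        (B (n + 1) : ℝ) * KFamily (a : ℝ) b c d e 0 - (A (n + 1) : ℝ) := fun n => by
    induction n with
    | zero => exact ⟨by simp [hA, hB, recSol], by simp [hA, hB, recSol, K0]⟩
    | succ n ih =>
      refine ⟨ih.2, ?_⟩
      have h1 := KFamily_recurrence h n
      simp only [Fin.sum_univ_three, Fin.val_zero, Fin.val_one, Fin.val_two, add_zero] at h1
      refine mul_left_cancel₀ (hn.recCoeff_two_ne_zero h n) ?_
      rw [show n + 1 + 1 = n + 2 from rfl]
      linear_combination h1 - recCoeff ((a : ℝ) + n + 1) (b + n + 1) (c + n + 1) (d + n + 1)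
          (e + n + 1) 0 * ih.1 - recCoeff ((a : ℝ) + n + 1) (b + n + 1) (c + n + 1) (d + n + 1)
          (e + n + 1) 1 * ih.2 - KFamily (a : ℝ) b c d e 0 * castsum n B (recB n)
          + castsum n A (recA n)
  refine ⟨A, B, recA, recB, fun n => (hlin n).1, ?_⟩
  refine tendsto_div_of_casoratian (K := KFamily (a : ℝ) b c d e)
    (A := fun n => (A n : ℝ)) (B := fun n => (B n : ℝ)) (θ := 1 / 4)
    (C := KFamily (a : ℝ) b c d e 0)
    (fun n => castsum n A (recA n)) (fun n => castsum n B (recB n))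
    (fun n => (recCoeff_zero_pos h n).ne') (hn.recCoeff_two_ne_zero h)
    (tendsto_recCoeff_div _ _ _ _ _) (fun n => (hlin n).1) Kpos (by norm_num) (by norm_num) ?_ ?_
  · intro n
    rw [KFamily_eq, KFamily_eq, Nat.cast_zero, div_mul_eq_mul_div,
      mul_comm (diagInt _ _ _ _ _ _ _ _)]
    gcongr
    exact diagInt_le h n
  · simp only [hA, hB, recSol]
    have : (ρ : ℝ) / g ≠ 0 := div_ne_zero ρpos.ne' gne
    simpa using this

end approximation

/-! ### The third-order recurrence -/

/-- The polynomial `(u + X)(u + 1 + X) ⋯ (u + k - 1 + X)`. -/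
def risingX {R : Type*} [CommRing R] (u : R) (k : ℕ) : R[X] :=
  ∏ i ∈ Finset.range k, (C (u + i) + X)

/-- The product `u (u + 1) ⋯ (u + k - 1)`. -/
def rising {R : Type*} [CommRing R] (u : R) (k : ℕ) : R := ∏ i ∈ Finset.range k, (u + i)

section rising
variable {R S : Type*} [CommRing R] [CommRing S]

theorem map_risingX (f : R →+* S) (u : R) (k : ℕ) : (risingX u k).map f = risingX (f u) k := by
  simp [risingX, Polynomial.map_prod]

theorem map_rising (f : R →+* S) (u : R) (k : ℕ) : f (rising u k) = rising (f u) k := by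
  simp [rising, map_prod]

theorem natDegree_risingX_le (u : R) (k : ℕ) : (risingX u k).natDegree ≤ k := by
  refine (natDegree_prod_le _ _).trans ((Finset.sum_le_card_nsmul _ _ 1 fun i _ => ?_).trans ?_)
  · exact natDegree_add_le_of_degree_le (by simp) natDegree_X_le
  · simp

theorem risingX_succ (u : R) (k : ℕ) : risingX u (k + 1) = (C (u + k) + X) * risingX u k := by
  rw [risingX, Finset.prod_range_succ, mul_comm]; rfl

theorem risingX_succ' (u : R) (k : ℕ) : risingX u (k + 1) = (C u + X) * risingX (u + 1) k := by
  rw [risingX, Finset.prod_range_succ', mul_comm, risingX]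
  simp [add_assoc, add_comm (1 : R[X])]

theorem rising_succ (u : R) (k : ℕ) : rising u (k + 1) = (u + k) * rising u k := by
  rw [rising, Finset.prod_range_succ, mul_comm]; rfl

theorem rising_succ' (u : R) (k : ℕ) : rising u (k + 1) = u * rising (u + 1) k := by
  rw [rising, Finset.prod_range_succ', mul_comm, rising]
  simp [add_assoc, add_comm (1 : R)]

end rising

section shift
variable {a₁ a₂ b₁ b₂ c₁ c₂ e : ℝ}

theorem eulerFun_e_rising (k : ℕ) (q : ℝ[X]) :
    eulerFun a₁ a₂ b₁ b₂ c₁ c₂ e (risingX e k * q) =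
      rising e k * eulerFun a₁ a₂ b₁ b₂ c₁ (c₂ + k) (e + k) q := by
  induction k generalizing c₂ e with
  | zero => simp [risingX, rising]
  | succ k ih =>
    rw [risingX_succ', mul_assoc, eulerFun_e_mul, ih, rising_succ', mul_assoc]
    push_cast
    rw [add_assoc c₂, add_assoc e, add_comm (1 : ℝ)]

theorem eulerFun_c₁_rising (h : EulerDom a₁ a₂ b₁ b₂ c₁ c₂ e) (k : ℕ) (q : ℝ[X]) :
    eulerFun a₁ a₂ b₁ b₂ c₁ c₂ e (risingX (c₁ + 1) k * q) =
      rising (c₁ + c₂ + 2 - e) k * eulerFun a₁ a₂ b₁ b₂ (c₁ + k) c₂ e q := by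
  induction k generalizing c₁ with
  | zero => simp [risingX, rising]
  | succ k ih =>
    have h' : EulerDom a₁ a₂ b₁ b₂ (c₁ + 1) c₂ e := by
      obtain ⟨g1, g2, g3, g4, g5, g6, g7, g8⟩ := h
      exact ⟨g1, g2, g3, g4, by linarith, g6, g7, g8⟩
    rw [risingX_succ', mul_assoc, eulerFun_c₁_mul h, ih h', rising_succ', mul_assoc]
    push_cast
    rw [add_assoc c₁ 1 (k : ℝ), add_comm (1 : ℝ) k,
      show c₁ + 1 + c₂ + 2 - e = c₁ + c₂ + 2 - e + 1 by ring]

theorem eulerFun_a₁_rising (h : EulerDom a₁ a₂ b₁ b₂ c₁ c₂ e) (k : ℕ) (q : ℝ[X]) :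
    eulerFun a₁ (a₂ + k) b₁ b₂ c₁ c₂ e (risingX (a₁ + 1) k * q) =
      rising (a₂ + 1) k * eulerFun (a₁ + k) a₂ b₁ b₂ c₁ c₂ e q := by
  induction k generalizing a₁ with
  | zero => simp [risingX, rising]
  | succ k ih =>
    have hk : (0 : ℝ) ≤ k := k.cast_nonneg
    obtain ⟨g1, g2, g3, g4, g5, g6, g7, g8⟩ := h
    have h₁ : EulerDom a₁ (a₂ + (k + 1)) b₁ b₂ c₁ c₂ e :=
      ⟨g1, by linarith, g3, g4, g5, g6, g7, g8⟩
    have h₂ : EulerDom (a₁ + 1) a₂ b₁ b₂ c₁ c₂ e :=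
      ⟨by linarith, g2, g3, g4, g5, g6, by linarith, g8⟩
    push_cast
    rw [risingX_succ', mul_assoc, eulerFun_a₁_mul h₁ (by linarith),
      show a₂ + (k + 1 : ℝ) - 1 = a₂ + k by ring, ih h₂, rising_succ,
      show a₁ + 1 + (k : ℝ) = a₁ + (k + 1) by ring]
    ring

theorem eulerFun_a₂_rising (h : EulerDom a₁ a₂ b₁ b₂ c₁ c₂ e) (k : ℕ) (q : ℝ[X]) :
    eulerFun a₁ (a₂ + k) b₁ b₂ c₁ c₂ e (risingX (a₁ + a₂ + 2) k * q) =
      rising (a₂ + 1) k * eulerFun a₁ a₂ b₁ b₂ c₁ c₂ e q := by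
  induction k with
  | zero => simp [risingX, rising]
  | succ k ih =>
    have hk : (0 : ℝ) ≤ k := k.cast_nonneg
    obtain ⟨g1, g2, g3, g4, g5, g6, g7, g8⟩ := h
    have h₁ : EulerDom a₁ (a₂ + (k + 1)) b₁ b₂ c₁ c₂ e :=
      ⟨g1, by linarith, g3, g4, g5, g6, g7, g8⟩
    push_cast
    rw [risingX_succ, show a₁ + a₂ + 2 + (k : ℝ) = a₁ + (a₂ + (k + 1)) + 1 by ring, mul_assoc,
      eulerFun_a₂_mul h₁ (by linarith), show a₂ + (k + 1 : ℝ) - 1 = a₂ + k by ring, ih,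
      rising_succ]
    ring

theorem eulerFun_a_rising (h : EulerDom a₁ a₂ b₁ b₂ c₁ c₂ e) (k l : ℕ) (q : ℝ[X]) :
    eulerFun a₁ (a₂ + k + l + k) b₁ b₂ c₁ c₂ e
        (risingX (a₁ + 1) k * (risingX (a₁ + a₂ + 2 + 2 * k) l * q)) =
      rising (a₂ + k + l + 1) k * rising (a₂ + k + 1) l *
        eulerFun (a₁ + k) (a₂ + k) b₁ b₂ c₁ c₂ e q := by
  have hk : (0 : ℝ) ≤ k := k.cast_nonneg
  have hl : (0 : ℝ) ≤ l := l.cast_nonneg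
  obtain ⟨g1, g2, g3, g4, g5, g6, g7, g8⟩ := h
  have h₁ : EulerDom a₁ (a₂ + k + l) b₁ b₂ c₁ c₂ e :=
    ⟨g1, by linarith, g3, g4, g5, g6, g7, g8⟩
  have h₂ : EulerDom (a₁ + k) (a₂ + k) b₁ b₂ c₁ c₂ e :=
    ⟨by linarith, by linarith, g3, g4, g5, g6, by linarith, g8⟩
  rw [eulerFun_a₁_rising h₁, show a₁ + a₂ + 2 + 2 * (k : ℝ) = a₁ + k + (a₂ + k) + 2 by ring,
    eulerFun_a₂_rising h₂, mul_assoc]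

theorem eulerFun_b_rising (h : EulerDom a₁ a₂ b₁ b₂ c₁ c₂ e) (k l : ℕ) (q : ℝ[X]) :
    eulerFun a₁ a₂ b₁ (b₂ + k + l + k) c₁ c₂ e
        (risingX (b₁ + 1) k * (risingX (b₁ + b₂ + 2 + 2 * k) l * q)) =
      rising (b₂ + k + l + 1) k * rising (b₂ + k + 1) l *
        eulerFun a₁ a₂ (b₁ + k) (b₂ + k) c₁ c₂ e q := by
  rw [← eulerFun_swap, eulerFun_a_rising h.swap, eulerFun_swap]

end shift

section generic
variable {R : Type*} [CommRing R]

/-- The polynomial which represents the Euler integral with all parameters raised by `k` as a value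
of the functional with parameters `(a₁, a₂ + 6, b₁, b₂ + 6, c₁, c₂, e)`, if `2k + l = 6`. -/
def shiftPoly (a₁ a₂ b₁ b₂ c₁ e : R) (k l : ℕ) : R[X] :=
  risingX e k * (risingX (c₁ + 1) k * (risingX (a₁ + 1) k * (risingX (a₁ + a₂ + 2 + 2 * k) l *
    (risingX (b₁ + 1) k * risingX (b₁ + b₂ + 2 + 2 * k) l))))

/-- The constant that goes with `shiftPoly`. -/
def shiftConst (a₂ b₂ c₁ c₂ e : R) (k l : ℕ) : R :=
  rising e k * rising (c₁ + c₂ + 2 - e) k * (rising (a₂ + k + l + 1) k * rising (a₂ + k + 1) l) *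
    (rising (b₂ + k + l + 1) k * rising (b₂ + k + 1) l)

/-- The polynomials annihilated by the functional with parameters
`(a₁, a₂ + 6, b₁, b₂ + 6, c₁, c₂, e)`. -/
def exactPoly (a₁ a₂ b₁ b₂ c₁ c₂ e : R) (q : R[X]) : R[X] :=
  (C e + X) * (C (c₁ + 1) + X) * (C (a₁ + 1) + X) * (C (b₁ + 1) + X) * q.comp (X + 1)
    - X * (X - C (c₂ + 1 - e)) * (C (a₁ + (a₂ + 6) + 1) + X) * (C (b₁ + (b₂ + 6) + 1) + X) * q

theorem natDegree_shiftPoly_le (a₁ a₂ b₁ b₂ c₁ e : R) {k l : ℕ} (h : 2 * k + l = 6) :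
    (shiftPoly a₁ a₂ b₁ b₂ c₁ e k l).natDegree ≤ 12 := by
  have : k + (k + (k + (l + (k + l)))) = 12 := by omega
  rw [← this]
  unfold shiftPoly
  refine natDegree_mul_le_of_le (natDegree_risingX_le _ _) ?_
  refine natDegree_mul_le_of_le (natDegree_risingX_le _ _) ?_
  refine natDegree_mul_le_of_le (natDegree_risingX_le _ _) ?_
  refine natDegree_mul_le_of_le (natDegree_risingX_le _ _) ?_
  exact natDegree_mul_le_of_le (natDegree_risingX_le _ _) (natDegree_risingX_le _ _)

theorem monic_C_add_X (r : R) : (C r + X).Monic := by rw [add_comm]; exact monic_X_add_C r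

/-- The leading terms of the two parts of an exact polynomial cancel. -/
theorem natDegree_exactPoly_le [Nontrivial R] (a₁ a₂ b₁ b₂ c₁ c₂ e : R) {j : ℕ} (hj : j ≤ 9) :
    (exactPoly a₁ a₂ b₁ b₂ c₁ c₂ e (X ^ j)).natDegree ≤ 12 := by
  have d : ∀ r : R, (C r + X).natDegree = 1 := fun r => by rw [add_comm]; exact natDegree_X_add_C r
  have m := monic_C_add_X (R := R)
  have m1 : ((X + 1 : R[X]) ^ j).Monic := by
    rw [← C_1]; exact (monic_X_add_C 1).pow j
  have d1 : ((X + 1 : R[X]) ^ j).natDegree = j := by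
    rw [← C_1, (monic_X_add_C (1 : R)).natDegree_pow, natDegree_X_add_C, mul_one]
  have mU := ((((m e).mul (m (c₁ + 1))).mul (m (a₁ + 1))).mul (m (b₁ + 1))).mul m1
  have mV := (((monic_X (R := R).mul (monic_X_sub_C (c₂ + 1 - e))).mul (m (a₁ + (a₂ + 6) + 1))).mul
    (m (b₁ + (b₂ + 6) + 1))).mul (monic_X_pow j)
  have dU : ((C e + X) * (C (c₁ + 1) + X) * (C (a₁ + 1) + X) * (C (b₁ + 1) + X) *
      (X + 1) ^ j).natDegree = 4 + j := by
    rw [(((m e).mul (m (c₁ + 1))).mul (m (a₁ + 1))).mul (m (b₁ + 1)) |>.natDegree_mul m1,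
      (((m e).mul (m (c₁ + 1))).mul (m (a₁ + 1))).natDegree_mul (m (b₁ + 1)),
      ((m e).mul (m (c₁ + 1))).natDegree_mul (m (a₁ + 1)), (m e).natDegree_mul (m (c₁ + 1)),
      d, d, d, d, d1]
  have dV : (X * (X - C (c₂ + 1 - e)) * (C (a₁ + (a₂ + 6) + 1) + X) *
      (C (b₁ + (b₂ + 6) + 1) + X) * X ^ j).natDegree = 4 + j := by
    rw [((monic_X (R := R).mul (monic_X_sub_C (c₂ + 1 - e))).mul (m (a₁ + (a₂ + 6) + 1))).mul
      (m (b₁ + (b₂ + 6) + 1)) |>.natDegree_mul (monic_X_pow j),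
      ((monic_X (R := R).mul (monic_X_sub_C (c₂ + 1 - e))).mul
        (m (a₁ + (a₂ + 6) + 1))).natDegree_mul
      (m (b₁ + (b₂ + 6) + 1)),
      (monic_X (R := R).mul (monic_X_sub_C (c₂ + 1 - e))).natDegree_mul (m (a₁ + (a₂ + 6) + 1)),
      monic_X.natDegree_mul (monic_X_sub_C (c₂ + 1 - e)), d, d, natDegree_X, natDegree_X_sub_C,
      natDegree_X_pow]
  have hcomp : (X ^ j : R[X]).comp (X + 1) = (X + 1) ^ j := by simp
  rw [exactPoly, hcomp]
  have hlt := degree_sub_lt_left (p := (C e + X) * (C (c₁ + 1) + X) * (C (a₁ + 1) + X) *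
      (C (b₁ + 1) + X) * (X + 1) ^ j) (q := X * (X - C (c₂ + 1 - e)) *
      (C (a₁ + (a₂ + 6) + 1) + X) * (C (b₁ + (b₂ + 6) + 1) + X) * X ^ j)
    (by rw [degree_eq_natDegree mU.ne_zero, degree_eq_natDegree mV.ne_zero, dU, dV])
    mU.ne_zero (by rw [mU.leadingCoeff, mV.leadingCoeff])
  rw [degree_eq_natDegree mU.ne_zero, dU] at hlt
  refine natDegree_le_iff_coeff_eq_zero.2 fun N hN => coeff_eq_zero_of_degree_lt ?_
  exact hlt.trans_le (by exact_mod_cast (by omega : 4 + j ≤ N))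

theorem exactPoly_sum {ι : Type*} (s : Finset ι) (a₁ a₂ b₁ b₂ c₁ c₂ e : R) (v : ι → R)
    (q : ι → R[X]) : exactPoly a₁ a₂ b₁ b₂ c₁ c₂ e (∑ i ∈ s, C (v i) * q i) =
      ∑ i ∈ s, C (v i) * exactPoly a₁ a₂ b₁ b₂ c₁ c₂ e (q i) := by
  have hcomp : (∑ i ∈ s, C (v i) * q i).comp (X + 1) = ∑ i ∈ s, C (v i) * (q i).comp (X + 1) := by
    simp [sum_comp]
  simp only [exactPoly, hcomp, Finset.mul_sum, ← Finset.sum_sub_distrib]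
  exact Finset.sum_congr rfl fun i _ => by
    generalize (q i).comp (X + 1) = r
    ring

section map
variable {S : Type*} [CommRing S] (f : R →+* S)

theorem map_shiftPoly (a₁ a₂ b₁ b₂ c₁ e : R) (k l : ℕ) :
    (shiftPoly a₁ a₂ b₁ b₂ c₁ e k l).map f =
      shiftPoly (f a₁) (f a₂) (f b₁) (f b₂) (f c₁) (f e) k l := by
  simp [shiftPoly, map_risingX, map_ofNat]

theorem map_shiftConst (a₂ b₂ c₁ c₂ e : R) (k l : ℕ) :
    f (shiftConst a₂ b₂ c₁ c₂ e k l) = shiftConst (f a₂) (f b₂) (f c₁) (f c₂) (f e) k l := by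
  simp [shiftConst, map_rising, map_ofNat]

theorem map_exactPoly (a₁ a₂ b₁ b₂ c₁ c₂ e : R) (q : R[X]) :
    (exactPoly a₁ a₂ b₁ b₂ c₁ c₂ e q).map f =
      exactPoly (f a₁) (f a₂) (f b₁) (f b₂) (f c₁) (f c₂) (f e) (q.map f) := by
  simp [exactPoly, Polynomial.map_comp, map_ofNat]

end map

/-- Exactness detects zero: if `exact(q) = 0`, then `q` vanishes at `1, 2, 3, …`. -/
theorem eq_zero_of_exactPoly_eq_zero [IsDomain R] [CharZero R] {a₁ a₂ b₁ b₂ c₁ c₂ e : R}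
    (he : ∀ m : ℕ, e + m ≠ 0) (hc : ∀ m : ℕ, c₁ + 1 + m ≠ 0) (ha : ∀ m : ℕ, a₁ + 1 + m ≠ 0)
    (hb : ∀ m : ℕ, b₁ + 1 + m ≠ 0) {q : R[X]} (h : exactPoly a₁ a₂ b₁ b₂ c₁ c₂ e q = 0) :
    q = 0 := by
  have hev : ∀ m : ℕ, (e + m) * (c₁ + 1 + m) * (a₁ + 1 + m) * (b₁ + 1 + m) *
      q.eval (m + 1 : R) = m * (m - (c₂ + 1 - e)) * (a₁ + (a₂ + 6) + 1 + m) *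
        (b₁ + (b₂ + 6) + 1 + m) * q.eval (m : R) := fun m => by
    have := congrArg (eval (m : R)) h
    simp only [exactPoly, eval_sub, eval_mul, eval_add, eval_C, eval_X, eval_comp, eval_one,
      eval_zero] at this
    exact sub_eq_zero.1 this
  have hroot : ∀ m : ℕ, q.eval ((m + 1 : ℕ) : R) = 0 := fun m => by
    have hU := fun m => mul_ne_zero (mul_ne_zero (mul_ne_zero (he m) (hc m)) (ha m)) (hb m)
    refine (mul_eq_zero.1 ?_).resolve_left (hU m)
    rw [Nat.cast_succ, hev]
    induction m with
    | zero => simp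
    | succ m ih =>
      rw [← hev] at ih
      replace ih := (mul_eq_zero.1 ih).resolve_left (hU m)
      rw [Nat.cast_succ, ih, mul_zero]
  refine eq_zero_of_infinite_isRoot q (Set.Infinite.mono
    (s := Set.range fun m : ℕ => ((m + 1 : ℕ) : R)) ?_
    (Set.infinite_range_of_injective fun a b hab => ?_))
  · rintro _ ⟨m, rfl⟩; exact hroot m
  · simpa using hab

end generic

section shift
variable {a₁ a₂ b₁ b₂ c₁ c₂ e : ℝ}

theorem eulerFun_shiftPoly (h : EulerDom a₁ a₂ b₁ b₂ c₁ c₂ e) {k l : ℕ} (hkl : 2 * k + l = 6) :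
    eulerFun a₁ (a₂ + 6) b₁ (b₂ + 6) c₁ c₂ e (shiftPoly a₁ a₂ b₁ b₂ c₁ e k l) =
      shiftConst a₂ b₂ c₁ c₂ e k l *
        eulerInt (a₁ + k) (a₂ + k) (b₁ + k) (b₂ + k) (c₁ + k) (c₂ + k) (e + k) := by
  have hk : (0 : ℝ) ≤ k := k.cast_nonneg
  have hl : (0 : ℝ) ≤ l := l.cast_nonneg
  have h6 : ∀ u : ℝ, u + 6 = u + k + l + k := fun u => by
    have : ((2 * k + l : ℕ) : ℝ) = 6 := by rw [hkl]; norm_num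
    push_cast at this
    linarith
  obtain ⟨g1, g2, g3, g4, g5, g6, g7, g8⟩ := h
  have h₁ : EulerDom a₁ (a₂ + 6) b₁ (b₂ + 6) c₁ (c₂ + k) (e + k) :=
    ⟨g1, by linarith, g3, by linarith, g5, by linarith, by linarith, by linarith⟩
  have h₂ : EulerDom a₁ a₂ b₁ (b₂ + 6) (c₁ + k) (c₂ + k) (e + k) :=
    ⟨g1, by linarith, g3, by linarith, by linarith, by linarith, by linarith, by linarith⟩
  have h₃ : EulerDom (a₁ + k) (a₂ + k) b₁ b₂ (c₁ + k) (c₂ + k) (e + k) :=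
    ⟨by linarith, by linarith, g3, by linarith, by linarith, by linarith, by linarith, by linarith⟩
  rw [shiftPoly, eulerFun_e_rising, eulerFun_c₁_rising h₁, h6 a₂, eulerFun_a_rising h₂, h6 b₂,
    ← mul_one (risingX (b₁ + b₂ + 2 + 2 * (k : ℝ)) l), eulerFun_b_rising h₃, eulerFun_one,
    shiftConst, show c₁ + (c₂ + k) + 2 - (e + k) = c₁ + c₂ + 2 - e by ring]
  ring

theorem eulerFun_exactPoly (h : EulerDom a₁ a₂ b₁ b₂ c₁ c₂ e) (q : ℝ[X]) :
    eulerFun a₁ (a₂ + 6) b₁ (b₂ + 6) c₁ c₂ e (exactPoly a₁ a₂ b₁ b₂ c₁ c₂ e q) = 0 := by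
  obtain ⟨g1, g2, g3, g4, g5, g6, g7, g8⟩ := h
  exact eulerFun_exact ⟨g1, by linarith, g3, by linarith, g5, g6, g7, g8⟩ (by linarith)
    (by linarith) q

end shift

/-- Fourteen polynomials of degree at most `12` over a domain are linearly dependent. -/
theorem exists_relation_of_natDegree_le {R : Type*} [CommRing R] [IsDomain R]
    (p : Fin 4 ⊕ Fin 10 → R[X]) (hp : ∀ i, (p i).natDegree ≤ 12) :
    ∃ v : Fin 4 ⊕ Fin 10 → R, v ≠ 0 ∧ ∑ i, C (v i) * p i = 0 := by
  set M : Matrix (Fin 4 ⊕ Fin 10) (Fin 4 ⊕ Fin 10) R := fun i j => (p j).coeff (finSumFinEquiv i)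
    with hM
  have hdet : M.det = 0 := by
    refine Matrix.det_eq_zero_of_row_eq_zero (Sum.inr 9) fun j => ?_
    rw [hM]
    refine coeff_eq_zero_of_natDegree_lt ((hp j).trans_lt ?_)
    decide
  obtain ⟨v, hv, h⟩ := Matrix.exists_mulVec_eq_zero_iff.2 hdet
  refine ⟨v, hv, ?_⟩
  ext m
  rw [finsetSum_coeff, coeff_zero]
  simp only [coeff_C_mul]
  rcases lt_or_ge m 14 with hm | hm
  · have := congrFun h (finSumFinEquiv.symm (⟨m, hm⟩ : Fin (4 + 10)))
    simp only [Matrix.mulVec, dotProduct, hM, Equiv.apply_symm_apply, Pi.zero_apply] at this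
    rw [← this]
    exact Finset.sum_congr rfl fun i _ => mul_comm _ _
  · refine Finset.sum_eq_zero fun i _ => ?_
    rw [coeff_eq_zero_of_natDegree_lt ((hp i).trans_lt (by omega)), mul_zero]

/-- A nontrivial relation of third order: four shifts and ten exact polynomials live in the
polynomials of degree at most `12`, a space of dimension `13`. The coefficients of the shifts do not
all vanish, because exactness detects zero. -/
theorem exists_third_order_relation :
    ∃ R : Fin 4 → MvPolynomial (Fin 8) ℤ, (∃ k, R k ≠ 0) ∧
      ∀ a₁ a₂ b₁ b₂ c₁ c₂ e : ℝ, Admissible a₁ a₂ b₁ b₂ c₁ c₂ e → ∀ n : ℕ,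
        ∑ k : Fin 4, MvPolynomial.aeval ![a₁, a₂, b₁, b₂, c₁, c₂, e, (n : ℝ)] (R k) *
          I3 a₁ a₂ b₁ b₂ c₁ c₂ e (n + k) = 0 := by
  set x : Fin 7 → MvPolynomial (Fin 8) ℤ := fun i => MvPolynomial.X i.castSucc + MvPolynomial.X 7
    with hx
  have hcc : ∀ i, MvPolynomial.constantCoeff (x i) = 0 := fun i => by simp [hx]
  set l : Fin 4 → ℕ := fun k => 6 - 2 * (k : ℕ) with hl
  have hkl : ∀ k : Fin 4, 2 * (k : ℕ) + l k = 6 := fun k => by simp only [hl]; omega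
  have hne : ∀ (i : Fin 7) (m : ℕ), x i + 1 + (m : MvPolynomial (Fin 8) ℤ) ≠ 0 := fun i m h0 => by
    have := congrArg MvPolynomial.constantCoeff h0
    simp [hcc] at this
    omega
  set p : Fin 4 ⊕ Fin 10 → (MvPolynomial (Fin 8) ℤ)[X] := Sum.elim
    (fun k => shiftPoly (x 0) (x 1) (x 2) (x 3) (x 4) (x 6 + 1) k (l k))
    (fun j => exactPoly (x 0) (x 1) (x 2) (x 3) (x 4) (x 5) (x 6 + 1) (X ^ (j : ℕ))) with hp
  obtain ⟨v, hv, hrel⟩ := exists_relation_of_natDegree_le p fun i => by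
    rcases i with k | j
    · exact natDegree_shiftPoly_le _ _ _ _ _ _ (hkl k)
    · exact natDegree_exactPoly_le _ _ _ _ _ _ _ (by omega)
  set Q : (MvPolynomial (Fin 8) ℤ)[X] := ∑ j : Fin 10, C (v (Sum.inr j)) * X ^ (j : ℕ) with hQ
  have hrel' : ∑ k : Fin 4, C (v (Sum.inl k)) *
        shiftPoly (x 0) (x 1) (x 2) (x 3) (x 4) (x 6 + 1) k (l k)
      + exactPoly (x 0) (x 1) (x 2) (x 3) (x 4) (x 5) (x 6 + 1) Q = 0 := by
    rw [hQ, exactPoly_sum, ← hrel, Fintype.sum_sum_type]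
    rfl
  refine ⟨fun k => v (Sum.inl k) * shiftConst (x 1) (x 3) (x 4) (x 5) (x 6 + 1) k (l k), ?_, ?_⟩
  · by_contra! h0
    have hconst : ∀ k : Fin 4, shiftConst (x 1) (x 3) (x 4) (x 5) (x 6 + 1) k (l k) ≠ 0 :=
      fun k hk => by
        have := congrArg MvPolynomial.constantCoeff hk
        rw [map_shiftConst] at this
        simp only [hcc, map_add, map_one, map_zero] at this
        revert this
        fin_cases k <;> simp [hl, shiftConst, rising, Finset.prod_range_succ]
    have hl0 : ∀ k, v (Sum.inl k) = 0 := fun k =>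
      (mul_eq_zero.1 (h0 k)).resolve_right (hconst k)
    simp only [hl0, map_zero, zero_mul, Finset.sum_const_zero, zero_add] at hrel'
    have hQ0 := eq_zero_of_exactPoly_eq_zero (hne 6)
      (hne 4) (hne 0) (hne 2) hrel'
    refine hv (funext fun i => ?_)
    rcases i with k | j
    · exact hl0 k
    · have := congrArg (fun q => coeff q (j : ℕ)) hQ0
      simpa [hQ, finsetSum_coeff, coeff_X_pow, Fin.val_inj] using this
  · intro a₁ a₂ b₁ b₂ c₁ c₂ e h n
    set φ : MvPolynomial (Fin 8) ℤ →+* ℝ := (MvPolynomial.aeval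
      ![a₁, a₂, b₁, b₂, c₁, c₂, e, (n : ℝ)] : MvPolynomial (Fin 8) ℤ →ₐ[ℤ] ℝ).toRingHom with hφ
    have hφx : φ (x 0) = a₁ + n ∧ φ (x 1) = a₂ + n ∧ φ (x 2) = b₁ + n ∧ φ (x 3) = b₂ + n ∧
        φ (x 4) = c₁ + n ∧ φ (x 5) = c₂ + n ∧ φ (x 6) = e + n := by
      simp [hφ, hx]
    obtain ⟨e0, e1, e2, e3, e4, e5, e6⟩ := hφx
    have hdom : EulerDom (a₁ + n) (a₂ + n) (b₁ + n) (b₂ + n) (c₁ + n) (c₂ + n) (e + n + 1) := by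
      have := h.eulerDom (Nat.cast_nonneg (α := ℝ) n)
      rwa [add_right_comm] at this
    have hmap := congrArg (Polynomial.map φ) hrel'
    simp only [Polynomial.map_add, Polynomial.map_sum, Polynomial.map_mul, Polynomial.map_C,
      map_shiftPoly, map_exactPoly, Polynomial.map_zero, e0, e1, e2, e3, e4, e5, e6, map_add,
      map_one] at hmap
    have hM := congrArg (eulerLin (a₁ + n) (a₂ + n + 6) (b₁ + n) (b₂ + n + 6) (c₁ + n) (c₂ + n)
      (e + n + 1)) hmap
    rw [LinearMap.map_add, ← eulerFun_eq_eulerLin _ _ _ _ _ _ _ (exactPoly _ _ _ _ _ _ _ _),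
      eulerFun_exactPoly hdom, add_zero, map_sum, LinearMap.map_zero] at hM
    simp only [← smul_eq_C_mul, LinearMap.map_smul, smul_eq_mul, ← eulerFun_eq_eulerLin,
      eulerFun_shiftPoly hdom (hkl _)] at hM
    simp only [I3, J3_eq_eulerInt, mul_div_assoc', ← Finset.sum_div]
    rw [div_eq_zero_iff]; left
    rw [← hM]
    refine Finset.sum_congr rfl fun k _ => ?_
    change φ _ * _ = _
    rw [map_mul, map_shiftConst, map_add φ (x 6), map_one, e1, e3, e4, e5, e6]
    push_cast
    simp only [← add_assoc, add_right_comm e 1 (n : ℝ)]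
    ring

theorem mvPolynomial_eval_aeval {σ τ R : Type*} [CommRing R] (g : σ → MvPolynomial τ R) (x : τ → R)
    (p : MvPolynomial σ R) : MvPolynomial.eval x (MvPolynomial.aeval g p) =
      MvPolynomial.eval (fun i => MvPolynomial.eval x (g i)) p := by
  induction p using MvPolynomial.induction_on with
  | C a => simp
  | add p q hp hq => rw [map_add, map_add, hp, hq, map_add]
  | mul_X p i hp =>
    rw [map_mul, map_mul, hp, map_mul, MvPolynomial.aeval_X, MvPolynomial.eval_X]

/-- If there is no second-order relation, the outer coefficients of a third-order relation do not
vanish: a relation without the first term is, after a shift of `n`, one of second order; the factor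
`n` makes up for the missing index `n - 1 = -1`. -/
theorem exists_third_order_recurrence
    (hno : ∀ S : Fin 3 → MvPolynomial (Fin 8) ℝ,
      (∀ a₁ a₂ b₁ b₂ c₁ c₂ e : ℝ, Admissible a₁ a₂ b₁ b₂ c₁ c₂ e → ∀ n : ℕ,
        ∑ k : Fin 3, MvPolynomial.eval ![a₁, a₂, b₁, b₂, c₁, c₂, e, (n : ℝ)] (S k) *
          I3 a₁ a₂ b₁ b₂ c₁ c₂ e (n + k) = 0) → ∀ k, S k = 0) :
    ∃ R : Fin 4 → MvPolynomial (Fin 8) ℤ, R 0 ≠ 0 ∧ R 3 ≠ 0 ∧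
      ∀ a₁ a₂ b₁ b₂ c₁ c₂ e : ℝ, Admissible a₁ a₂ b₁ b₂ c₁ c₂ e → ∀ n : ℕ,
        ∑ k : Fin 4, MvPolynomial.aeval ![a₁, a₂, b₁, b₂, c₁, c₂, e, (n : ℝ)] (R k) *
          I3 a₁ a₂ b₁ b₂ c₁ c₂ e (n + k) = 0 := by
  obtain ⟨R, ⟨k₀, hk₀⟩, hR⟩ := exists_third_order_relation
  set T : Fin 4 → MvPolynomial (Fin 8) ℝ := fun k => MvPolynomial.map (Int.castRingHom ℝ) (R k)
    with hT
  have hTeval : ∀ x k, MvPolynomial.aeval x (R k) = MvPolynomial.eval x (T k) := fun x k => by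
    rw [hT, MvPolynomial.eval_map, MvPolynomial.aeval_def]; rfl
  have hT0 : ∀ k, T k = 0 → R k = 0 := fun k h =>
    MvPolynomial.map_injective _ (RingHom.injective_int _) (by rw [map_zero]; exact h)
  simp only [hTeval] at hR
  refine ⟨R, fun h0 => hk₀ ?_, fun h3 => hk₀ ?_, by simpa only [hTeval] using hR⟩
  · set g : Fin 8 → MvPolynomial (Fin 8) ℝ := fun i => MvPolynomial.X i -
      MvPolynomial.C (if i = 7 then 1 else 0) with hg
    have hsub : ∀ x p, MvPolynomial.eval x (MvPolynomial.aeval g p) =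
        MvPolynomial.eval (fun i => x i - if i = 7 then 1 else 0) p := fun x p => by
      rw [mvPolynomial_eval_aeval]
      simp [hg]
    have hS := hno (fun k => MvPolynomial.X 7 * MvPolynomial.aeval g (T k.succ)) ?_
    · have hsucc : ∀ k : Fin 3, R k.succ = 0 := fun k => by
        refine hT0 _ (MvPolynomial.funext fun x => ?_)
        have h1 := (mul_eq_zero.1 (hS k)).resolve_left (MvPolynomial.X_ne_zero _)
        have h2 := hsub (fun i => x i + if i = 7 then 1 else 0) (T k.succ)
        rw [h1] at h2
        simpa using h2.symm
      exact Fin.cases h0 hsucc k₀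
    · intro a₁ a₂ b₁ b₂ c₁ c₂ e h n
      simp only [MvPolynomial.eval_mul, MvPolynomial.eval_X, hsub]
      cases n with
      | zero => simp
      | succ m =>
        have h1 := hR a₁ a₂ b₁ b₂ c₁ c₂ e h m
        rw [Fin.sum_univ_succ] at h1
        have h00 : T 0 = 0 := by simp [hT, h0]
        rw [h00, map_zero, zero_mul, zero_add] at h1
        have hx : (fun i => ![a₁, a₂, b₁, b₂, c₁, c₂, e, ((m + 1 : ℕ) : ℝ)] i -
            if i = 7 then 1 else 0) = ![a₁, a₂, b₁, b₂, c₁, c₂, e, (m : ℝ)] := by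
          funext i
          fin_cases i <;> simp
        rw [hx]
        simp only [mul_assoc]
        rw [← Finset.mul_sum, mul_eq_zero]
        right
        rw [← h1]
        refine Finset.sum_congr rfl fun k _ => ?_
        rw [Fin.val_succ, add_right_comm, add_assoc m]
  · have hS := hno (fun k => T k.castSucc) fun a₁ a₂ b₁ b₂ c₁ c₂ e h n => by
      have h1 := hR a₁ a₂ b₁ b₂ c₁ c₂ e h n
      rw [Fin.sum_univ_castSucc] at h1
      have h33 : T (Fin.last 3) = 0 := by
        have : R (Fin.last 3) = 0 := h3
        simp only [hT, this, map_zero]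
      rw [h33, map_zero, zero_mul, add_zero] at h1
      exact h1
    exact Fin.lastCases h3 (fun k => hT0 _ (hS k)) k₀

/-! ### The trigamma function and rational functions -/

/-- The boundary value at `x = 1` of the Euler integral. -/
def eulerBdry (b₁ b₂ c₁ c₂ e : ℝ) : ℝ :=
  ∫ q in Set.Ioo (0 : ℝ) 1 ×ˢ Set.Ioo (0 : ℝ) 1,
    q.1 ^ b₁ * (1 - q.1) ^ b₂ * (q.2 ^ c₁ * (1 - q.2) ^ c₂) * den 1 q.1 q.2 ^ (-e)

/-- Integration by parts in `x` when the exponent of `1 - x` vanishes. -/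
theorem eulerInt_parts_fst_zero {a₁ b₁ b₂ c₁ c₂ e : ℝ} (h : EulerDom a₁ 0 b₁ b₂ c₁ c₂ e) :
    (a₁ + 1) * eulerInt a₁ 0 b₁ b₂ c₁ c₂ e
      - e * eulerInt (a₁ + 1) 0 (b₁ + 1) b₂ (c₁ + 1) c₂ (e + 1) = eulerBdry b₁ b₂ c₁ c₂ e := by
  obtain ⟨h1, h2, h3, h4, h5, h6, h7, h8⟩ := h
  have i1 := integrableOn_eulerWeight (a₁ := a₁) (a₂ := 0) (b₁ := b₁) (b₂ := b₂) (c₁ := c₁)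
    (c₂ := c₂) (e := e) ⟨h1, h2, h3, h4, h5, h6, h7, h8⟩
  have i2 := integrableOn_eulerWeight (a₁ := a₁ + 1) (a₂ := 0) (b₁ := b₁ + 1) (b₂ := b₂)
    (c₁ := c₁ + 1) (c₂ := c₂) (e := e + 1)
    ⟨by linarith, h2, by linarith, h4, by linarith, h6, by linarith, by linarith⟩
  have key := integral_unitCube_of_hasDerivAt_fst (B := fun q =>
    q.1 ^ b₁ * (1 - q.1) ^ b₂ * (q.2 ^ c₁ * (1 - q.2) ^ c₂) * den 1 q.1 q.2 ^ (-e))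
    ((i1.const_mul (a₁ + 1)).sub (i2.const_mul e)) ?_
  · rwa [integral_sub' (i1.const_mul (a₁ + 1)) (i2.const_mul e), integral_const_mul,
      integral_const_mul] at key
  · intro y hy z hz
    set k := y ^ b₁ * (1 - y) ^ b₂ * (z ^ c₁ * (1 - z) ^ c₂) with hk
    have hD1 : 0 < den 1 y z := by
      have := mul_pos hy.1 hz.1; have := hz.2; unfold den; linarith
    have hD0 : 0 < den 0 y z := by have := hz.2; unfold den; linarith
    refine ⟨fun x => k * (x ^ (a₁ + 1) * (1 - x) ^ (0 : ℝ) * den x y z ^ (-e)), ?_, ?_, ?_⟩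
    · intro x hx
      convert! ((hasDerivAt_rpow_mul_one_sub_rpow (a := a₁) (b := 0) hx).mul
        (hasDerivAt_den_rpow_fst (e := e) (den_pos hx hy hz))).const_mul k using 1
      simp only [eulerWeight, Pi.sub_apply]
      rw [Real.rpow_add_one hy.1.ne', Real.rpow_add_one hz.1.ne', hk]
      ring
    · have := ((tendsto_zero_left (b := 0) h1).mul
        ((continuousAt_den_rpow_fst (e := e) hD0).tendsto.mono_left nhdsWithin_le_nhds)).const_mul k
      simpa using this
    · have := ((tendsto_one_right (a := a₁)).mul
        ((continuousAt_den_rpow_fst (e := e) hD1).tendsto.mono_left nhdsWithin_le_nhds)).const_mul k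
      simpa using this

/-- The functional on polynomials given by the boundary values at `x = 1`. -/
def bdryFun (b : ℝ) (q : ℝ[X]) : ℝ :=
  aeval (thetaOp 1) q (fun j => (∏ i ∈ Finset.range j, (1 + (i : ℝ))) * eulerBdry b 0 0 j (1 + j)) 0

/-- The boundary values of `bdryFun`, see `bdryFun_mul`. -/
def cornerFun (q : ℝ[X]) : ℝ := bdryFun 0 ((C (0 + 1) + X) * q)

/-- The boundary value `∫∫ y ^ b / (1 - z + yz)`, which is the trigamma function at `b + 1`. -/
def psi (b : ℝ) : ℝ := bdryFun b 1

theorem eulerDom_base {a b : ℝ} (ha : -1 < a) (hb : -1 < b) : EulerDom a 0 b 0 0 0 1 :=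
  ⟨ha, by norm_num, hb, by norm_num, by norm_num, by norm_num, by linarith, by linarith⟩

theorem eulerFun_fst_mul {a b : ℝ} (ha : -1 < a) (hb : -1 < b) (q : ℝ[X]) :
    eulerFun a 0 b 0 0 0 1 ((C (a + 1) + X) * q) = bdryFun b q := by
  have : aeval (thetaOp 1) (C (a + 1) + X) (eulerSeq a 0 b 0 0 0 1) =
      fun j : ℕ => (∏ i ∈ Finset.range j, (1 + (i : ℝ))) * eulerBdry b 0 0 j (1 + j) := by
    funext j
    have hd := (eulerDom_base ha hb).add_nat j
    rw [aeval_thetaOp_C_add_X, eulerSeq_succ]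
    have h1 := eulerInt_parts_fst_zero hd
    have h2 := eulerInt_split_den hd
    simp only [zero_add] at h1 h2
    simp only [eulerSeq, zero_add]
    linear_combination (∏ i ∈ Finset.range j, (1 + (i : ℝ))) * (h1 - (1 + (j : ℝ)) * h2)
  rw [eulerFun, mul_comm, map_mul, Module.End.mul_apply, this, bdryFun]

theorem eulerFun_snd_mul {a b : ℝ} (ha : -1 < a) (hb : -1 < b) (q : ℝ[X]) :
    eulerFun a 0 b 0 0 0 1 ((C (b + 1) + X) * q) = bdryFun a q := by
  rw [← eulerFun_swap, eulerFun_fst_mul hb ha]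

/-- The boundary values of the boundary values do not depend on the parameter, because the
derivatives in `x` and in `y` commute. -/
theorem bdryFun_mul {b : ℝ} (hb : -1 < b) (q : ℝ[X]) :
    bdryFun b ((C (b + 1) + X) * q) = cornerFun q := by
  rw [cornerFun, ← eulerFun_fst_mul (a := 0) (by norm_num) hb, mul_left_comm,
    eulerFun_snd_mul (by norm_num) hb]

theorem bdryFun_add (b : ℝ) (p q : ℝ[X]) : bdryFun b (p + q) = bdryFun b p + bdryFun b q := by
  simp [bdryFun]

theorem bdryFun_C_mul (b r : ℝ) (q : ℝ[X]) : bdryFun b (C r * q) = r * bdryFun b q := by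
  simp [bdryFun]

theorem cornerFun_add (p q : ℝ[X]) : cornerFun (p + q) = cornerFun p + cornerFun q := by
  rw [cornerFun, mul_add, bdryFun_add]; rfl

theorem cornerFun_C_mul (r : ℝ) (q : ℝ[X]) : cornerFun (C r * q) = r * cornerFun q := by
  rw [cornerFun, mul_left_comm, bdryFun_C_mul]; rfl

theorem cornerFun_one_pos : 0 < cornerFun 1 := by
  have h0 : (-1 : ℝ) < 0 := by norm_num
  have hd : EulerDom 0 0 0 0 0 (0 + 1) (1 + 1) := by
    refine ⟨?_, ?_, ?_, ?_, ?_, ?_, ?_, ?_⟩ <;> norm_num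
  have h1 : cornerFun 1 = eulerFun 0 0 0 0 0 0 1 ((C 1 + X) * ((C (0 + 1) + X) * 1)) := by
    have := eulerFun_fst_mul h0 h0 ((C (0 + 1) + X) * 1)
    rw [cornerFun, ← this, zero_add]
  rw [h1, eulerFun_e_mul, eulerFun_c₁_mul hd, eulerFun_one]
  have : 0 < eulerInt 0 0 0 0 (0 + 1) (0 + 1) (1 + 1) := by
    refine eulerInt_pos ⟨?_, ?_, ?_, ?_, ?_, ?_, ?_, ?_⟩ <;> norm_num
  linarith

/-- The difference equation of the trigamma function, up to the value of the constant. It comes from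
the shift by one in `x`, `y` and `z`, which acts by `q(X) ↦ q(X + 1)`. -/
theorem psi_sub_psi {b : ℝ} (hb : -1 < b) :
    (b + 1) ^ 2 * (psi b - psi (b + 1)) = cornerFun 1 := by
  have h0 : (-1 : ℝ) < 0 := by norm_num
  have hb' : -1 < b + 1 := by linarith
  have hd := eulerDom_base h0 hb
  have hd1 : EulerDom (0 + 1) 0 (b + 1) 0 0 (0 + 1) (1 + 1) :=
    ⟨by linarith, h0, hb', h0, h0, by linarith, by linarith, by linarith⟩
  -- two expressions for the same value of the functional
  have k1 : bdryFun b (X * X) = bdryFun (b + 1) ((C 1 + X) * (C 1 + X)) := by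
    rw [← eulerFun_fst_mul h0 hb, ← eulerFun_fst_mul (a := 0 + 1) (by norm_num) hb',
      show (C (0 + 1 + 1) + X : ℝ[X]) * ((C 1 + X) * (C 1 + X)) =
        (C 1 + X) * ((C (0 + 1) + X) * (C (0 + 1 + 1) + X)) by rw [zero_add]; ring,
      eulerFun_e_mul, eulerFun_c₁_mul hd1]
    have := eulerFun_X_mul_c₂ hd (C (0 + 1) + X)
    rw [show X * (X - C (0 + 1 - 1)) * (C (0 + 1) + X : ℝ[X]) =
      (C (0 + 1) + X) * (X * X) by simp; ring] at this
    rw [this, show (C (0 + 1) + X : ℝ[X]).comp (X + 1) = C (0 + 1 + 1) + X by simp; ring]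
    norm_num
  have k2 : bdryFun b (X * X) = (b + 1) ^ 2 * psi b + (cornerFun X - (b + 1) * cornerFun 1) := by
    rw [show (X * X : ℝ[X]) = C ((b + 1) ^ 2) * 1 + (C (b + 1) + X) * (X + C (-(b + 1)) * 1) by
      simp only [C_neg, C_pow]; ring, bdryFun_add, bdryFun_C_mul, bdryFun_mul hb, cornerFun_add,
      cornerFun_C_mul, psi]
    ring
  have k3 : bdryFun (b + 1) ((C 1 + X) * (C 1 + X)) =
      (b + 1) ^ 2 * psi (b + 1) + (cornerFun X - b * cornerFun 1) := by
    rw [show ((C 1 + X) * (C 1 + X) : ℝ[X]) =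
      C ((b + 1) ^ 2) * 1 + (C (b + 1 + 1) + X) * (X + C (-b) * 1) by
      simp only [C_neg, C_pow, C_add, C_1]; ring, bdryFun_add, bdryFun_C_mul,
      bdryFun_mul hb', cornerFun_add, cornerFun_C_mul, psi]
    ring
  rw [k1, k3] at k2
  linarith

/-- A function which agrees with a rational function away from the zeros of a denominator. -/
def IsRat (f : ℝ → ℝ) : Prop :=
  ∃ p q : ℝ[X], q ≠ 0 ∧ ∀ x, q.eval x ≠ 0 → f x = p.eval x / q.eval x

namespace IsRat

theorem const (c : ℝ) : IsRat fun _ => c := ⟨C c, 1, one_ne_zero, by simp⟩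

theorem id : IsRat fun x => x := ⟨X, 1, one_ne_zero, by simp⟩

variable {f g : ℝ → ℝ}

theorem add (hf : IsRat f) (hg : IsRat g) : IsRat fun x => f x + g x := by
  obtain ⟨p₁, q₁, h₁, e₁⟩ := hf
  obtain ⟨p₂, q₂, h₂, e₂⟩ := hg
  refine ⟨p₁ * q₂ + q₁ * p₂, q₁ * q₂, mul_ne_zero h₁ h₂, fun x hx => ?_⟩
  rw [eval_mul] at hx
  have k₁ := left_ne_zero_of_mul hx
  have k₂ := right_ne_zero_of_mul hx
  beta_reduce
  rw [e₁ x k₁, e₂ x k₂, div_add_div _ _ k₁ k₂]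
  simp

theorem mul (hf : IsRat f) (hg : IsRat g) : IsRat fun x => f x * g x := by
  obtain ⟨p₁, q₁, h₁, e₁⟩ := hf
  obtain ⟨p₂, q₂, h₂, e₂⟩ := hg
  refine ⟨p₁ * p₂, q₁ * q₂, mul_ne_zero h₁ h₂, fun x hx => ?_⟩
  rw [eval_mul] at hx
  beta_reduce
  rw [e₁ x (left_ne_zero_of_mul hx), e₂ x (right_ne_zero_of_mul hx), div_mul_div_comm]
  simp

theorem inv (hf : IsRat f) : IsRat fun x => (f x)⁻¹ := by
  obtain ⟨p, q, h, e⟩ := hf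
  by_cases hp : p = 0
  · exact ⟨0, q, h, fun x hx => by simp [e x hx, hp]⟩
  · refine ⟨q * q, p * q, mul_ne_zero hp h, fun x hx => ?_⟩
    rw [eval_mul] at hx
    have k₁ := left_ne_zero_of_mul hx
    have k₂ := right_ne_zero_of_mul hx
    beta_reduce
    rw [e x k₂, eval_mul, eval_mul]
    field_simp

theorem neg (hf : IsRat f) : IsRat fun x => -f x := by
  simpa using (const (-1)).mul hf

theorem sub (hf : IsRat f) (hg : IsRat g) : IsRat fun x => f x - g x := by
  simpa [sub_eq_add_neg] using hf.add hg.neg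

theorem div (hf : IsRat f) (hg : IsRat g) : IsRat fun x => f x / g x := by
  simpa [div_eq_mul_inv] using hf.mul hg.inv

theorem pow (hf : IsRat f) (n : ℕ) : IsRat fun x => f x ^ n := by
  induction n with
  | zero => simpa using const 1
  | succ n ih => simpa [pow_succ] using ih.mul hf

theorem sum {ι : Type*} {s : Finset ι} {f : ι → ℝ → ℝ} (h : ∀ i ∈ s, IsRat (f i)) :
    IsRat fun x => ∑ i ∈ s, f i x := by
  classical
  induction s using Finset.induction_on with
  | empty => simpa using const 0
  | insert i s hi ih =>
    simp only [Finset.sum_insert hi]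
    exact (h i (Finset.mem_insert_self i s)).add
      (ih fun j hj => h j (Finset.mem_insert_of_mem hj))

theorem comp_add (hf : IsRat f) (c : ℝ) : IsRat fun x => f (x + c) := by
  obtain ⟨p, q, h, e⟩ := hf
  refine ⟨p.comp (X + C c), q.comp (X + C c), fun h0 => h ?_, fun x hx => ?_⟩
  · have := congrArg (fun r => r.comp (X - C c)) h0
    simpa [comp_assoc] using this
  · simp only [eval_comp, eval_add, eval_X, eval_C] at hx ⊢
    exact e _ hx

end IsRat

/-- Shifts of `psi` by integers differ from it by rational functions. -/
theorem psi_add_nat (m : ℕ) : ∃ r, IsRat r ∧ ∀ x, -1 < x → psi (x + m) = psi x + r x := by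
  induction m with
  | zero => exact ⟨_, IsRat.const 0, fun x _ => by simp⟩
  | succ m ih =>
    obtain ⟨r, hr, h⟩ := ih
    refine ⟨_, hr.sub ((IsRat.const (cornerFun 1)).div
      ((IsRat.id.add (IsRat.const ((m : ℝ) + 1))).pow 2)), fun x hx => ?_⟩
    have hm : (0 : ℝ) ≤ m := m.cast_nonneg
    have h1 := psi_sub_psi (b := x + m) (by linarith)
    have hne : x + (m + 1) ≠ 0 := by linarith
    rw [add_assoc] at h1
    have h2 := h x hx
    push_cast
    have h3 : cornerFun 1 / (x + (m + 1)) ^ 2 = psi (x + m) - psi (x + (m + 1)) := by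
      rw [← h1]; field_simp
    rw [h3, h2]; ring

/-- No nontrivial multiple of `psi` by a polynomial is a polynomial: otherwise the differences
`psi x - psi (x + M)`, which have double poles at `-1, …, -M`, show that the multiplier `P`
satisfies `P(-j) P(M - j) = 0` for `1 ≤ j ≤ M`. -/
theorem eq_zero_of_mul_psi_eq {P Q : ℝ[X]} {S : Set ℝ} (hS : S.Finite)
    (h : ∀ x, 0 < x → x ∉ S → P.eval x * psi x = Q.eval x) : P = 0 := by
  set κ := cornerFun 1 with hκ
  have hκ0 : κ ≠ 0 := cornerFun_one_pos.ne'
  by_contra hP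
  -- the polynomial form of the difference equation over `M` steps
  have key : ∀ i j : ℕ, P.eval (-((j : ℝ) + 1)) * P.eval (i : ℝ) = 0 := fun i j => by
    set M : ℕ := i + j + 1 with hM
    set D : ℝ[X] := ∏ m ∈ Finset.range M, (X + C ((m : ℝ) + 1)) ^ 2 with hD
    set N : ℝ[X] := ∑ l ∈ Finset.range M,
      ∏ m ∈ (Finset.range M).erase l, (X + C ((m : ℝ) + 1)) ^ 2 with hN
    have hsum : ∀ x : ℝ, 0 < x → D.eval x * (psi x - psi (x + M)) = κ * N.eval x := fun x hx => by
      have htel : psi x - psi (x + M) = ∑ l ∈ Finset.range M, κ / (x + (l + 1)) ^ 2 := by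
        have := Finset.sum_range_sub' (fun l : ℕ => psi (x + l)) M
        rw [Nat.cast_zero, add_zero] at this
        rw [← this]
        refine Finset.sum_congr rfl fun l _ => ?_
        have hl : (0 : ℝ) ≤ l := l.cast_nonneg
        have h1 := psi_sub_psi (b := x + l) (by linarith)
        have hne : x + (l + 1) ≠ 0 := by linarith
        push_cast
        rw [add_assoc] at h1
        rw [hκ, ← h1]; field_simp
      rw [htel, hN, eval_finsetSum, Finset.mul_sum, Finset.mul_sum]
      refine Finset.sum_congr rfl fun l hl => ?_
      have hne : x + (l + 1) ≠ 0 := by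
        have hl : (0 : ℝ) ≤ l := l.cast_nonneg
        linarith
      rw [hD, ← Finset.mul_prod_erase _ _ hl, eval_mul, eval_pow, eval_add, eval_X, eval_C]
      field_simp
    have hpoly : P * P.comp (X + C (M : ℝ)) * (C κ * N) =
        D * (Q * P.comp (X + C (M : ℝ)) - Q.comp (X + C (M : ℝ)) * P) := by
      refine eq_of_infinite_eval_eq _ _ (((Set.Ioi_infinite (0 : ℝ)).sdiff
        (hS.union (hS.image fun s : ℝ => s - (M : ℝ)))).mono ?_)
      rintro x ⟨hx, hxS⟩
      rw [Set.mem_union, not_or] at hxS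
      have hx0 : 0 < x := hx
      have hM0 : (0 : ℝ) ≤ M := M.cast_nonneg
      have e1 := h x hx0 hxS.1
      have e2 := h (x + M) (by linarith) fun hmem => hxS.2 ⟨x + M, hmem, by ring⟩
      have e3 := hsum x hx0
      simp only [Set.mem_ofPred_eq, eval_mul, eval_sub, eval_comp, eval_add, eval_X, eval_C]
      rw [← e1, ← e2, ← e3]
      ring
    have hj : j ∈ Finset.range M := Finset.mem_range.2 (by omega)
    have hev := congrArg (eval (-((j : ℝ) + 1))) hpoly
    have hD0 : D.eval (-((j : ℝ) + 1)) = 0 := by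
      rw [hD, ← Finset.mul_prod_erase _ _ hj]; simp
    have hN0 : N.eval (-((j : ℝ) + 1)) ≠ 0 := by
      rw [hN, eval_finsetSum, Finset.sum_eq_single_of_mem j hj]
      · rw [eval_prod, Finset.prod_ne_zero_iff]
        intro m hm
        have hmj := Finset.ne_of_mem_erase hm
        simp only [eval_pow, eval_add, eval_X, eval_C]
        refine pow_ne_zero _ fun h0 => hmj ?_
        have : (m : ℝ) = j := by linarith
        exact_mod_cast this
      · intro l _ hlj
        rw [eval_prod]
        exact Finset.prod_eq_zero (Finset.mem_erase.2 ⟨hlj.symm, hj⟩) (by simp)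
    simp only [eval_mul, hD0, zero_mul, eval_comp, eval_add, eval_X, eval_C] at hev
    have hMj : -((j : ℝ) + 1) + M = i := by rw [hM]; push_cast; ring
    rw [hMj] at hev
    exact (mul_eq_zero.1 hev).resolve_right (mul_ne_zero hκ0 hN0)
  have hroots : ∀ f : ℕ → ℝ, Function.Injective f → ∃ n, P.eval (f n) ≠ 0 := fun f hf => by
    by_contra! h0
    refine hP (eq_zero_of_infinite_isRoot P ((Set.infinite_range_of_injective hf).mono ?_))
    rintro _ ⟨n, rfl⟩
    exact h0 n
  obtain ⟨i, hi⟩ := hroots (fun n => (n : ℝ)) Nat.cast_injective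
  obtain ⟨j, hj⟩ := hroots (fun n => -((n : ℝ) + 1)) fun a b hab => by simpa using hab
  exact mul_ne_zero hj hi (key i j)

/-- The function `f` is, up to finitely many exceptions, of the form `u psi + r` with `r`
rational. -/
def PsiForm (f u : ℝ → ℝ) : Prop :=
  ∃ r, IsRat r ∧ ∃ S : Set ℝ, S.Finite ∧ ∀ x, 0 < x → x ∉ S → f x = u x * psi x + r x

namespace PsiForm
variable {f g u v : ℝ → ℝ}

theorem add (hf : PsiForm f u) (hg : PsiForm g v) :
    PsiForm (fun x => f x + g x) fun x => u x + v x := by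
  obtain ⟨r, hr, S, hS, h⟩ := hf
  obtain ⟨s, hs, T, hT, k⟩ := hg
  refine ⟨_, hr.add hs, S ∪ T, hS.union hT, fun x hx hxS => ?_⟩
  rw [Set.mem_union, not_or] at hxS
  beta_reduce
  rw [h x hx hxS.1, k x hx hxS.2]; ring

theorem mul (hf : PsiForm f u) (hv : IsRat v) :
    PsiForm (fun x => v x * f x) fun x => v x * u x := by
  obtain ⟨r, hr, S, hS, h⟩ := hf
  exact ⟨_, hv.mul hr, S, hS, fun x hx hxS => by beta_reduce; rw [h x hx hxS]; ring⟩

theorem of_isRat (hf : IsRat f) : PsiForm f fun _ => 0 :=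
  ⟨f, hf, ∅, Set.finite_empty, fun x _ _ => by ring⟩

theorem sum {ι : Type*} {s : Finset ι} {f u : ι → ℝ → ℝ} (h : ∀ i ∈ s, PsiForm (f i) (u i)) :
    PsiForm (fun x => ∑ i ∈ s, f i x) fun x => ∑ i ∈ s, u i x := by
  classical
  induction s using Finset.induction_on with
  | empty => simpa using of_isRat (IsRat.const 0)
  | insert i s hi ih =>
    simp only [Finset.sum_insert hi]
    exact (h i (Finset.mem_insert_self i s)).add
      (ih fun j hj => h j (Finset.mem_insert_of_mem hj))

theorem congr (hf : PsiForm f u) (h : ∀ x, 0 < x → g x = f x) : PsiForm g u := by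
  obtain ⟨r, hr, S, hS, k⟩ := hf
  exact ⟨r, hr, S, hS, fun x hx hxS => by rw [h x hx, k x hx hxS]⟩

theorem psi_add_nat (m : ℕ) : PsiForm (fun x => psi (x + m)) fun _ => 1 := by
  obtain ⟨r, hr, h⟩ := _root_.psi_add_nat m
  exact ⟨r, hr, ∅, Set.finite_empty, fun x hx _ => by beta_reduce; rw [h x (by linarith)]; ring⟩

/-- The coefficient of `psi` in the zero function vanishes. -/
theorem eq_zero (hf : PsiForm (fun _ => 0) u) (hu : IsRat u) :
    ∃ S : Set ℝ, S.Finite ∧ ∀ x, x ∉ S → u x = 0 := by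
  obtain ⟨r, ⟨p₁, q₁, h₁, e₁⟩, S, hS, h⟩ := hf
  obtain ⟨p₂, q₂, h₂, e₂⟩ := hu
  have hfin : ∀ q : ℝ[X], q ≠ 0 → {x | q.eval x = 0}.Finite := fun q hq =>
    (q.roots.toFinset.finite_toSet).subset fun x hx => by simpa [hq] using hx
  have := eq_zero_of_mul_psi_eq (P := p₂ * q₁) (Q := -(p₁ * q₂))
    ((hS.union (hfin q₁ h₁)).union (hfin q₂ h₂)) fun x hx hxS => by
      simp only [Set.mem_union, Set.mem_ofPred_eq, not_or] at hxS
      obtain ⟨⟨k, k₁⟩, k₂⟩ := hxS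
      have := h x hx k
      rw [e₁ x k₁, e₂ x k₂] at this
      field_simp at this
      simp only [eval_mul, eval_neg]
      linarith
  refine ⟨_, hfin q₂ h₂, fun x hx => ?_⟩
  rw [e₂ x hx, (mul_eq_zero.1 this).resolve_right h₁]
  simp

end PsiForm

/-! ### Special parameters -/

/-- `G` is a divided difference of `A · psi`, up to a function which is rational in the first
variable. -/
def PsiDiff (G : ℝ → ℝ → ℝ) (A : ℝ → ℝ) : Prop :=
  ∃ W : ℝ → ℝ → ℝ, (∀ b, IsRat fun a => W a b) ∧ ∀ a b, -1 < a → -1 < b → a ≠ b →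
    G a b = (A a * psi a - A b * psi b) / (b - a) + W a b

theorem PsiDiff.add {G H : ℝ → ℝ → ℝ} {A B : ℝ → ℝ} (h : PsiDiff G A) (k : PsiDiff H B) :
    PsiDiff (fun a b => G a b + H a b) fun a => A a + B a := by
  obtain ⟨W, hW, h⟩ := h
  obtain ⟨V, hV, k⟩ := k
  refine ⟨fun a b => W a b + V a b, fun b => (hW b).add (hV b), fun a b ha hb hab => ?_⟩
  beta_reduce
  rw [h a b ha hb hab, k a b ha hb hab]
  ring

theorem PsiDiff.const_mul {G : ℝ → ℝ → ℝ} {A : ℝ → ℝ} (h : PsiDiff G A) (c : ℝ) :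
    PsiDiff (fun a b => c * G a b) fun a => c * A a := by
  obtain ⟨W, hW, h⟩ := h
  refine ⟨fun a b => c * W a b, fun b => (IsRat.const c).mul (hW b), fun a b ha hb hab => ?_⟩
  beta_reduce
  rw [h a b ha hb hab]
  ring

/-- The values `eulerFun a 0 b 0 0 0 1 (X ^ m)` satisfy a second-order recurrence with
characteristic roots `-(a + 1)` and `-(b + 1)`. -/
theorem psiDiff_eulerFun_X_pow (m : ℕ) :
    PsiDiff (fun a b => eulerFun a 0 b 0 0 0 1 (X ^ m)) (fun a => (-(a + 1)) ^ m) ∧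
      PsiDiff (fun a b => eulerFun a 0 b 0 0 0 1 (X ^ (m + 1)))
        (fun a => (-(a + 1)) ^ (m + 1)) := by
  induction m with
  | zero =>
    have key : ∀ a b : ℝ, -1 < a → -1 < b → a ≠ b →
        eulerFun a 0 b 0 0 0 1 1 = (psi a - psi b) / (b - a) ∧
        eulerFun a 0 b 0 0 0 1 X = (-(a + 1) * psi a - -(b + 1) * psi b) / (b - a) :=
      fun a b ha hb hab => by
        have h1 := eulerFun_fst_mul ha hb 1
        have h2 := eulerFun_snd_mul ha hb 1
        rw [mul_one, ← mul_one (C (a + 1)), ← smul_eq_C_mul, eulerFun_eq_eulerLin,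
          LinearMap.map_add, LinearMap.map_smul, smul_eq_mul] at h1
        rw [mul_one, ← mul_one (C (b + 1)), ← smul_eq_C_mul, eulerFun_eq_eulerLin,
          LinearMap.map_add, LinearMap.map_smul, smul_eq_mul] at h2
        have hne : b - a ≠ 0 := sub_ne_zero.2 hab.symm
        rw [eq_div_iff hne, eq_div_iff hne]
        simp only [eulerFun_eq_eulerLin, psi, ← h1, ← h2]
        constructor <;> ring
    refine ⟨⟨fun _ _ => 0, fun _ => IsRat.const 0, fun a b ha hb hab => ?_⟩,
      fun _ _ => 0, fun _ => IsRat.const 0, fun a b ha hb hab => ?_⟩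
    · simpa using (key a b ha hb hab).1
    · simpa using (key a b ha hb hab).2
  | succ m ih =>
    refine ⟨ih.2, ?_⟩
    obtain ⟨⟨W, hW, h⟩, V, hV, k⟩ := ih
    refine ⟨fun a b => cornerFun (X ^ m) - (a + b + 2) * V a b - (a + 1) * (b + 1) * W a b,
      fun b => ?_, fun a b ha hb hab => ?_⟩
    · exact ((IsRat.const _).sub (((IsRat.id.add (IsRat.const b)).add (IsRat.const 2)).mul
        (hV b))).sub (((IsRat.id.add (IsRat.const 1)).mul (IsRat.const (b + 1))).mul (hW b))
    · have h1 := eulerFun_fst_mul ha hb ((C (b + 1) + X) * X ^ m)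
      rw [bdryFun_mul hb, show (C (a + 1) + X : ℝ[X]) * ((C (b + 1) + X) * X ^ m) =
        X ^ (m + 1 + 1) + ((a + b + 2) • X ^ (m + 1) + ((a + 1) * (b + 1)) • X ^ m) by
          simp only [smul_eq_C_mul, C_add, C_mul, C_1, C_ofNat]; ring] at h1
      simp only [eulerFun_eq_eulerLin, LinearMap.map_add, LinearMap.map_smul, smul_eq_mul] at h1
      simp only [← eulerFun_eq_eulerLin] at h1
      have h2 := h a b ha hb hab
      have h3 := k a b ha hb hab
      beta_reduce at h2 h3 ⊢
      rw [← h1, h2, h3]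
      have hne : b - a ≠ 0 := sub_ne_zero.2 hab.symm
      rw [← sub_eq_zero]
      field_simp
      ring

theorem psiDiff_eulerFun (q : ℝ[X]) :
    PsiDiff (fun a b => eulerFun a 0 b 0 0 0 1 q) fun a => q.eval (-(a + 1)) := by
  induction q using Polynomial.induction_on' with
  | add p q hp hq => simpa [eulerFun_eq_eulerLin] using hp.add hq
  | monomial n r =>
    simpa [eulerFun_eq_eulerLin, ← smul_X_eq_monomial] using
      (psiDiff_eulerFun_X_pow n).1.const_mul r

/-- The multiplier `A` of `psi` in the integral `eulerInt a 0 b 0 2 1 1`, of which the first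
shift at the special parameters is a combination. -/
def psiLead₁ (a : ℝ) : ℝ := (a + 1) * a * (a - 1) / 6

/-- The multiplier `A` of `psi` in the integral `eulerInt a 0 b 0 3 2 2`, of which the second shift
at the special parameters is a combination. -/
def psiLead₂ (a : ℝ) : ℝ := (a + 1) * a ^ 2 * (a - 1) * (a - 2) / 24

theorem psiDiff_eulerInt_one :
    PsiDiff (fun a b => eulerInt a 0 b 0 2 1 1) psiLead₁ := by
  obtain ⟨W, hW, h⟩ := (psiDiff_eulerFun (-X * ((C 1 + X) * (C 2 + X)))).const_mul (1 / 6)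
  refine ⟨W, hW, fun a b ha hb hab => ?_⟩
  have hd := eulerDom_base ha hb
  have hd1 : EulerDom a 0 b 0 0 (0 + 1) 1 := by
    refine ⟨ha, ?_, hb, ?_, ?_, ?_, ?_, ?_⟩ <;> linarith
  have hd2 : EulerDom a 0 b 0 (0 + 1) (0 + 1) 1 := by
    refine ⟨ha, ?_, hb, ?_, ?_, ?_, ?_, ?_⟩ <;> linarith
  have h1 := eulerFun_c₂_mul hd ((C (0 + 1) + X) * ((C (0 + 1 + 1) + X) * 1))
  rw [eulerFun_c₁_mul hd1, eulerFun_c₁_mul hd2, eulerFun_one,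
    show (C (0 + 1 - 1) - X : ℝ[X]) * ((C (0 + 1) + X) * ((C (0 + 1 + 1) + X) * 1)) =
      -X * ((C 1 + X) * (C 2 + X)) by norm_num] at h1
  have h2 := h a b ha hb hab
  beta_reduce at h2 ⊢
  rw [h1] at h2
  norm_num at h2
  simp only [psiLead₁]
  linear_combination h2

theorem psiDiff_eulerInt_two :
    PsiDiff (fun a b => eulerInt a 0 b 0 3 2 2) psiLead₂ := by
  obtain ⟨W, hW, h⟩ := (psiDiff_eulerFun
    ((C 1 + X) * (-X * ((C 1 + X) * ((C 2 + X) * (C 3 + X)))))).const_mul (1 / 24)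
  refine ⟨W, hW, fun a b ha hb hab => ?_⟩
  have hd0 : EulerDom a 0 b 0 0 (0 + 1) (1 + 1) := by
    refine ⟨ha, ?_, hb, ?_, ?_, ?_, ?_, ?_⟩ <;> linarith
  have hd1 : EulerDom a 0 b 0 0 (0 + 1 + 1) (1 + 1) := by
    refine ⟨ha, ?_, hb, ?_, ?_, ?_, ?_, ?_⟩ <;> linarith
  have hd2 : EulerDom a 0 b 0 (0 + 1) (0 + 1 + 1) (1 + 1) := by
    refine ⟨ha, ?_, hb, ?_, ?_, ?_, ?_, ?_⟩ <;> linarith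
  have hd3 : EulerDom a 0 b 0 (0 + 1 + 1) (0 + 1 + 1) (1 + 1) := by
    refine ⟨ha, ?_, hb, ?_, ?_, ?_, ?_, ?_⟩ <;> linarith
  have h1 := eulerFun_e_mul (a₁ := a) (a₂ := 0) (b₁ := b) (b₂ := 0) (c₁ := 0) (c₂ := 0) (e := 1)
    ((C (0 + 1 + 1 - (1 + 1)) - X) *
      ((C (0 + 1) + X) * ((C (0 + 1 + 1) + X) * ((C (0 + 1 + 1 + 1) + X) * 1))))
  rw [eulerFun_c₂_mul hd0, eulerFun_c₁_mul hd1, eulerFun_c₁_mul hd2, eulerFun_c₁_mul hd3,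
    eulerFun_one, show (C 1 + X) * ((C (0 + 1 + 1 - (1 + 1)) - X : ℝ[X]) *
      ((C (0 + 1) + X) * ((C (0 + 1 + 1) + X) * ((C (0 + 1 + 1 + 1) + X) * 1)))) =
      (C 1 + X) * (-X * ((C 1 + X) * ((C 2 + X) * (C 3 + X)))) by norm_num] at h1
  have h2 := h a b ha hb hab
  beta_reduce at h2 ⊢
  rw [h1] at h2
  norm_num at h2
  simp only [psiLead₂]
  linear_combination h2

/-- The coefficient of `psi α` in the `k`-th differences of a divided difference of `A · psi`. -/
def psiCoeff (A : ℝ → ℝ) (k : ℕ) (α β : ℝ) : ℝ :=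
  ∑ i ∈ Finset.range (k + 1), ∑ j ∈ Finset.range (k + 1),
    (-1) ^ (i + j) * (k.choose i * k.choose j) *
      (A (α + (k + i : ℕ)) / (β + (k + j : ℕ) - (α + (k + i : ℕ))))

theorem PsiDiff.psiForm {G : ℝ → ℝ → ℝ} {A : ℝ → ℝ} (h : PsiDiff G A) (hA : IsRat A) {b : ℝ}
    (hb : -1 < b) (m : ℕ) :
    PsiForm (fun x => G (x + m) b) fun x => A (x + m) / (b - (x + m)) := by
  obtain ⟨W, hW, h⟩ := h
  have hx : IsRat fun x => b - (x + m) := (IsRat.const b).sub (IsRat.id.add (IsRat.const m))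
  obtain ⟨r, hr, S, hS, k⟩ := ((PsiForm.psi_add_nat m).mul ((hA.comp_add m).div hx)).add
    (PsiForm.of_isRat (((hW b).comp_add m).sub ((IsRat.const (A b * psi b)).div hx)))
  refine ⟨r, hr, S ∪ {b - m}, hS.union (Set.finite_singleton _), fun x hx hxS => ?_⟩
  simp only [Set.mem_union, Set.mem_singleton_iff, not_or] at hxS
  have hm : (0 : ℝ) ≤ m := m.cast_nonneg
  have h1 := h (x + m) b (by linarith) hb fun h0 => hxS.2 (by linarith)
  have h2 := k x hx hxS.1
  beta_reduce at h1 h2 ⊢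
  rw [h1]
  linear_combination h2

theorem PsiDiff.psiForm_sum {G : ℝ → ℝ → ℝ} {A : ℝ → ℝ} (h : PsiDiff G A) (hA : IsRat A) {β : ℝ}
    (hβ : 0 < β) (k : ℕ) :
    PsiForm (fun x => ∑ i ∈ Finset.range (k + 1), ∑ j ∈ Finset.range (k + 1),
      (-1) ^ (i + j) * (k.choose i * k.choose j) * G (x + (k + i : ℕ)) (β + (k + j : ℕ)))
      fun x => psiCoeff A k x β :=
  PsiForm.sum fun i _ => PsiForm.sum fun j _ => (h.psiForm hA (by
    have : (0 : ℝ) ≤ (k + j : ℕ) := Nat.cast_nonneg _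
    linarith) (k + i)).mul (IsRat.const _)

theorem isRat_psiCoeff {A : ℝ → ℝ} (hA : IsRat A) (k : ℕ) (β : ℝ) :
    IsRat fun x => psiCoeff A k x β :=
  IsRat.sum fun _ _ => IsRat.sum fun _ _ => (IsRat.const _).mul
    ((hA.comp_add _).div ((IsRat.const _).sub (IsRat.id.add (IsRat.const _))))

theorem continuousAt_psiCoeff {A : ℝ → ℝ} (hA : Continuous A) (k : ℕ) {p : ℝ × ℝ}
    (hp : (k : ℝ) < |p.2 - p.1|) : ContinuousAt (fun p : ℝ × ℝ => psiCoeff A k p.1 p.2) p := by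
  unfold psiCoeff
  refine tendsto_finsetSum _ fun i hi => tendsto_finsetSum _ fun j hj => ?_
  refine Tendsto.const_mul _ (Tendsto.div ?_ ?_ fun h0 => ?_)
  · exact (hA.comp (by fun_prop : Continuous fun p : ℝ × ℝ => p.1 + ((k + i : ℕ) : ℝ))).tendsto p
  · exact (by fun_prop : Continuous fun p : ℝ × ℝ =>
      p.2 + ((k + j : ℕ) : ℝ) - (p.1 + ((k + i : ℕ) : ℝ))).tendsto p
  · have hi' : (i : ℝ) ≤ k := by exact_mod_cast Nat.lt_succ_iff.1 (Finset.mem_range.1 hi)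
    have hj' : (j : ℝ) ≤ k := by exact_mod_cast Nat.lt_succ_iff.1 (Finset.mem_range.1 hj)
    have hi0 : (0 : ℝ) ≤ i := i.cast_nonneg
    have hj0 : (0 : ℝ) ≤ j := j.cast_nonneg
    push_cast at h0
    have : p.2 - p.1 = i - j := by linarith
    rw [this] at hp
    exact absurd hp (not_lt.2 (abs_le.2 ⟨by linarith, by linarith⟩))

section differences
variable {a b : ℝ}

/-- Expansion of the powers `(1 - x)(1 - y)`. -/
theorem eulerInt_one_eq_sum (ha : 0 < a) (hb : 0 < b) :
    eulerInt (a + 1) 1 (b + 1) 1 2 1 1 = ∑ i ∈ Finset.range (1 + 1), ∑ j ∈ Finset.range (1 + 1),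
      (-1) ^ (i + j) * ((1 : ℕ).choose i * (1 : ℕ).choose j) *
        eulerInt (a + (1 + i : ℕ)) 0 (b + (1 + j : ℕ)) 0 2 1 1 := by
  have hx : ∀ a b b₂ : ℝ, 0 < a → 0 < b → 0 ≤ b₂ → eulerInt a 1 b b₂ 2 1 1 =
      eulerInt a 0 b b₂ 2 1 1 - eulerInt (a + 1) 0 b b₂ 2 1 1 := fun a b b₂ ha hb hb₂ => by
    have := eulerInt_split_fst (a₁ := a) (a₂ := 0) (b₁ := b) (b₂ := b₂) (c₁ := 2) (c₂ := 1) (e := 1)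
      (by refine ⟨?_, ?_, ?_, ?_, ?_, ?_, ?_, ?_⟩ <;> linarith)
    rw [zero_add] at this
    linarith
  have hy : ∀ a b : ℝ, 0 < a → 0 < b → eulerInt a 0 b 1 2 1 1 =
      eulerInt a 0 b 0 2 1 1 - eulerInt a 0 (b + 1) 0 2 1 1 := fun a b ha hb => by
    rw [← eulerInt_swap, hx b a 0 hb ha le_rfl, eulerInt_swap a 0 b 0, eulerInt_swap a 0 (b + 1) 0]
  rw [hx _ _ _ (by linarith) (by linarith) zero_le_one, hy _ _ (by linarith) (by linarith),
    hy _ _ (by linarith) (by linarith)]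
  simp only [Finset.sum_range_succ, Finset.sum_range_zero]
  norm_num [add_assoc]
  ring

/-- Expansion of the powers `(1 - x)²(1 - y)²`. -/
theorem eulerInt_two_eq_sum (ha : 0 < a) (hb : 0 < b) :
    eulerInt (a + 2) 2 (b + 2) 2 3 2 2 = ∑ i ∈ Finset.range (2 + 1), ∑ j ∈ Finset.range (2 + 1),
      (-1) ^ (i + j) * ((2 : ℕ).choose i * (2 : ℕ).choose j) *
        eulerInt (a + (2 + i : ℕ)) 0 (b + (2 + j : ℕ)) 0 3 2 2 := by
  have hx : ∀ a b b₂ : ℝ, 0 < a → 0 < b → 0 ≤ b₂ → eulerInt a 2 b b₂ 3 2 2 =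
      eulerInt a 0 b b₂ 3 2 2 - 2 * eulerInt (a + 1) 0 b b₂ 3 2 2
        + eulerInt (a + 2) 0 b b₂ 3 2 2 := fun a b b₂ ha hb hb₂ => by
    have h0 : ∀ a a₂ : ℝ, 0 < a → 0 ≤ a₂ → eulerInt a a₂ b b₂ 3 2 2 =
        eulerInt (a + 1) a₂ b b₂ 3 2 2 + eulerInt a (a₂ + 1) b b₂ 3 2 2 := fun a a₂ ha ha₂ =>
      eulerInt_split_fst (by refine ⟨?_, ?_, ?_, ?_, ?_, ?_, ?_, ?_⟩ <;> linarith)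
    have h1 := h0 a 0 ha le_rfl
    have h2 := h0 (a + 1) 0 (by linarith) le_rfl
    have h3 := h0 a 1 ha zero_le_one
    rw [zero_add] at h1 h2
    rw [show (1 : ℝ) + 1 = 2 by norm_num] at h3
    rw [add_assoc, show (1 : ℝ) + 1 = 2 by norm_num] at h2
    linarith
  have hy : ∀ a b : ℝ, 0 < a → 0 < b → eulerInt a 0 b 2 3 2 2 =
      eulerInt a 0 b 0 3 2 2 - 2 * eulerInt a 0 (b + 1) 0 3 2 2
        + eulerInt a 0 (b + 2) 0 3 2 2 := fun a b ha hb => by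
    rw [← eulerInt_swap, hx b a 0 hb ha le_rfl, eulerInt_swap a 0 b 0, eulerInt_swap a 0 (b + 1) 0,
      eulerInt_swap a 0 (b + 2) 0]
  rw [hx _ _ _ (by linarith) (by linarith) zero_le_two, hy _ _ (by linarith) (by linarith),
    hy _ _ (by linarith) (by linarith), hy _ _ (by linarith) (by linarith)]
  simp only [Finset.sum_range_succ, Finset.sum_range_zero]
  norm_num [add_assoc]
  ring

end differences

theorem isRat_mvPolynomial_eval {σ : Type*} (P : MvPolynomial σ ℝ) {g : σ → ℝ → ℝ}
    (hg : ∀ i, IsRat (g i)) : IsRat fun x => MvPolynomial.eval (fun i => g i x) P := by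
  induction P using MvPolynomial.induction_on with
  | C r => simpa using IsRat.const r
  | add p q hp hq => simpa using hp.add hq
  | mul_X p i hp => simpa using hp.mul (hg i)

/-- Comparison of the coefficients of `psi` in a relation with rational coefficients. -/
theorem exists_finite_psiCoeff_eq_zero {P₀ P₁ P₂ : ℝ → ℝ} (h₀ : IsRat P₀) (h₁ : IsRat P₁)
    (h₂ : IsRat P₂) {β : ℝ} (hβ : 0 < β)
    (h : ∀ α, 0 < α → P₀ α * eulerInt α 0 β 0 1 0 0 + P₁ α * eulerInt (α + 1) 1 (β + 1) 1 2 1 1 +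
      P₂ α * eulerInt (α + 2) 2 (β + 2) 2 3 2 2 = 0) :
    ∃ S : Set ℝ, S.Finite ∧ ∀ α, α ∉ S →
      P₁ α * psiCoeff psiLead₁ 1 α β + P₂ α * psiCoeff psiLead₂ 2 α β = 0 := by
  have hx : ∀ c : ℝ, IsRat fun x => x - c := fun c => IsRat.id.sub (IsRat.const c)
  have hy : ∀ c : ℝ, IsRat fun x => x + c := fun c => IsRat.id.add (IsRat.const c)
  have hA₁ : IsRat psiLead₁ := (((hy 1).mul IsRat.id).mul (hx 1)).div (IsRat.const 6)
  have hA₂ : IsRat psiLead₂ :=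
    ((((hy 1).mul (IsRat.id.pow 2)).mul (hx 1)).mul (hx 2)).div (IsRat.const 24)
  have f₁ := (psiDiff_eulerInt_one.psiForm_sum hA₁ hβ 1).mul h₁
  have f₂ := (psiDiff_eulerInt_two.psiForm_sum hA₂ hβ 2).mul h₂
  have f₀ := PsiForm.of_isRat (h₀.mul ((IsRat.const (eulerBdry β 0 1 0 0)).div (hy 1)))
  have f := (f₀.add f₁).add f₂
  have hu : IsRat fun x => 0 + P₁ x * psiCoeff psiLead₁ 1 x β + P₂ x * psiCoeff psiLead₂ 2 x β :=
    ((IsRat.const 0).add (h₁.mul (isRat_psiCoeff hA₁ 1 β))).add (h₂.mul (isRat_psiCoeff hA₂ 2 β))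
  obtain ⟨S, hS, k⟩ := (f.congr (g := fun _ => 0) fun x hx => by
    have hb := eulerInt_parts_fst_zero (a₁ := x) (b₁ := β) (b₂ := 0) (c₁ := 1) (c₂ := 0) (e := 0)
      (by refine ⟨?_, ?_, ?_, ?_, ?_, ?_, ?_, ?_⟩ <;> linarith)
    have h0 : eulerBdry β 0 1 0 0 / (x + 1) = eulerInt x 0 β 0 1 0 0 := by
      rw [← hb]
      have : x + 1 ≠ 0 := by linarith
      field_simp
      ring
    rw [h0, ← eulerInt_one_eq_sum hx hβ, ← eulerInt_two_eq_sum hx hβ]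
    exact (h x hx).symm).eq_zero hu
  exact ⟨S, hS, fun α hα => by simpa using k α hα⟩

theorem ContinuousAt.eq_zero_of_finite {f : ℝ → ℝ} {x : ℝ} (hf : ContinuousAt f x) {S : Set ℝ}
    (hS : S.Finite) (h : ∀ y, y ∉ S → f y = 0) : f x = 0 := by
  have h1 : Tendsto f (𝓝[≠] x) (𝓝 (f x)) := hf.tendsto.mono_left nhdsWithin_le_nhds
  have h2 : f =ᶠ[𝓝[≠] x] fun _ => 0 := by
    have : (S \ {x})ᶜ ∈ 𝓝 x := (hS.subset Set.sdiff_subset).isClosed.isOpen_compl.mem_nhds (by simp)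
    filter_upwards [nhdsWithin_le_nhds this, self_mem_nhdsWithin] with y hy hyx
    exact h y fun hyS => hy ⟨hyS, hyx⟩
  exact tendsto_nhds_unique h1 (tendsto_const_nhds.congr' h2.symm)

/-- At the special parameters `a₂ = b₂ = c₂ = e = 0`, `c₁ = 1` the Euler integral and its first two
shifts are linearly independent over the rational functions of the remaining two parameters. The
first of the three is rational in `α` for fixed `β`; comparing the coefficients of `psi α`, and by
symmetry those of `psi β`, gives two linear equations for the other two coefficients. -/
theorem eq_zero_of_special_relation (P : Fin 3 → MvPolynomial (Fin 2) ℝ)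
    (h : ∀ α β : ℝ, 0 < α → 0 < β →
      MvPolynomial.eval ![α, β] (P 0) * eulerInt α 0 β 0 1 0 0 +
      MvPolynomial.eval ![α, β] (P 1) * eulerInt (α + 1) 1 (β + 1) 1 2 1 1 +
      MvPolynomial.eval ![α, β] (P 2) * eulerInt (α + 2) 2 (β + 2) 2 3 2 2 = 0) (k : Fin 3) :
    P k = 0 := by
  have hcA₁ : Continuous psiLead₁ := by unfold psiLead₁; fun_prop
  have hcA₂ : Continuous psiLead₂ := by unfold psiLead₂; fun_prop
  have hcP : ∀ k, Continuous fun p : ℝ × ℝ => MvPolynomial.eval ![p.1, p.2] (P k) := fun k =>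
    (MvPolynomial.continuous_eval (P k)).comp (by
      refine continuous_pi fun i => ?_
      fin_cases i <;> simp <;> fun_prop)
  have hratl : ∀ β k, IsRat fun α => MvPolynomial.eval ![α, β] (P k) := fun β k => by
    have e : ∀ x : ℝ, ![x, β] = fun i => (![fun x => x, fun _ => β] : Fin 2 → ℝ → ℝ) i x :=
      fun x => by funext i; fin_cases i <;> rfl
    have := isRat_mvPolynomial_eval (P k) (g := ![fun x => x, fun _ => β]) fun i => by
      fin_cases i
      · exact IsRat.id
      · exact IsRat.const β
    rwa [show (fun α => MvPolynomial.eval ![α, β] (P k)) = _ from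
      funext fun x => congrArg (fun v => MvPolynomial.eval v (P k)) (e x)]
  have hratr : ∀ α k, IsRat fun β => MvPolynomial.eval ![α, β] (P k) := fun α k => by
    have e : ∀ x : ℝ, ![α, x] = fun i => (![fun _ => α, fun x => x] : Fin 2 → ℝ → ℝ) i x :=
      fun x => by funext i; fin_cases i <;> rfl
    have := isRat_mvPolynomial_eval (P k) (g := ![fun _ => α, fun x => x]) fun i => by
      fin_cases i
      · exact IsRat.const α
      · exact IsRat.id
    rwa [show (fun β => MvPolynomial.eval ![α, β] (P k)) = _ from
      funext fun x => congrArg (fun v => MvPolynomial.eval v (P k)) (e x)]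
  have hl : ∀ α β : ℝ, 0 < α → 0 < β → 2 < |β - α| →
      MvPolynomial.eval ![α, β] (P 1) * psiCoeff psiLead₁ 1 α β +
        MvPolynomial.eval ![α, β] (P 2) * psiCoeff psiLead₂ 2 α β = 0 := fun α β hα hβ hαβ => by
    obtain ⟨S, hS, k⟩ := exists_finite_psiCoeff_eq_zero (hratl β 0) (hratl β 1) (hratl β 2) hβ
      fun α hα => h α β hα hβ
    have c : ContinuousAt (fun x : ℝ => (x, β)) α := by fun_prop
    refine ContinuousAt.eq_zero_of_finite (f := fun α =>
      MvPolynomial.eval ![α, β] (P 1) * psiCoeff psiLead₁ 1 α β +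
        MvPolynomial.eval ![α, β] (P 2) * psiCoeff psiLead₂ 2 α β) ?_ hS k
    exact (((hcP 1).continuousAt.comp c).mul (ContinuousAt.comp (f := fun x : ℝ => (x, β))
      (continuousAt_psiCoeff hcA₁ 1 (by norm_num; linarith)) c)).add
      (((hcP 2).continuousAt.comp c).mul (ContinuousAt.comp (f := fun x : ℝ => (x, β))
      (continuousAt_psiCoeff hcA₂ 2 (by norm_num; linarith)) c))
  have hr : ∀ α β : ℝ, 0 < α → 0 < β → 2 < |β - α| →
      MvPolynomial.eval ![α, β] (P 1) * psiCoeff psiLead₁ 1 β α +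
        MvPolynomial.eval ![α, β] (P 2) * psiCoeff psiLead₂ 2 β α = 0 := fun α β hα hβ hαβ => by
    obtain ⟨S, hS, k⟩ := exists_finite_psiCoeff_eq_zero (hratr α 0) (hratr α 1) (hratr α 2) hα
      fun β hβ => by
        have := h α β hα hβ
        rwa [← eulerInt_swap, ← eulerInt_swap (α + 1), ← eulerInt_swap (α + 2)] at this
    rw [abs_sub_comm] at hαβ
    have c : ContinuousAt (fun x : ℝ => (α, x)) β := by fun_prop
    have c' : ContinuousAt (fun x : ℝ => (x, α)) β := by fun_prop
    refine ContinuousAt.eq_zero_of_finite (f := fun β =>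
      MvPolynomial.eval ![α, β] (P 1) * psiCoeff psiLead₁ 1 β α +
        MvPolynomial.eval ![α, β] (P 2) * psiCoeff psiLead₂ 2 β α) ?_ hS k
    exact (((hcP 1).continuousAt.comp c).mul (ContinuousAt.comp (f := fun x : ℝ => (x, α))
      (continuousAt_psiCoeff hcA₁ 1 (by norm_num; linarith)) c')).add
      (((hcP 2).continuousAt.comp c).mul (ContinuousAt.comp (f := fun x : ℝ => (x, α))
      (continuousAt_psiCoeff hcA₂ 2 (by norm_num; linarith)) c'))
  -- the determinant of the coefficients of `psi α` and `psi β` does not vanish near `(1, 9)`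
  set D : ℝ × ℝ → ℝ := fun p => psiCoeff psiLead₁ 1 p.1 p.2 * psiCoeff psiLead₂ 2 p.2 p.1 -
    psiCoeff psiLead₂ 2 p.1 p.2 * psiCoeff psiLead₁ 1 p.2 p.1 with hD
  have hD0 : D (1, 9) ≠ 0 := by
    simp only [hD, psiCoeff, psiLead₁, psiLead₂, Finset.sum_range_succ, Finset.sum_range_zero]
    norm_num [Nat.choose]
  have hDc : ContinuousAt D (1, 9) := by
    have s : ContinuousAt (fun p : ℝ × ℝ => (p.2, p.1)) (1, 9) := by fun_prop
    have e₁ : ((1 : ℕ) : ℝ) < |(9 : ℝ) - 1| := by norm_num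
    have e₂ : ((2 : ℕ) : ℝ) < |(9 : ℝ) - 1| := by norm_num
    have e₁' : ((1 : ℕ) : ℝ) < |(1 : ℝ) - 9| := by norm_num
    have e₂' : ((2 : ℕ) : ℝ) < |(1 : ℝ) - 9| := by norm_num
    exact ((continuousAt_psiCoeff hcA₁ 1 e₁).mul (ContinuousAt.comp
      (f := fun p : ℝ × ℝ => (p.2, p.1)) (continuousAt_psiCoeff hcA₂ 2 e₂') s)).sub
      ((continuousAt_psiCoeff hcA₂ 2 e₂).mul (ContinuousAt.comp
      (f := fun p : ℝ × ℝ => (p.2, p.1)) (continuousAt_psiCoeff hcA₁ 1 e₁') s))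
  obtain ⟨ε, hε, hball⟩ := Metric.eventually_nhds_iff.1 (hDc.eventually_ne hD0)
  set s : Fin 2 → Set ℝ := ![Metric.ball 1 (min ε 1), Metric.ball 9 (min ε 1)] with hs
  have hinf : ∀ i, (s i).Infinite := fun i => by
    have : ∀ x : ℝ, (Metric.ball x (min ε 1)).Infinite := fun x => by
      rw [Real.ball_eq_Ioo]
      exact Set.Ioo_infinite (by have : 0 < min ε 1 := by positivity
                                 linarith)
    fin_cases i <;> exact this _
  have hzero : ∀ k : Fin 3, (∀ x ∈ Set.pi Set.univ s, MvPolynomial.eval x (P k) = 0) → P k = 0 :=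
    fun k hk => MvPolynomial.funext_set s hinf fun x hx => by rw [hk x hx, map_zero]
  have hmem : ∀ x ∈ Set.pi Set.univ s, ∃ α β : ℝ, x = ![α, β] ∧ 0 < α ∧ 0 < β ∧ 2 < |β - α| ∧
      D (α, β) ≠ 0 := fun x hx => by
    have h0 : x 0 ∈ Metric.ball (1 : ℝ) (min ε 1) := hx 0 trivial
    have h1 : x 1 ∈ Metric.ball (9 : ℝ) (min ε 1) := hx 1 trivial
    rw [Metric.mem_ball, lt_min_iff] at h0 h1
    have b0 := abs_lt.1 (Real.dist_eq _ _ ▸ h0.2)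
    have b1 := abs_lt.1 (Real.dist_eq _ _ ▸ h1.2)
    refine ⟨x 0, x 1, ?_, by linarith, by linarith, ?_, hball ?_⟩
    · funext i; fin_cases i <;> rfl
    · rw [abs_of_pos (by linarith)]; linarith
    · rw [Prod.dist_eq]; exact max_lt h0.1 h1.1
  have hP1 : P 1 = 0 := hzero 1 fun x hx => by
    obtain ⟨α, β, rfl, hα, hβ, hαβ, hne⟩ := hmem x hx
    refine (mul_eq_zero.1 ?_).resolve_right hne
    simp only [hD]
    linear_combination psiCoeff psiLead₂ 2 β α * hl α β hα hβ hαβ -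
      psiCoeff psiLead₂ 2 α β * hr α β hα hβ hαβ
  have hP2 : P 2 = 0 := hzero 2 fun x hx => by
    obtain ⟨α, β, rfl, hα, hβ, hαβ, hne⟩ := hmem x hx
    refine (mul_eq_zero.1 ?_).resolve_right hne
    simp only [hD]
    linear_combination psiCoeff psiLead₁ 1 α β * hr α β hα hβ hαβ -
      psiCoeff psiLead₁ 1 β α * hl α β hα hβ hαβ
  have hP0 : P 0 = 0 := hzero 0 fun x hx => by
    obtain ⟨α, β, rfl, hα, hβ, hαβ, hne⟩ := hmem x hx
    have := h α β hα hβ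
    rw [hP1, hP2, map_zero, zero_mul, zero_mul, add_zero, add_zero] at this
    refine (mul_eq_zero.1 this).resolve_right (eulerInt_pos ?_).ne'
    refine ⟨?_, ?_, ?_, ?_, ?_, ?_, ?_, ?_⟩ <;> linarith
  fin_cases k
  exacts [hP0, hP1, hP2]

/-! ### Absence of a second-order recurrence -/

/-- Finitely many polynomials, not all zero, become not all zero at `0` after division by a common
power of the variable. -/
theorem exists_eq_X_pow_mul {ι R : Type*} [CommRing R] (f : ι → R[X]) (h : ∃ k, f k ≠ 0) :
    ∃ (N : ℕ) (g : ι → R[X]), (∀ k, f k = X ^ N * g k) ∧ ∃ k, (g k).coeff 0 ≠ 0 := by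
  classical
  have hex : ∃ N k, (f k).coeff N ≠ 0 := by
    obtain ⟨k, hk⟩ := h
    by_contra! h0
    exact hk (Polynomial.ext fun n => h0 n k)
  obtain ⟨k, hk⟩ := Nat.find_spec hex
  have hdvd : ∀ k, X ^ Nat.find hex ∣ f k := fun k => X_pow_dvd_iff.2 fun d hd => by
    have := Nat.find_min hex hd
    push Not at this
    exact this k
  choose g hg using hdvd
  refine ⟨_, g, hg, k, fun h0 => hk ?_⟩
  rw [hg k, ← zero_add (Nat.find hex), coeff_X_pow_mul', zero_add]
  simpa using h0

theorem analyticOnNhd_mvPolynomial_eval {σ : Type*} (P : MvPolynomial σ ℝ) {g : σ → ℝ → ℝ}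
    {I : Set ℝ} (hg : ∀ i, AnalyticOnNhd ℝ (g i) I) :
    AnalyticOnNhd ℝ (fun x => MvPolynomial.eval (fun i => g i x) P) I := by
  induction P using MvPolynomial.induction_on with
  | C r => simpa using analyticOnNhd_const
  | add p q hp hq => simp only [map_add]; exact hp.add hq
  | mul_X p i hp => simp only [map_mul, MvPolynomial.eval_X]; exact hp.mul (hg i)

/-- The Euler integral and its first two shifts are linearly independent over the polynomials in the
seven parameters: a relation can be specialised to the parameters of `eq_zero_of_special_relation`,
along a line on which it does not vanish identically. -/
theorem eq_zero_of_relation (T : Fin 3 → MvPolynomial (Fin 7) ℝ)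
    (h : ∀ a₁ a₂ b₁ b₂ c₁ c₂ e : ℝ, Admissible a₁ a₂ b₁ b₂ c₁ c₂ e →
      ∑ k : Fin 3, MvPolynomial.eval ![a₁, a₂, b₁, b₂, c₁, c₂, e] (T k) *
        diagInt a₁ a₂ b₁ b₂ c₁ c₂ (e + 1) (k : ℕ) = 0) (k : Fin 3) : T k = 0 := by
  by_contra hk
  obtain ⟨x, hx⟩ : ∃ x, MvPolynomial.eval x (T k) ≠ 0 := by
    by_contra! h0
    exact hk (MvPolynomial.funext fun x => by rw [h0, map_zero])
  -- for `α = x 0`, `β = x 2` the line joins the special parameters, at `t = 0`, to `x`, at `t = 1`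
  set u : Fin 7 → MvPolynomial (Fin 2) ℝ :=
    ![MvPolynomial.X 0, 0, MvPolynomial.X 1, 0, 1, 0, -1] with hu
  set v : Fin 7 → ℝ := ![0, x 1, 0, x 3, x 4 - 1, x 5, x 6 + 1] with hv
  set φ : MvPolynomial (Fin 7) ℝ →ₐ[ℝ] (MvPolynomial (Fin 2) ℝ)[X] :=
    MvPolynomial.aeval fun i => C (u i) + X * C (MvPolynomial.C (v i)) with hφ
  have hφeval : ∀ (y : Fin 2 → ℝ) (t : ℝ) (p : MvPolynomial (Fin 7) ℝ),
      eval₂ (MvPolynomial.eval y) t (φ p) =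
        MvPolynomial.eval (fun i => MvPolynomial.eval y (u i) + t * v i) p := fun y t p => by
    induction p using MvPolynomial.induction_on with
    | C a =>
      rw [MvPolynomial.eval_C, hφ, MvPolynomial.aeval_C, Polynomial.algebraMap_apply, eval₂_C,
        MvPolynomial.algebraMap_eq, MvPolynomial.eval_C]
    | add p q hp hq => rw [map_add, eval₂_add, hp, hq, map_add]
    | mul_X p i hp =>
      rw [map_mul, eval₂_mul, hp, map_mul, MvPolynomial.eval_X, hφ, MvPolynomial.aeval_X, eval₂_add,
        eval₂_mul, eval₂_C, eval₂_C, eval₂_X, MvPolynomial.eval_C]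
  have hline : ∀ α β t : ℝ, (fun i => MvPolynomial.eval ![α, β] (u i) + t * v i) =
      ![α, t * x 1, β, t * x 3, 1 + t * (x 4 - 1), t * x 5, -1 + t * (x 6 + 1)] := fun α β t => by
    funext i
    fin_cases i <;> simp [hu, hv]
  obtain ⟨N, g, hg, k₀, hk₀⟩ := exists_eq_X_pow_mul (fun k => φ (T k)) ⟨k, fun h0 => hx (by
    have h1 := hφeval ![x 0, x 2] 1 (T k)
    rw [h0, eval₂_zero, hline] at h1
    rw [h1]
    refine congrArg (fun w => MvPolynomial.eval w (T k)) (funext fun i => ?_)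
    fin_cases i <;> simp)⟩
  refine hk₀ (eq_zero_of_special_relation (fun k => (g k).coeff 0) (fun α β hα hβ => ?_) k₀)
  -- the relation holds for small parameters on the line, and therefore at `0`
  have hadm : ∀ᶠ t : ℝ in 𝓝 0, Admissible α (t * x 1) β (t * x 3) (1 + t * (x 4 - 1)) (t * x 5)
      (-1 + t * (x 6 + 1)) := by
    have hlt : ∀ f₁ f₂ : ℝ → ℝ, Continuous f₁ → Continuous f₂ → f₁ 0 < f₂ 0 →
        ∀ᶠ t in 𝓝 0, f₁ t < f₂ t := fun f₁ f₂ c₁ c₂ h0 => (isOpen_lt c₁ c₂).mem_nhds h0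
    refine (hlt _ _ ?_ ?_ ?_).and <| (hlt _ _ ?_ ?_ ?_).and <| (hlt _ _ ?_ ?_ ?_).and <|
      (hlt _ _ ?_ ?_ ?_).and <| (hlt _ _ ?_ ?_ ?_).and <| (hlt _ _ ?_ ?_ ?_).and <|
      (hlt _ _ ?_ ?_ ?_).and <| hlt _ _ ?_ ?_ ?_ <;> first | fun_prop | (norm_num <;> linarith)
  obtain ⟨I, hI, hIo, hI0⟩ := eventually_nhds_iff.1 hadm
  have hF : ∀ k : ℕ, Tendsto (fun t => diagInt α (t * x 1) β (t * x 3) (1 + t * (x 4 - 1)) (t * x 5)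
      (-1 + t * (x 6 + 1) + 1) k) (𝓝 0) (𝓝 (diagInt α 0 β 0 1 0 0 k)) := fun k => by
    have hshape : ∀ t : ℝ, diagInt α (t * x 1) β (t * x 3) (1 + t * (x 4 - 1)) (t * x 5)
        (-1 + t * (x 6 + 1) + 1) k = eulerInt (α + k + t * 0) (k + t * x 1) (β + k + t * 0)
          (k + t * x 3) (1 + k + t * (x 4 - 1)) (k + t * x 5) (k + t * (x 6 + 1)) := fun t => by
      rw [diagInt]; congr 1 <;> ring
    have han := analyticOnNhd_eulerInt (α + k) k (β + k) k (1 + k) k k 0 (x 1) 0 (x 3) (x 4 - 1)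
      (x 5) (x 6 + 1) hIo fun t ht => by
        have := (hI t ht).eulerDom (Nat.cast_nonneg (α := ℝ) k)
        obtain ⟨h1, h2, h3, h4, h5, h6, h7, h8⟩ := this
        refine ⟨?_, ?_, ?_, ?_, ?_, ?_, ?_, ?_⟩ <;> linarith
    have := (han 0 hI0).continuousAt.tendsto
    simp only [hshape]
    convert! this using 2
    rw [diagInt]; congr 1 <;> ring
  have hlim : Tendsto (fun t => ∑ k : Fin 3, eval₂ (MvPolynomial.eval ![α, β]) t (g k) *
      diagInt α (t * x 1) β (t * x 3) (1 + t * (x 4 - 1)) (t * x 5) (-1 + t * (x 6 + 1) + 1)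
        (k : ℕ)) (𝓝[≠] 0)
      (𝓝 (∑ k : Fin 3, MvPolynomial.eval ![α, β] ((g k).coeff 0) *
        diagInt α 0 β 0 1 0 0 (k : ℕ))) := by
    refine Tendsto.mono_left ?_ nhdsWithin_le_nhds
    refine tendsto_finsetSum _ fun k _ => Tendsto.mul ?_ (hF (k : ℕ))
    have hc : Continuous fun t => eval₂ (MvPolynomial.eval ![α, β]) t (g k) := by
      simp only [← eval_map]
      exact Polynomial.continuous _
    have := hc.tendsto 0
    rwa [eval₂_at_zero] at this
  have hz : ∑ k : Fin 3, MvPolynomial.eval ![α, β] ((g k).coeff 0) *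
      diagInt α 0 β 0 1 0 0 (k : ℕ) = 0 := by
    refine tendsto_nhds_unique hlim (tendsto_const_nhds.congr' ?_)
    filter_upwards [nhdsWithin_le_nhds (hIo.mem_nhds hI0), self_mem_nhdsWithin] with t ht ht0
    have h1 := h _ _ _ _ _ _ _ (hI t ht)
    simp only [← hline, ← hφeval, hg, eval₂_mul, eval₂_pow, eval₂_X, mul_assoc] at h1
    rw [← Finset.mul_sum] at h1
    exact ((mul_eq_zero.1 h1).resolve_left (pow_ne_zero _ ht0)).symm
  rw [Fin.sum_univ_three] at hz
  simp only [diagInt, Fin.val_zero, Fin.val_one, Fin.val_two, Nat.cast_zero, Nat.cast_one,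
    Nat.cast_ofNat, add_zero, zero_add] at hz
  norm_num at hz
  exact hz

/-- There is no second-order recurrence for the seven-parameter family. -/
theorem eq_zero_of_second_order_recurrence (S : Fin 3 → MvPolynomial (Fin 8) ℝ)
    (hS : ∀ a₁ a₂ b₁ b₂ c₁ c₂ e : ℝ, Admissible a₁ a₂ b₁ b₂ c₁ c₂ e → ∀ n : ℕ,
      ∑ k : Fin 3, MvPolynomial.eval ![a₁, a₂, b₁, b₂, c₁, c₂, e, (n : ℝ)] (S k) *
        I3 a₁ a₂ b₁ b₂ c₁ c₂ e (n + k) = 0) (k : Fin 3) : S k = 0 := by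
  -- for a fixed index the substitution `p ↦ p - n` gives a relation of the preceding kind
  have hT : ∀ (n : ℕ) (k : Fin 3) (a₁ a₂ b₁ b₂ c₁ c₂ e : ℝ),
      MvPolynomial.eval ![a₁, a₂, b₁, b₂, c₁, c₂, e, (n : ℝ)] (S k) = 0 := fun n => by
    set g : Fin 8 → MvPolynomial (Fin 7) ℝ := ![MvPolynomial.X 0 - MvPolynomial.C (n : ℝ),
      MvPolynomial.X 1 - MvPolynomial.C (n : ℝ), MvPolynomial.X 2 - MvPolynomial.C (n : ℝ),
      MvPolynomial.X 3 - MvPolynomial.C (n : ℝ), MvPolynomial.X 4 - MvPolynomial.C (n : ℝ),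
      MvPolynomial.X 5 - MvPolynomial.C (n : ℝ), MvPolynomial.X 6 - MvPolynomial.C (n : ℝ),
      MvPolynomial.C (n : ℝ)] with hgdef
    have hsub : ∀ (a₁ a₂ b₁ b₂ c₁ c₂ e : ℝ) (k : Fin 3),
        MvPolynomial.eval ![a₁, a₂, b₁, b₂, c₁, c₂, e] (MvPolynomial.aeval g (S k)) =
        MvPolynomial.eval ![a₁ - n, a₂ - n, b₁ - n, b₂ - n, c₁ - n, c₂ - n, e - n, (n : ℝ)] (S k) :=
      fun a₁ a₂ b₁ b₂ c₁ c₂ e k => by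
        rw [mvPolynomial_eval_aeval]
        refine congrArg (fun w => MvPolynomial.eval w (S k)) (funext fun i => ?_)
        fin_cases i <;> simp [hgdef]
    have hzero := eq_zero_of_relation (fun k => MvPolynomial.aeval g (S k))
      fun a₁ a₂ b₁ b₂ c₁ c₂ e hadm => ?_
    · intro k a₁ a₂ b₁ b₂ c₁ c₂ e
      have := hsub (a₁ + n) (a₂ + n) (b₁ + n) (b₂ + n) (c₁ + n) (c₂ + n) (e + n) k
      have h0 := hzero k
      beta_reduce at h0
      rw [h0, map_zero] at this
      simpa only [add_sub_cancel_right] using this.symm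
    · have hdom : EulerDom a₁ a₂ b₁ b₂ c₁ c₂ (e + 1) := by simpa using hadm.eulerDom le_rfl
      obtain ⟨r, hr, hdiag⟩ := hdom.exists_diag
      -- far out on the diagonal the parameters `p + t - n` are admissible
      have hA := analyticOnNhd_diagInt hdiag
      have hP : ∀ k : Fin 3, AnalyticOnNhd ℝ (fun t => MvPolynomial.eval
          ![a₁ + t, a₂ + t, b₁ + t, b₂ + t, c₁ + t, c₂ + t, e + t] (MvPolynomial.aeval g (S k)) *
          diagInt a₁ a₂ b₁ b₂ c₁ c₂ (e + 1) (t + (k : ℕ))) (Set.Ioi (-r)) := fun k => by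
        refine AnalyticOnNhd.mul ?_ ?_
        · have := analyticOnNhd_mvPolynomial_eval (MvPolynomial.aeval g (S k)) (I := Set.Ioi (-r))
            (g := fun i t => ![a₁, a₂, b₁, b₂, c₁, c₂, e] i + t)
            fun i => fun t _ => by fun_prop
          convert! this using 4 with t
          funext i
          fin_cases i <;> rfl
        · refine hA.comp (t := Set.Ioi (-r)) (f := fun t => t + ((k : ℕ) : ℝ))
            (fun t _ => by fun_prop) fun t ht => ?_
          have : (0 : ℝ) ≤ (k : ℕ) := Nat.cast_nonneg _
          rw [Set.mem_Ioi] at ht ⊢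
          linarith
      have hsum := ((hP 0).add (hP 1)).add (hP 2)
      have hev := AnalyticOnNhd.eq_zero_of_eventually hsum (t := 0) ?_ (by linarith)
      · rw [Fin.sum_univ_three]
        simpa using hev
      · filter_upwards [eventually_ge_atTop (n : ℝ)] with t ht
        have hadm' : Admissible (a₁ + t - n) (a₂ + t - n) (b₁ + t - n) (b₂ + t - n) (c₁ + t - n)
            (c₂ + t - n) (e + t - n) := by
          obtain ⟨h1, h2, h3, h4, h5, h6, h7, h8⟩ := hadm
          refine ⟨?_, ?_, ?_, ?_, ?_, ?_, ?_, ?_⟩ <;> linarith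
        have h1 := hS _ _ _ _ _ _ _ hadm' n
        simp only [I3, mul_div_assoc', ← Finset.sum_div] at h1
        have h2 := (div_eq_zero_iff.1 h1).resolve_right hadm'.J3_pos.ne'
        simp only [← hsub] at h2
        have h3 : ∀ k : ℕ, J3 (a₁ + t - n) (a₂ + t - n) (b₁ + t - n) (b₂ + t - n) (c₁ + t - n)
            (c₂ + t - n) (e + t - n + 1) (n + k) = diagInt a₁ a₂ b₁ b₂ c₁ c₂ (e + 1) (t + k) :=
          fun k => by
            rw [J3_eq_eulerInt, diagInt]
            push_cast
            congr 1 <;> ring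
        simp only [h3, Fin.sum_univ_three] at h2
        exact h2
  refine MvPolynomial.funext_set (fun i => if i = 7 then Set.range ((↑) : ℕ → ℝ) else Set.univ)
    (fun i => ?_) fun y hy => ?_
  · split_ifs
    · exact Set.infinite_range_of_injective Nat.cast_injective
    · exact Set.infinite_univ
  · obtain ⟨n, hn⟩ : y 7 ∈ Set.range ((↑) : ℕ → ℝ) := by simpa using hy 7 trivial
    have := hT n k (y 0) (y 1) (y 2) (y 3) (y 4) (y 5) (y 6)
    rw [map_zero, ← this, hn]
    refine congrArg (fun w => MvPolynomial.eval w (S k)) (funext fun i => ?_)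
    fin_cases i <;> rfl

end

theorem mainTheorem2 :
    -- inside the admissible range everything that is written down is well defined
    (∀ a₁ a₂ b₁ b₂ c₁ c₂ e : ℝ, Admissible a₁ a₂ b₁ b₂ c₁ c₂ e →
      (∀ n : ℕ, IntegrableOn (J3Integrand a₁ a₂ b₁ b₂ c₁ c₂ (e + 1) n) unitCube) ∧
      IntegrableOn (J3Integrand a₁ a₂ b₁ b₂ c₁ c₂ e 0) unitCube ∧
      0 < J3 a₁ a₂ b₁ b₂ c₁ c₂ e 0) ∧
    -- the seven-parameter family satisfies a third-order recurrence
    (∃ R : Fin 4 → MvPolynomial (Fin 8) ℤ, R 0 ≠ 0 ∧ R 3 ≠ 0 ∧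
      ∀ a₁ a₂ b₁ b₂ c₁ c₂ e : ℝ, Admissible a₁ a₂ b₁ b₂ c₁ c₂ e → ∀ n : ℕ,
        ∑ k : Fin 4, MvPolynomial.aeval ![a₁, a₂, b₁, b₂, c₁, c₂, e, (n : ℝ)] (R k) *
          I3 a₁ a₂ b₁ b₂ c₁ c₂ e (n + k) = 0) ∧
    -- but no second-order one
    (∀ S : Fin 3 → MvPolynomial (Fin 8) ℝ,
      (∀ a₁ a₂ b₁ b₂ c₁ c₂ e : ℝ, Admissible a₁ a₂ b₁ b₂ c₁ c₂ e → ∀ n : ℕ,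
        ∑ k : Fin 3, MvPolynomial.eval ![a₁, a₂, b₁, b₂, c₁, c₂, e, (n : ℝ)] (S k) *
          I3 a₁ a₂ b₁ b₂ c₁ c₂ e (n + k) = 0) →
      ∀ k, S k = 0) ∧
    -- the five-parameter family satisfies a second-order recurrence
    ∃ P : Fin 3 → MvPolynomial (Fin 6) ℤ,
      (∀ a b c d e : ℝ, Admissible b c e a a c d →
        (∀ n : ℕ, ∑ k : Fin 3, MvPolynomial.aeval ![a, b, c, d, e, (n : ℝ)] (P k) *
          KFamily a b c d e (n + k) = 0) ∧
        (∀ᶠ n : ℕ in atTop, MvPolynomial.aeval ![a, b, c, d, e, (n : ℝ)] (P 0) ≠ 0 ∧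
          MvPolynomial.aeval ![a, b, c, d, e, (n : ℝ)] (P 2) ≠ 0) ∧
        (Nondegenerate a b c d e → ∀ n : ℕ,
          MvPolynomial.aeval ![a, b, c, d, e, (n : ℝ)] (P 0) ≠ 0 ∧
          MvPolynomial.aeval ![a, b, c, d, e, (n : ℝ)] (P 2) ≠ 0)) ∧
      -- which yields rational approximations to the constants `K(a,b,c,d,e)(0)`
      (∀ a b c d e : ℚ, Admissible (b : ℝ) c e a a c d → Nondegenerate (a : ℝ) b c d e →
        ∃ A B : ℕ → ℚ,
          (∀ n : ℕ, ∑ k : Fin 3,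
            MvPolynomial.aeval ![a, b, c, d, e, (n : ℚ)] (P k) * A (n + k) = 0) ∧
          (∀ n : ℕ, ∑ k : Fin 3,
            MvPolynomial.aeval ![a, b, c, d, e, (n : ℚ)] (P k) * B (n + k) = 0) ∧
          (∀ n : ℕ, KFamily (a : ℝ) b c d e n =
            (B n : ℝ) * KFamily (a : ℝ) b c d e 0 - (A n : ℝ)) ∧
          Tendsto (fun n : ℕ => (A n : ℝ) / (B n : ℝ)) atTop
            (𝓝 (KFamily (a : ℝ) b c d e 0))) := by
  refine ⟨fun a₁ a₂ b₁ b₂ c₁ c₂ e h => ⟨h.integrableOn_J3Integrand,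
    h.integrableOn_J3Integrand_zero, h.J3_pos⟩, ?_, ?_, kPoly, ?_, ?_⟩
  · exact exists_third_order_recurrence eq_zero_of_second_order_recurrence
  · exact eq_zero_of_second_order_recurrence
  · intro a b c d e h
    simp only [aeval_kPoly]
    exact ⟨KFamily_recurrence h,
      (eventually_recCoeff_two_ne_zero h).mono fun n hn => ⟨(recCoeff_zero_pos h n).ne', hn⟩,
      fun hnd n => ⟨(recCoeff_zero_pos h n).ne', hnd.recCoeff_two_ne_zero h n⟩⟩
  · intro a b c d e h hnd
    simp only [aeval_kPoly]
    exact exists_rat_approx h hnd
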